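/- **Theorem 6.3.** Let $k\ge 1$, $r\ge 2$ be integers and let $q_1,q_2,q_3\in\mathbb C$ satisfy $q_1q_2q_3=1$ and the resonance condition $q_1^{1-r}q_3^{k+1}=1$; assume moreover that, for integers $n,m$, $q_1^nq_3^m=1$ holds if and only if $n=(1-r)\alpha$, $m=(k+1)\alpha$ for some integer $\alpha$. Let $u\in\mathbb C$, $u\neq 0$, and let $c=(c_1,\dots,c_{k-1})$ be integers with $0=c_0\le c_1\le\dots\le c_{k-1}\le r$. *The algebra.* Put $g(z,w)=(z-q_1w)(z-q_2w)(z-q_3w)$, $\delta(z)=\sum_{n\in\mathbb Z}z^n$. Let $\mathcal E$ be the associative unital $\mathbb C$-algebra generated by $e_i,f_i$ ($i\in\mathbb Z$), $\psi^+_j,\psi^-_{-j}$ ($j>0$) and $(\psi_0^\pm)^{\pm1}$, with generating series $e(z)=\sum_i e_iz^{-i}$, $f(z)=\sum_i f_iz^{-i}$, $\psi^\pm(z)=\sum_{\pm i\ge0}\psi^\pm_iz^{-i}$ and relations (read coefficientwise) $$g(z,w)e(z)e(w)=-g(w,z)e(w)e(z),\qquad g(w,z)f(z)f(w)=-g(z,w)f(w)f(z),$$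 $$g(z,w)\psi^\pm(z)e(w)=-g(w,z)e(w)\psi^\pm(z),\qquad g(w,z)\psi^\pm(z)f(w)=-g(z,w)f(w)\psi^\pm(z),$$ $$[e(z),f(w)]=\frac{\delta(z/w)}{g(1,1)}\bigl(\psi^+(z)-\psi^-(z)\bigr),\qquad [\psi^\pm_i,\psi^\pm_j]=[\psi^\pm_i,\psi^\mp_j]=0,$$ $$\psi_0^\pm(\psi_0^\pm)^{-1}=(\psi_0^\pm)^{-1}\psi_0^\pm=1,\qquad [e_0,[e_1,e_{-1}]]=[f_0,[f_1,f_{-1}]]=0.$$ An $\mathcal E$-module has level $(l_+,l_-)$ if $\psi^\pm_0$ act by the scalars $l_\pm$. *Finite tensor products.* For a rational function $\gamma(z)$ regular at $0$ and $\infty$, let $\gamma^+(z)$ and $\gamma^-(z)$ be its expansions at $z=\infty$ and at $z=0$. Let $V^N(u)$ be the space with basis $[u_1]_{a_1}\otimes\cdots\otimes[u_N]_{a_N}$, $a\in\mathbb Z^N$, where $u_s=uq_2^{-s+1}$. With $\gamma_{i,v}(z)=\frac{(1-q_3q_1^iv/z)(1-q_2q_1^iv/z)}{(1-q_1^{i-1}v/z)(1-q_1^iv/z)}$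 and $[\mathbf u]_a=[u_1]_{a_1}\otimes\cdots\otimes[u_N]_{a_N}$, put $$(1-q_1)e(z)[\mathbf u]_a=\sum_{s=1}^N\Bigl(\prod_{l<s}\gamma_{a_l,u_l}(q_1^{a_s}u_s)\Bigr)\delta(q_1^{a_s}u_s/z)\,[\mathbf u]_{a+\mathbf 1_s},$$ $$-(1-q_1^{-1})f(z)[\mathbf u]_a=\sum_{s=1}^N\Bigl(\prod_{l>s}\gamma_{a_l,u_l}(q_1^{a_s-1}u_s)\Bigr)\delta(q_1^{a_s-1}u_s/z)\,[\mathbf u]_{a-\mathbf 1_s},$$ $$\psi^\pm(z)[\mathbf u]_a=\prod_{l=1}^N\gamma^\pm_{a_l,u_l}(z)\,[\mathbf u]_a .$$ For integers $\lambda_1\ge\dots\ge\lambda_N$ put $|\lambda\rangle=[u_1]_{\lambda_1}\otimes[u_2]_{\lambda_2-1}\otimes\cdots\otimes[u_N]_{\lambda_N-N+1}$. On such vectors the coefficients are those obtained by specialization from generic parameters; in particular a coefficient that vanishes identically in the parameters is $0$. *The space.* Let $\lambda^0_{\nu k+i+1}=-\nu r-c_i$ ($\nu\ge0$, $0\le i\le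 k-1$). Let $S^{k,r}_c$ be the set of sequences of integers $\lambda_1\ge\lambda_2\ge\cdots$ with $\lambda_j-\lambda_{j+k}\ge r$ for all $j\ge1$ and $\lambda_j=\lambda^0_j$ for all sufficiently large $j$, and let $W^{k,r}_c(u)$ be the vector space with basis $|\lambda\rangle$, $\lambda\in S^{k,r}_c$. Let $W^{k,r,N,+}_c(u)\subset V^N(u)$ be the span of the $|\lambda\rangle$ with $\lambda_1\ge\dots\ge\lambda_N$, $\lambda_j-\lambda_{j+k}\ge r$ ($1\le j\le N-k$) and $\lambda_j\ge\lambda^0_j$ ($1\le j\le N$); it is mapped to $W^{k,r}_c(u)$ by $|\lambda_1,\dots,\lambda_N\rangle\mapsto|\lambda_1,\dots,\lambda_N,\lambda^0_{N+1},\lambda^0_{N+2},\dots\rangle$. *The modified operators.* For $N=\nu k+i+1$ with $\nu\ge0$, $0\le i\le k-1$, let $$\beta_{k,N}(z)=\prod_{j=0}^{i}\frac{1-q_1^{-c_j-\nu-1}q_3^{-\nu+j}u/z}{1-q_1^{-c_j-\nu-1}q_3^{-\nu+j-1}u/z}\ \prod_{j=i+1}^{k-1}\frac{1-q_1^{-c_j-\nu}q_3^{-\nu+j+1}u/z}{1-q_1^{-c_j-\nu}q_3^{-\nu+j}u/z},$$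 and put $e^{[k,N]}(z)=e(z)$, $f^{[k,N]}(z)=\beta_{k,N}(z)f(z)$ (each delta function is multiplied by the value of $\beta_{k,N}$ at its support) and $\psi^{\pm[k,N]}(z)=\beta^\pm_{k,N}(z)\psi^\pm(z)$. *Claim.* For every $\lambda\in S^{k,r}_c$ and $x=e,f,\psi^+,\psi^-$ there is $N_0$ such that, for all $N\ge N_0$, all coefficients of $x^{[k,N]}(z)|\lambda_1,\dots,\lambda_N\rangle$ lie in $W^{k,r,N,+}_c(u)$ and their images in $W^{k,r}_c(u)$ do not depend on $N$. The formula $$x(z)|\lambda\rangle=\lim_{N\to\infty}x^{[k,N]}(z)|\lambda_1,\dots,\lambda_N\rangle\qquad(\lambda\in S^{k,r}_c,\ x=e,f,\psi^+,\psi^-)$$ defines one and only one $\mathcal E$-module structure on $W^{k,r}_c(u)$, and this module has level $(1,q_3^k)$. -/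

import Mathlib

noncomputable section

namespace QuantumGlInf

open Filter

/-! ### The algebra -/

/-- The two signs in `ψ⁺`, `ψ⁻`. -/
inductive Sgn
  | plus
  | minus

/-- Generators: `e_i`, `f_i` for `i : ℤ`; `psi plus j` is `ψ⁺_j`, `psi minus j` is `ψ⁻_{-j}`
(`j : ℕ`); `psiInv ε` is the inverse of `ψ^ε_0`. -/
inductive Gen
  | e (i : ℤ)
  | f (i : ℤ)
  | psi (ε : Sgn) (j : ℕ)
  | psiInv (ε : Sgn)

/-- The free algebra on the generators. -/
abbrev Free : Type := FreeAlgebra ℂ Gen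

/-- The coefficient `e_i` of `z ^ (-i)` in `e(z)`. -/
def eF (i : ℤ) : Free := FreeAlgebra.ι ℂ (Gen.e i)

/-- The coefficient `f_i` of `z ^ (-i)` in `f(z)`. -/
def fF (i : ℤ) : Free := FreeAlgebra.ι ℂ (Gen.f i)

/-- The coefficient of `z ^ (-i)` in `ψ^ε(z)`, for every `i : ℤ`: it vanishes for `i < 0`
if `ε` is `+`, and for `i > 0` if `ε` is `-`. -/
def psiF : Sgn → ℤ → Free
  | Sgn.plus, i => if 0 ≤ i then FreeAlgebra.ι ℂ (Gen.psi Sgn.plus i.toNat) else 0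
  | Sgn.minus, i => if i ≤ 0 then FreeAlgebra.ι ℂ (Gen.psi Sgn.minus (-i).toNat) else 0

/-- The inverse of `ψ^ε_0`. -/
def psiInvF (ε : Sgn) : Free := FreeAlgebra.ι ℂ (Gen.psiInv ε)

/-- The coefficient of `z ^ (-n) * w ^ (-m)` in `g(z,w) * ∑ P i j z ^ (-i) w ^ (-j)`, where
`g(z,w) = (z - q₁ w)(z - q₂ w)(z - q₃ w)`. -/
def gCoeff {A : Type} [Ring A] [Algebra ℂ A] (q₁ q₂ q₃ : ℂ) (P : ℤ → ℤ → A) (n m : ℤ) : A :=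
  P (n + 3) m - (q₁ + q₂ + q₃) • P (n + 2) (m + 1)
    + (q₁ * q₂ + q₁ * q₃ + q₂ * q₃) • P (n + 1) (m + 2) - (q₁ * q₂ * q₃) • P n (m + 3)

/-- The defining relations, coefficient by coefficient in `z ^ (-n) * w ^ (-m)`. -/
inductive Rel (q₁ q₂ q₃ : ℂ) : Free → Free → Prop
  /-- `g(z,w) e(z) e(w) = - g(w,z) e(w) e(z)` -/
  | ee (n m : ℤ) : Rel q₁ q₂ q₃
      (gCoeff q₁ q₂ q₃ (fun i j => eF i * eF j) n m)
      (-gCoeff q₁ q₂ q₃ (fun j i => eF j * eF i) m n)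
  /-- `g(w,z) f(z) f(w) = - g(z,w) f(w) f(z)` -/
  | ff (n m : ℤ) : Rel q₁ q₂ q₃
      (gCoeff q₁ q₂ q₃ (fun j i => fF i * fF j) m n)
      (-gCoeff q₁ q₂ q₃ (fun i j => fF j * fF i) n m)
  /-- `g(z,w) ψ^±(z) e(w) = - g(w,z) e(w) ψ^±(z)` -/
  | psie (ε : Sgn) (n m : ℤ) : Rel q₁ q₂ q₃
      (gCoeff q₁ q₂ q₃ (fun i j => psiF ε i * eF j) n m)
      (-gCoeff q₁ q₂ q₃ (fun j i => eF j * psiF ε i) m n)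
  /-- `g(w,z) ψ^±(z) f(w) = - g(z,w) f(w) ψ^±(z)` -/
  | psif (ε : Sgn) (n m : ℤ) : Rel q₁ q₂ q₃
      (gCoeff q₁ q₂ q₃ (fun j i => psiF ε i * fF j) m n)
      (-gCoeff q₁ q₂ q₃ (fun i j => fF j * psiF ε i) n m)
  /-- `[e(z), f(w)] = δ(z/w) (ψ⁺(z) - ψ⁻(z)) / g(1,1)` -/
  | ef (n m : ℤ) : Rel q₁ q₂ q₃
      (((1 - q₁) * (1 - q₂) * (1 - q₃)) • (eF n * fF m - fF m * eF n))
      (psiF Sgn.plus (n + m) - psiF Sgn.minus (n + m))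
  /-- all coefficients of `ψ⁺(z)` and `ψ⁻(z)` commute -/
  | psipsi (ε ε' : Sgn) (n m : ℤ) : Rel q₁ q₂ q₃ (psiF ε n * psiF ε' m) (psiF ε' m * psiF ε n)
  | psi_inv (ε : Sgn) : Rel q₁ q₂ q₃ (psiF ε 0 * psiInvF ε) 1
  | inv_psi (ε : Sgn) : Rel q₁ q₂ q₃ (psiInvF ε * psiF ε 0) 1
  /-- `[e₀, [e₁, e₋₁]] = 0` -/
  | serre_e : Rel q₁ q₂ q₃ ⁅eF 0, ⁅eF 1, eF (-1)⁆⁆ 0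
  /-- `[f₀, [f₁, f₋₁]] = 0` -/
  | serre_f : Rel q₁ q₂ q₃ ⁅fF 0, ⁅fF 1, fF (-1)⁆⁆ 0

/-- The algebra `𝓔` (quantum continuous `𝔤𝔩_∞`). -/
abbrev Alg (q₁ q₂ q₃ : ℂ) : Type := RingQuot (Rel q₁ q₂ q₃)

/-- A generator, as an element of `𝓔`. -/
def gen (q₁ q₂ q₃ : ℂ) (x : Gen) : Alg q₁ q₂ q₃ :=
  RingQuot.mkAlgHom ℂ (Rel q₁ q₂ q₃) (FreeAlgebra.ι ℂ x)

/-- The `𝓔`-module given by `ρ` is of level `(l₊, l₋)`: `ψ^±_0` acts as the scalar `l_±`. -/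
def HasLevel {q₁ q₂ q₃ : ℂ} {M : Type} [AddCommMonoid M] [Module ℂ M]
    (ρ : Alg q₁ q₂ q₃ →ₐ[ℂ] Module.End ℂ M) (lp lm : ℂ) : Prop :=
  (∀ v, ρ (gen q₁ q₂ q₃ (Gen.psi Sgn.plus 0)) v = lp • v) ∧
  (∀ v, ρ (gen q₁ q₂ q₃ (Gen.psi Sgn.minus 0)) v = lm • v)

/-! ### Rational functions, their values and their expansions

The rational functions that occur are products of factors `(1 - a / z) / (1 - b / z)`. Such a
factor is written in a homogeneous coordinate `[z : y]`, as `(z - a y) / (z - b y)`. Its value at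
a point `z` of `ℂ` is obtained from `[z : 1]`, its expansion at `z = 0`, a power series in `X = z`,
from `[X : 1]`, and its expansion at `z = ∞`, a power series in `X = z⁻¹`, from `[1 : X]`. -/

/-- The factor `(1 - a / z) / (1 - b / z)` at `[z : y]`. -/
def factor {R : Type} [CommRing R] [Algebra ℂ R] [Inv R] (a b : ℂ) (z y : R) : R :=
  (z - a • y) * (z - b • y)⁻¹

/-- With `p = q₁ ^ i * u` this is `γ_{i,u}`, at `[z : y]`:
`(1 - q₃ p / z) (1 - q₂ p / z) / ((1 - q₁⁻¹ p / z) (1 - p / z))`. -/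
def gam {R : Type} [CommRing R] [Algebra ℂ R] [Inv R] (q₁ q₂ q₃ p : ℂ) (z y : R) : R :=
  factor (q₃ * p) (q₁⁻¹ * p) z y * factor (q₂ * p) p z y

/-- `β_{k,N}` at `[z : y]`, where `N = ν k + i + 1` with `0 ≤ i ≤ k - 1`. -/
def beta {R : Type} [CommRing R] [Algebra ℂ R] [Inv R] (q₁ q₃ u : ℂ) (k : ℕ) (c : ℕ → ℤ)
    (N : ℕ) (z y : R) : R :=
  let i : ℕ := (N - 1) % k
  let ν : ℤ := ((N - 1) / k : ℕ)
  (∏ j ∈ Finset.range (i + 1),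
    factor (q₁ ^ (-c j - ν - 1) * q₃ ^ (-ν + j) * u)
      (q₁ ^ (-c j - ν - 1) * q₃ ^ (-ν + j - 1) * u) z y) *
  ∏ j ∈ Finset.Ico (i + 1) k,
    factor (q₁ ^ (-c j - ν) * q₃ ^ (-ν + j + 1) * u)
      (q₁ ^ (-c j - ν) * q₃ ^ (-ν + j) * u) z y

/-! ### Tensor products of vector representations -/

/-- The space `V(v₁) ⊗ ⋯ ⊗ V(v_N)`, through its basis `[v₁]_{a₁} ⊗ ⋯ ⊗ [v_N]_{a_N}`, `a ∈ ℤ^N`. -/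
abbrev V (N : ℕ) : Type := (Fin N → ℤ) →₀ ℂ

/-- The coefficient `e_n` of `z ^ (-n)` in `e(z)`, where
`(1 - q₁) e(z) [v₁]_{a₁} ⊗ ⋯ ⊗ [v_N]_{a_N}` is the sum over `s` of
`∏_{l < s} γ_{a_l,v_l}(q₁^{a_s} v_s) δ(q₁^{a_s} v_s / z)` times the basis vector with `a_s` replaced
by `a_s + 1`, and `δ(x) = ∑_n x ^ n`. -/
def tensorE (q₁ q₂ q₃ : ℂ) {N : ℕ} (v : Fin N → ℂ) (n : ℤ) : V N →ₗ[ℂ] V N :=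
  Finsupp.linearCombination ℂ fun a : Fin N → ℤ =>
    ∑ s : Fin N, Finsupp.single (Function.update a s (a s + 1))
      ((1 - q₁)⁻¹ * (∏ l ∈ Finset.Iio s, gam q₁ q₂ q₃ (q₁ ^ a l * v l) (q₁ ^ a s * v s) 1) *
        (q₁ ^ a s * v s) ^ n)

/-- The coefficient of `z ^ (-n)` in `b(z) f(z)`, where
`-(1 - q₁⁻¹) f(z) [v₁]_{a₁} ⊗ ⋯ ⊗ [v_N]_{a_N}` is the sum over `s` of
`∏_{l > s} γ_{a_l,v_l}(q₁^{a_s-1} v_s) δ(q₁^{a_s-1} v_s / z)` times the basis vector with `a_s`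
replaced by `a_s - 1`; multiplication by `b(z)` multiplies each delta function by the value of `b`
at its support. -/
def tensorF (q₁ q₂ q₃ : ℂ) {N : ℕ} (v : Fin N → ℂ) (b : ℂ → ℂ) (n : ℤ) : V N →ₗ[ℂ] V N :=
  Finsupp.linearCombination ℂ fun a : Fin N → ℤ =>
    ∑ s : Fin N, Finsupp.single (Function.update a s (a s - 1))
      (-(1 - q₁⁻¹)⁻¹ * b (q₁ ^ (a s - 1) * v s) *
        (∏ l ∈ Finset.Ioi s, gam q₁ q₂ q₃ (q₁ ^ a l * v l) (q₁ ^ (a s - 1) * v s) 1) *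
        (q₁ ^ (a s - 1) * v s) ^ n)

/-- The expansion of a rational function (given in the homogeneous coordinate) at `z = ∞` for the
sign `+` (a power series in `z⁻¹`) and at `z = 0` for the sign `-` (a power series in `z`). -/
def expand : Sgn → (PowerSeries ℂ → PowerSeries ℂ → PowerSeries ℂ) → PowerSeries ℂ
  | Sgn.plus, h => h 1 PowerSeries.X
  | Sgn.minus, h => h PowerSeries.X 1

/-- The coefficient of `z ^ (∓j)` in `b^±(z) ψ^±(z)`, where `ψ^±(z)` multiplies
`[v₁]_{a₁} ⊗ ⋯ ⊗ [v_N]_{a_N}` by the product of the `γ^±_{a_l,v_l}(z)`. -/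
def tensorPsi (q₁ q₂ q₃ : ℂ) {N : ℕ} (v : Fin N → ℂ)
    (b : PowerSeries ℂ → PowerSeries ℂ → PowerSeries ℂ) (ε : Sgn) (j : ℕ) : V N →ₗ[ℂ] V N :=
  Finsupp.linearCombination ℂ fun a : Fin N → ℤ =>
    Finsupp.single a (PowerSeries.coeff j
      (expand ε b * ∏ l : Fin N, expand ε (gam q₁ q₂ q₃ (q₁ ^ a l * v l))))

/-- The evaluation parameters `u, u q₂⁻¹, …, u q₂^{-N+1}` of `V^N(u)`. -/
def params (q₂ u : ℂ) (N : ℕ) : Fin N → ℂ := fun s => u * q₂ ^ (-(s : ℤ))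

/-- The vector `|lam⟩ = [u]_{lam₁} ⊗ [u q₂⁻¹]_{lam₂ - 1} ⊗ ⋯ ⊗ [u q₂^{-N+1}]_{lam_N - N + 1}`. -/
def ket {N : ℕ} (lam : Fin N → ℤ) : V N := Finsupp.single (fun s => lam s - (s : ℤ)) 1

/-! The modified operators. For `lam ∈ Splus` the rational expressions in these operators have the
following property: whenever a denominator vanishes in the coefficient of `|lam ± 1_s⟩`, so does
`lam s - lam (s ∓ 1)`, and the product contains a factor that is zero identically in the parameters
`q₁`, `q₃`. Therefore the convention `x / 0 = 0` gives the value obtained by specialization from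
generic parameters. -/

/-- The coefficient of `z ^ (-n)` in `e^{[k,N]}(z) = e(z)`, acting on `V^N(u)`. -/
def eOp (q₁ q₂ q₃ u : ℂ) (N : ℕ) (n : ℤ) : V N →ₗ[ℂ] V N :=
  tensorE q₁ q₂ q₃ (params q₂ u N) n

/-- The coefficient of `z ^ (-n)` in `f^{[k,N]}(z) = β_{k,N}(z) f(z)`. -/
def fOp (q₁ q₂ q₃ u : ℂ) (k : ℕ) (c : ℕ → ℤ) (N : ℕ) (n : ℤ) : V N →ₗ[ℂ] V N :=
  tensorF q₁ q₂ q₃ (params q₂ u N) (fun x => beta q₁ q₃ u k c N x 1) n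

/-- The coefficient of `z ^ (∓j)` in `ψ^{±[k,N]}(z) = β^±_{k,N}(z) ψ^±(z)`. -/
def psiOp (q₁ q₂ q₃ u : ℂ) (k : ℕ) (c : ℕ → ℤ) (N : ℕ) (ε : Sgn) (j : ℕ) : V N →ₗ[ℂ] V N :=
  tensorPsi q₁ q₂ q₃ (params q₂ u N) (beta q₁ q₃ u k c N) ε j

/-! ### Admissible partitions and the semi-infinite space

Finite and infinite sequences are indexed from `0`: `lam j` is the `(j+1)`-st part. -/

/-- The tail: the `(ν k + i + 1)`-st part is `-ν r - c_i`, for `0 ≤ i ≤ k - 1`. -/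
def tail (k r : ℕ) (c : ℕ → ℤ) (j : ℕ) : ℤ := -((j / k : ℕ) : ℤ) * r - c (j % k)

/-- Infinite `(k,r)`-admissible partitions that agree with the tail far out. -/
def S (k r : ℕ) (c : ℕ → ℤ) : Set (ℕ → ℤ) :=
  {lam | Antitone lam ∧ (∀ j, (r : ℤ) ≤ lam j - lam (j + k)) ∧
    ∀ᶠ j in atTop, lam j = tail k r c j}

/-- `(k,r)`-admissible partitions with `N` parts, bounded below by the tail. -/
def Splus (k r : ℕ) (c : ℕ → ℤ) (N : ℕ) : Set (Fin N → ℤ) :=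
  {lam | Antitone lam ∧ (∀ i j : Fin N, (j : ℕ) = i + k → (r : ℤ) ≤ lam i - lam j) ∧
    ∀ j : Fin N, tail k r c j ≤ lam j}

/-- `W^{k,r}_c(u)`: the space with basis `|lam⟩`, `lam ∈ S`. -/
def W (k r : ℕ) (c : ℕ → ℤ) : Submodule ℂ ((ℕ → ℤ) →₀ ℂ) :=
  Submodule.span ℂ ((fun lam => Finsupp.single lam (1 : ℂ)) '' S k r c)

/-- `|lam⟩` as an element of `W^{k,r}_c(u)`. -/
def ketW {k r : ℕ} {c : ℕ → ℤ} (lam : S k r c) : W k r c :=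
  ⟨Finsupp.single lam.1 1, Submodule.subset_span ⟨lam.1, lam.2, rfl⟩⟩

/-- `W^{k,r,N,+}_c(u)`: the span of the `|lam⟩` with `lam ∈ Splus`, inside `V^N(u)`. -/
def Wplus (k r : ℕ) (c : ℕ → ℤ) (N : ℕ) : Submodule ℂ (V N) :=
  Submodule.span ℂ (ket '' Splus k r c N)

/-- The map to the inductive limit: `|lam₁, …, lam_N⟩ ↦ |lam₁, …, lam_N, tail⟩`. -/
def toLimit (k r : ℕ) (c : ℕ → ℤ) (N : ℕ) : V N →ₗ[ℂ] ((ℕ → ℤ) →₀ ℂ) :=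
  Finsupp.lmapDomain ℂ ℂ fun a j =>
    if h : j < N then a ⟨j, h⟩ + (j : ℤ) else tail k r c j

/-- The vector `v` of `V^N(u)` lies in `W^{k,r,N,+}_c(u)`, and its image in the inductive limit
`W^{k,r}_c(u)` is `w`. -/
def Represents {k r : ℕ} {c : ℕ → ℤ} {N : ℕ} (v : V N) (w : W k r c) : Prop :=
  v ∈ Wplus k r c N ∧ toLimit k r c N v = (w : (ℕ → ℤ) →₀ ℂ)

/-- `x(z) |lam⟩ = lim_{N → ∞} x^{[k,N]}(z) |lam₁, …, lam_N⟩` for all `lam ∈ S` and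
`x = e, f, ψ⁺, ψ⁻`: for all large `N` the right hand side lies in `W^{k,r,N,+}_c(u)` and
represents the vector on the left. -/
def IsLimitAction {q₁ q₂ q₃ : ℂ} (u : ℂ) {k r : ℕ} {c : ℕ → ℤ}
    (ρ : Alg q₁ q₂ q₃ →ₐ[ℂ] Module.End ℂ (W k r c)) : Prop :=
  ∀ lam : S k r c, ∀ᶠ N in atTop,
    (∀ n : ℤ, Represents (eOp q₁ q₂ q₃ u N n (ket fun j : Fin N => lam.1 j))
      (ρ (gen q₁ q₂ q₃ (Gen.e n)) (ketW lam))) ∧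
    (∀ n : ℤ, Represents (fOp q₁ q₂ q₃ u k c N n (ket fun j : Fin N => lam.1 j))
      (ρ (gen q₁ q₂ q₃ (Gen.f n)) (ketW lam))) ∧
    (∀ (ε : Sgn) (j : ℕ), Represents (psiOp q₁ q₂ q₃ u k c N ε j (ket fun j : Fin N => lam.1 j))
      (ρ (gen q₁ q₂ q₃ (Gen.psi ε j)) (ketW lam)))

end QuantumGlInf

end

/-!
The limit operators act on `|lam⟩` through the points `x_s = q₁ ^ lam_s * q₃ ^ s * u`: `e(z)` moves
`x_s` to `q₁ x_s` with the coefficient `∏_{l < s} γ(x_l; x_s)`, and `f(z)` moves it to `q₁⁻¹ x_s`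
with the coefficient `∏_{l > s} γ(x_l; q₁⁻¹ x_s)`. In the tail all gap conditions are saturated,
`x_{l + k} = q₂ x_l`, so that the infinite products over the tail telescope; what remains of them is
`tailProd`, which is the factor `β_{k,N}` (`Resonant.beta_eq_tailProd`, `Resonant.tailProd_eq`).
Hence the coefficients are independent of `N` as soon as a full period of the tail has been reached
(`Resonant.fCo_stable`, `Resonant.psiSer_eq`).

The resonance makes the space of admissible sequences invariant: `lam_s = lam_{s+1}` means
`x_{s+1} = q₃ x_s`, a saturated gap condition means `x_{s+k} = q₂ x_s`, and at these points the
structure functions vanish, so that no forbidden move occurs (`Resonant.eCo_eq_zero`,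
`Resonant.fCo_eq_zero`). Because there is no other relation between `q₁` and `q₃`, two points that
are moved between admissible sequences are never in a position where a structure function has a
pole (`Resonant.separated`, `Resonant.pt_ne_of_two`). The relations can therefore be checked as
identities of structure functions, for one admissible final sequence at a time:

* the quadratic relations express `γ_{q₁ y}(x) / γ_y(x) = - g(y, x) / g(x, y)` (`coef_exchange`),
  and the cubic relations follow by symmetrization over the six orders of three moves from the
  polynomial identity `gval_sym_sum` and its degenerations for repeated moves. The current `f` is
  obtained from `e` by inverting the parameters and reversing the order of the factors (`gam_inv`),
  so both are treated at once (`IsCurrent.quadratic`, `IsCurrent.serre`);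
* the relations with `ψ^±` hold factor by factor (`Resonant.lin_mul_gam`);
* in `[e(z), f(w)]` the moves of two different parts commute (`Resonant.fCo_mul_eCo`). The moves of
  one part back and forth give the sum of the residues of the eigenvalue of `ψ`: its poles are the
  supports of the moves of `lam`, a pole that belongs to a forbidden move is cancelled by a zero
  that belongs to the part blocking the move (`Resonant.psiZero_blocker`), and the partial fraction
  expansion over the remaining simple poles is the difference of the expansions at `∞` and at `0`
  (`zcoeff_sub_zcoeff_of_cancel`, `Resonant.diagonal_eq`).

The module structure is determined by the limit formula, since the formula gives the action of all
generators except the inverses of `ψ^±_0`, and inverses are unique (`IsLimitAction.unique`).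
-/

noncomputable section

namespace QuantumGlInf

open Filter

/-! ### Admissible sequences and their tails -/

theorem tail_add {k r : ℕ} {c : ℕ → ℤ} (hk : 1 ≤ k) (j : ℕ) :
    tail k r c (j + k) = tail k r c j - r := by
  unfold tail
  rw [Nat.add_div_right j hk, Nat.add_mod_right]
  push_cast
  ring

/-- The sequence has reached its tail at least `k` places before `N`, so that the truncation to the
first `N` parts contains a full period of the tail. -/
def Settled (k r : ℕ) (c : ℕ → ℤ) (N : ℕ) (lam : ℕ → ℤ) : Prop :=
  k ≤ N ∧ ∀ j, N ≤ j + k → lam j = tail k r c j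

theorem Settled.mono {k r : ℕ} {c : ℕ → ℤ} {N M : ℕ} {lam : ℕ → ℤ} (h : Settled k r c N lam)
    (hNM : N ≤ M) : Settled k r c M lam :=
  ⟨h.1.trans hNM, fun j hj => h.2 j (hNM.trans hj)⟩

theorem Settled.gap {k r : ℕ} {c : ℕ → ℤ} {N : ℕ} {lam : ℕ → ℤ} (h : Settled k r c N lam)
    (hk : 1 ≤ k) {j : ℕ} (hj : N ≤ j + k) : lam (j + k) = lam j - r := by
  rw [h.2 j hj, h.2 (j + k) (by omega), tail_add hk]

theorem exists_settled {k r : ℕ} {c : ℕ → ℤ} {lam : ℕ → ℤ} (h : lam ∈ S k r c) :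
    ∃ N, Settled k r c N lam := by
  obtain ⟨N, hN⟩ := eventually_atTop.1 h.2.2
  exact ⟨N + k, by omega, fun j hj => hN j (by omega)⟩

theorem le_sub_of_mem_S {k r : ℕ} {c : ℕ → ℤ} {lam : ℕ → ℤ} (h : lam ∈ S k r c) (s t n : ℕ)
    (hst : s + n * k ≤ t) : (n : ℤ) * r ≤ lam s - lam t := by
  have key : ∀ n : ℕ, (n : ℤ) * r ≤ lam s - lam (s + n * k) := by
    intro n
    induction n with
    | zero => simp
    | succ n ih =>
      have h1 := h.2.1 (s + n * k)
      rw [show s + (n + 1) * k = s + n * k + k by ring]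
      push_cast
      linarith
  have h1 := h.1 hst
  linarith [key n]

theorem tail_le_of_mem_S {k r : ℕ} {c : ℕ → ℤ} {lam : ℕ → ℤ} (h : lam ∈ S k r c) (hk : 1 ≤ k)
    (j : ℕ) : tail k r c j ≤ lam j := by
  obtain ⟨N, -, hN⟩ := exists_settled h
  have h1 := le_sub_of_mem_S h j (j + N * k) N le_rfl
  have h2 : ∀ n : ℕ, tail k r c (j + n * k) = tail k r c j - n * r := by
    intro n
    induction n with
    | zero => simp
    | succ n ih =>
      rw [show j + (n + 1) * k = j + n * k + k by ring, tail_add hk, ih]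
      push_cast
      ring
  rw [hN (j + N * k) (by nlinarith), h2] at h1
  linarith

/-- The sequence `lam + d · 1_s`. -/
def shift (lam : ℕ → ℤ) (s : ℕ) (d : ℤ) : ℕ → ℤ := lam + Pi.single s d

theorem shift_comm (lam : ℕ → ℤ) (s t : ℕ) (d e : ℤ) :
    shift (shift lam s d) t e = shift (shift lam t e) s d :=
  add_right_comm _ _ _

theorem shift_apply (lam : ℕ → ℤ) (s j : ℕ) (d : ℤ) :
    shift lam s d j = lam j + if j = s then d else 0 := by
  simp [shift, Pi.single_apply]

theorem shift_self (lam : ℕ → ℤ) (s : ℕ) (d : ℤ) : shift lam s d s = lam s + d := by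
  simp [shift]

theorem shift_ne (lam : ℕ → ℤ) {s j : ℕ} (h : j ≠ s) (d : ℤ) :
    shift lam s d j = lam j := by
  simp [shift, h]

theorem raise_mem_S_iff {k r : ℕ} {c : ℕ → ℤ} (hk : 1 ≤ k) {lam : ℕ → ℤ} (h : lam ∈ S k r c)
    (s : ℕ) : shift lam s 1 ∈ S k r c ↔
      (∀ j, j + 1 = s → lam s < lam j) ∧ ∀ j, j + k = s → (r : ℤ) < lam j - lam s := by
  constructor
  · rintro ⟨h1, h2, -⟩
    constructor
    · rintro j rfl
      have := h1 (Nat.le_succ j)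
      simp only [Nat.succ_eq_add_one, shift_apply] at this
      simp at this
      omega
    · rintro j rfl
      have := h2 j
      simp only [shift_apply] at this
      rw [if_neg (by omega)] at this
      simp at this
      omega
  · rintro ⟨h1, h2⟩
    refine ⟨antitone_nat_of_succ_le fun j => ?_, fun j => ?_, ?_⟩
    · simp only [shift_apply]
      have h3 := h.1 (Nat.le_succ j)
      have h4 := h1 j
      simp only [Nat.succ_eq_add_one] at h3
      split_ifs with h5 h6 h6
      · omega
      · subst h5; have := h4 rfl; omega
      · omega
      · omega
    · simp only [shift_apply]
      have h3 := h.2.1 j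
      have h4 := h2 j
      split_ifs with h5 h6 h6
      · omega
      · omega
      · subst h6; have := h4 rfl; omega
      · omega
    · filter_upwards [h.2.2, eventually_gt_atTop s] with j hj hs
      rw [shift_ne _ (by omega), hj]

theorem lower_mem_S_iff {k r : ℕ} {c : ℕ → ℤ} (hk : 1 ≤ k) {lam : ℕ → ℤ} (h : lam ∈ S k r c)
    (s : ℕ) : shift lam s (-1) ∈ S k r c ↔
      lam (s + 1) < lam s ∧ (r : ℤ) < lam s - lam (s + k) := by
  constructor
  · rintro ⟨h1, h2, -⟩
    constructor
    · have := h1 (Nat.le_succ s)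
      simp only [Nat.succ_eq_add_one, shift_apply] at this
      simp at this
      omega
    · have := h2 s
      simp only [shift_apply] at this
      rw [if_neg (by omega : s + k ≠ s)] at this
      simp at this
      omega
  · rintro ⟨h1, h2⟩
    refine ⟨antitone_nat_of_succ_le fun j => ?_, fun j => ?_, ?_⟩
    · simp only [shift_apply]
      have h3 := h.1 (Nat.le_succ j)
      simp only [Nat.succ_eq_add_one] at h3
      split_ifs with h5 h6 h6
      · omega
      · omega
      · subst h6; omega
      · omega
    · simp only [shift_apply]
      have h3 := h.2.1 j
      split_ifs with h5 h6 h6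
      · omega
      · subst h5; omega
      · omega
      · omega
    · filter_upwards [h.2.2, eventually_gt_atTop s] with j hj hs
      rw [shift_ne _ (by omega), hj]

theorem Settled.lt_of_raise_mem {k r : ℕ} {c : ℕ → ℤ} {N : ℕ} {lam : ℕ → ℤ}
    (h : Settled k r c N lam) (hk : 1 ≤ k) (hS : lam ∈ S k r c) {s : ℕ}
    (hs : shift lam s 1 ∈ S k r c) : s < N := by
  by_contra hN
  have h1 := h.1
  have h2 := ((raise_mem_S_iff hk hS s).1 hs).2 (s - k) (by omega)
  have h3 := h.gap hk (j := s - k) (by omega)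
  rw [show s - k + k = s by omega] at h3
  omega

theorem Settled.lt_of_lower_mem {k r : ℕ} {c : ℕ → ℤ} {N : ℕ} {lam : ℕ → ℤ}
    (h : Settled k r c N lam) (hk : 1 ≤ k) (hS : lam ∈ S k r c) {s : ℕ}
    (hs : shift lam s (-1) ∈ S k r c) : s + k < N := by
  by_contra hN
  have h2 := ((lower_mem_S_iff hk hS s).1 hs).2
  have h3 := h.gap hk (j := s) (by omega)
  omega

theorem Settled.shift {k r : ℕ} {c : ℕ → ℤ} {N : ℕ} {lam : ℕ → ℤ}
    (h : Settled k r c N lam) (hk : 1 ≤ k) (hS : lam ∈ S k r c) {s : ℕ} {d : ℤ}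
    (hd : d = 1 ∨ d = -1) (hs : shift lam s d ∈ S k r c) {M : ℕ} (hM : N + k + 1 ≤ M) :
    s < N ∧ Settled k r c M (shift lam s d) := by
  have hsN : s < N := by
    rcases hd with rfl | rfl
    · exact h.lt_of_raise_mem hk hS hs
    · have := h.lt_of_lower_mem hk hS hs; omega
  refine ⟨hsN, ?_, fun j hj => ?_⟩
  · have := h.1; omega
  · rw [shift_ne _ (by omega), h.2 j (by omega)]

/-! ### Expansions of rational functions -/

/-- The linear form `z - b` of the homogeneous coordinate, in the power series ring that belongs to
the sign: `1 - b X` at `z = ∞` and `X - b` at `z = 0`. -/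
def lin (ε : Sgn) (b : ℂ) : PowerSeries ℂ := expand ε fun z y => z - b • y

theorem lin_mul_inv (ε : Sgn) {b : ℂ} (hb : b ≠ 0) : lin ε b * (lin ε b)⁻¹ = 1 := by
  apply PowerSeries.mul_inv_cancel
  cases ε <;> simp [lin, expand, hb]

theorem expand_gam (ε : Sgn) (q₁ q₂ q₃ p : ℂ) :
    expand ε (gam q₁ q₂ q₃ p) =
      (lin ε (q₃ * p) * (lin ε (q₁⁻¹ * p))⁻¹) * (lin ε (q₂ * p) * (lin ε p)⁻¹) := by
  cases ε <;> rfl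

/-- The coefficient of `z ^ (-i)` of a power series that is an expansion at `z = ∞` (sign `+`) or
at `z = 0` (sign `-`). -/
def zcoeff : Sgn → PowerSeries ℂ → ℤ → ℂ
  | Sgn.plus, h, i => if 0 ≤ i then PowerSeries.coeff i.toNat h else 0
  | Sgn.minus, h, i => if i ≤ 0 then PowerSeries.coeff (-i).toNat h else 0

theorem zcoeff_smul (ε : Sgn) (a : ℂ) (h : PowerSeries ℂ) (i : ℤ) :
    zcoeff ε (a • h) i = a * zcoeff ε h i := by
  cases ε <;> simp [zcoeff]

theorem zcoeff_add (ε : Sgn) (g h : PowerSeries ℂ) (i : ℤ) :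
    zcoeff ε (g + h) i = zcoeff ε g i + zcoeff ε h i := by
  cases ε <;> simp only [zcoeff] <;> split_ifs <;> simp

theorem zcoeff_sum {ι : Type*} (ε : Sgn) (D : Finset ι) (h : ι → PowerSeries ℂ) (i : ℤ) :
    zcoeff ε (∑ j ∈ D, h j) i = ∑ j ∈ D, zcoeff ε (h j) i := by
  classical
  induction D using Finset.induction_on with
  | empty => cases ε <;> simp [zcoeff]
  | insert a D ha ih => rw [Finset.sum_insert ha, Finset.sum_insert ha, zcoeff_add, ih]

/-- Multiplication by `z - b` shifts the coefficients at `z = ∞` by one place, because `1 - b X` is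
`X (z - b)` there. -/
def linShift : Sgn → ℤ
  | Sgn.plus => 1
  | Sgn.minus => 0

theorem zcoeff_lin_mul (ε : Sgn) (b : ℂ) (h : PowerSeries ℂ) (i : ℤ) :
    zcoeff ε (lin ε b * h) (i + linShift ε) = zcoeff ε h (i + 1) - b * zcoeff ε h i := by
  cases ε
  · rw [show linShift Sgn.plus = 1 from rfl]
    simp only [zcoeff, lin, expand]
    rcases lt_trichotomy i (-1) with hi | hi | hi
    · rw [if_neg (by omega), if_neg (by omega), if_neg (by omega)]; simp
    · subst hi
      simp [sub_mul]
    · lift i to ℕ using (by omega)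
      rw [if_pos (by omega), if_pos (by omega), if_pos (by omega),
        show ((i : ℤ) + 1).toNat = i + 1 by omega, Int.toNat_natCast, sub_mul, one_mul,
        smul_mul_assoc, map_sub, PowerSeries.coeff_smul, PowerSeries.coeff_succ_X_mul, smul_eq_mul]
  · rw [show linShift Sgn.minus = 0 from rfl, add_zero]
    simp only [zcoeff, lin, expand]
    rcases lt_trichotomy i 0 with hi | hi | hi
    · obtain ⟨n, rfl⟩ : ∃ n : ℕ, i = -((n : ℤ) + 1) := ⟨(-i - 1).toNat, by omega⟩
      rw [if_pos (by omega), if_pos (by omega), if_pos (by omega),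
        show (-(-((n : ℤ) + 1))).toNat = n + 1 by omega,
        show (-(-((n : ℤ) + 1) + 1)).toNat = n by omega, sub_mul, smul_mul_assoc, one_mul, map_sub,
        PowerSeries.coeff_smul, PowerSeries.coeff_succ_X_mul, smul_eq_mul]
    · subst hi
      simp [sub_mul]
    · rw [if_neg (by omega), if_neg (by omega), if_neg (by omega)]; simp

/-- The coefficients of `1 / (z - b)`: the difference of the two expansions is the delta function
`b⁻¹ δ(b / z)`. -/
theorem zcoeff_sub_zcoeff_inv {b : ℂ} (hb : b ≠ 0) (i : ℤ) :
    zcoeff Sgn.plus (expand Sgn.plus (fun _ y => y) * (lin Sgn.plus b)⁻¹) i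
      - zcoeff Sgn.minus (expand Sgn.minus (fun _ y => y) * (lin Sgn.minus b)⁻¹) i
      = b ^ (i - 1) := by
  have h1 : (lin Sgn.plus b)⁻¹ = PowerSeries.mk fun n => b ^ n := by
    rw [PowerSeries.inv_eq_iff_mul_eq_one (by simp [lin, expand])]
    ext n
    rw [lin, expand, mul_sub, mul_one, mul_smul_comm, map_sub, PowerSeries.coeff_smul]
    cases n with
    | zero => simp
    | succ n => simp [pow_succ', PowerSeries.coeff_succ_mul_X]
  have h2 : (lin Sgn.minus b)⁻¹ = PowerSeries.mk fun n => -b⁻¹ ^ (n + 1) := by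
    rw [PowerSeries.inv_eq_iff_mul_eq_one (by simp [lin, expand, hb])]
    ext n
    rw [lin, expand, mul_sub, mul_smul_comm, mul_one, map_sub, PowerSeries.coeff_smul]
    cases n with
    | zero => simp [hb]
    | succ n =>
      simp only [PowerSeries.coeff_succ_mul_X, PowerSeries.coeff_mk, smul_eq_mul, pow_succ]
      rw [PowerSeries.coeff_one, if_neg (by omega)]
      field_simp
      ring
  simp only [zcoeff, expand, one_mul, h1, h2]
  rcases lt_or_ge 0 i with hi | hi
  · obtain ⟨n, rfl⟩ : ∃ n : ℕ, i = (n : ℤ) + 1 := ⟨(i - 1).toNat, by omega⟩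
    rw [if_pos (by omega), if_neg (by omega), show ((n : ℤ) + 1).toNat = n + 1 by omega,
      PowerSeries.coeff_succ_X_mul, PowerSeries.coeff_mk]
    simp
  · obtain ⟨n, rfl⟩ : ∃ n : ℕ, i = -(n : ℤ) := ⟨(-i).toNat, by omega⟩
    have h3 : (if 0 ≤ -(n : ℤ) then PowerSeries.coeff (-(n : ℤ)).toNat
        ((PowerSeries.X : PowerSeries ℂ) * PowerSeries.mk fun n => b ^ n) else 0) = 0 := by
      split_ifs with h
      · have : n = 0 := by omega
        subst this
        simp
      · rfl
    rw [h3, if_pos (by omega), show (-(-(n : ℤ))).toNat = n by omega, PowerSeries.coeff_mk,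
      show -(n : ℤ) - 1 = -((n + 1 : ℕ) : ℤ) by push_cast; ring, zpow_neg, zpow_natCast, inv_pow]
    ring

/-- Partial fractions for `∏ (z - a i) / (z - b i)` with simple poles, in any commutative
`ℂ`-algebra in which the denominators have the inverses `m i`. -/
theorem prod_eq_one_add_sum {ι : Type*} [DecidableEq ι] (a b : ι → ℂ) (D : Finset ι)
    (hb : Set.InjOn b D) : ∀ {R : Type} [CommRing R] [Algebra ℂ R] (z y : R) (m : ι → R),
      (∀ i ∈ D, (z - b i • y) * m i = 1) →
      ∏ i ∈ D, (z - a i • y) * m i = 1 + ∑ i ∈ D,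
        ((b i - a i) * ∏ j ∈ D.erase i, (b i - a j) * (b i - b j)⁻¹) • (y * m i) := by
  induction D using Finset.induction_on with
  | empty => simp
  | insert o D ho ih =>
    intro R _ _ z y m hm
    have hb' : Set.InjOn b D := hb.mono (by simp)
    have hne : ∀ i ∈ D, b i - b o ≠ 0 := by
      intro i hi h
      have h1 := hb (by simp [hi]) (by simp) (sub_eq_zero.1 h)
      exact ho (h1 ▸ hi)
    have hne' : ∀ i ∈ D, b o - b i ≠ 0 := fun i hi h => hne i hi (by rw [← neg_sub, h, neg_zero])
    rw [Finset.prod_insert ho, Finset.sum_insert ho, Finset.erase_insert ho,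
      ih hb' z y m fun i hi => hm i (Finset.mem_insert_of_mem hi)]
    -- the residue at the new pole is the old product, evaluated there
    have hev := ih hb' (R := ℂ) (b o) 1 (fun i => (b o - b i)⁻¹)
      fun i hi => by simpa using mul_inv_cancel₀ (hne' i hi)
    simp only [smul_eq_mul, mul_one, one_mul] at hev
    rw [hev]
    have hmo := hm o (Finset.mem_insert_self _ _)
    have hfac : (z - a o • y) * m o = 1 + (b o - a o) • (y * m o) := by
      rw [← hmo, sub_smul]
      simp only [Algebra.smul_def]
      ring
    set ρ : ι → ℂ := fun i => (b i - a i) * ∏ j ∈ D.erase i, (b i - a j) * (b i - b j)⁻¹ with hρ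
    have hsum : ∑ i ∈ D, ((b i - a i) * ∏ j ∈ (insert o D).erase i,
          (b i - a j) * (b i - b j)⁻¹) • (y * m i)
        = ∑ i ∈ D, (ρ i * ((b i - a o) * (b i - b o)⁻¹)) • (y * m i) := by
      refine Finset.sum_congr rfl fun i hi => ?_
      have hio : o ≠ i := fun h => ho (h ▸ hi)
      rw [Finset.erase_insert_of_ne hio, Finset.prod_insert (by simp [ho])]
      congr 1
      simp only [hρ]
      ring
    rw [hsum, hfac]
    have hterm : ∀ i ∈ D, (1 + (b o - a o) • (y * m o)) * (ρ i • (y * m i)) =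
        (ρ i * ((b i - a o) * (b i - b o)⁻¹)) • (y * m i)
          + ((b o - a o) * (ρ i * (b o - b i)⁻¹)) • (y * m o) := by
      intro i hi
      have h1 : (b i - b o) • ((y * m o) * (y * m i)) = y * m i - y * m o := by
        have h2 := hm i (Finset.mem_insert_of_mem hi)
        simp only [Algebra.smul_def, map_sub] at h2 hmo ⊢
        linear_combination (y * m i) * hmo - (y * m o) * h2
      have h3 : (y * m o) * (y * m i) = (b i - b o)⁻¹ • (y * m i - y * m o) := by
        rw [← h1, smul_smul, inv_mul_cancel₀ (hne i hi), one_smul]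
      rw [add_mul, one_mul, smul_mul_smul_comm, h3, smul_smul, smul_sub, ← sub_eq_zero]
      have h4 : (b o - b i)⁻¹ = -(b i - b o)⁻¹ := by rw [← inv_neg, neg_sub]
      have h5 : (b i - a o) * (b i - b o)⁻¹ = 1 + (b o - a o) * (b i - b o)⁻¹ := by
        field_simp [hne i hi]
        ring
      rw [h4, h5]
      simp only [Algebra.smul_def, map_sub, map_mul, map_add, map_one, map_neg]
      ring
    rw [mul_add, mul_one, Finset.mul_sum, Finset.sum_congr rfl hterm, Finset.sum_add_distrib,
      ← Finset.sum_smul, ← Finset.mul_sum, mul_add, add_smul, mul_one]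
    simp only [hρ]
    abel

/-! ### Exchange identities -/

/-- `g(z, w) = (z - q₁ w) (z - q₂ w) (z - q₃ w)`. -/
def gval (q₁ q₂ q₃ z w : ℂ) : ℂ := (z - q₁ * w) * (z - q₂ * w) * (z - q₃ * w)

/-- The symbol of the cubic relation: if `x`, `y`, `z` are the supports of the delta functions in
the order in which three currents act, `[e₀, [e₁, e₋₁]]` produces the factor `serreH x y z`. -/
def serreH (x y z : ℂ) : ℂ := y / x - x / y - z / y + y / z

/-- The denominator common to `γ_y(x)` and `γ_{q₁ y}(x)`. -/
def gden (q₁ x y : ℂ) : ℂ := (x - y) * (x - q₁ * y) * (q₁ * x - y)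

theorem gam_eq_div {q₁ q₂ q₃ x y : ℂ} (hq : q₁ * q₂ * q₃ = 1) (h : gden q₁ x y ≠ 0) :
    gam q₁ q₂ q₃ y x 1 = q₁ * gval q₁ q₂ q₃ x y / gden q₁ x y := by
  have h1 : q₁ ≠ 0 := by rintro rfl; simp at hq
  simp only [gden, ne_eq, mul_eq_zero, not_or] at h
  obtain ⟨⟨a0, a1⟩, a2⟩ := h
  have b1 : x - q₁⁻¹ * y ≠ 0 := by
    intro h; apply a2; field_simp at h; linear_combination h
  have b2 : q₁ * x - y = q₁ * (x - q₁⁻¹ * y) := by field_simp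
  simp only [gam, factor, smul_eq_mul, mul_one, gval, gden]
  rw [b2]
  generalize x - q₁⁻¹ * y = A at *
  generalize x - y = B at *
  generalize x - q₁ * y = C at *
  field_simp

theorem gam_mul_eq_div {q₁ q₂ q₃ x y : ℂ} (hq : q₁ * q₂ * q₃ = 1) (h : gden q₁ x y ≠ 0) :
    gam q₁ q₂ q₃ (q₁ * y) x 1 = -(q₁ * gval q₁ q₂ q₃ y x) / gden q₁ x y := by
  have h1 : q₁ ≠ 0 := by rintro rfl; simp at hq
  simp only [gden, ne_eq, mul_eq_zero, not_or] at h
  obtain ⟨⟨a0, a1⟩, a2⟩ := h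
  simp only [gam, factor, smul_eq_mul, mul_one, gval, gden, inv_mul_cancel_left₀ h1]
  rw [show y - q₁ * x = -(q₁ * x - y) by ring]
  have key : (x - q₃ * (q₁ * y)) * (x - q₂ * (q₁ * y)) = q₁ * ((y - q₂ * x) * (y - q₃ * x)) := by
    linear_combination (q₁ * y ^ 2 - x ^ 2) * hq
  generalize q₁ * x - y = A at *
  generalize x - y = B at *
  generalize x - q₁ * y = C at *
  field_simp
  linear_combination key

/-- The antisymmetrization of `g(x, y) g(x, z) g(y, z) serreH x y z` over the orders of `x`, `y`,
`z` vanishes. -/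
theorem gval_sym_sum (e f x y z : ℂ) (g : ℂ → ℂ → ℂ)
    (hg : ∀ x y, g x y = x ^ 3 - e * x ^ 2 * y + f * x * y ^ 2 - y ^ 3) (hx : x ≠ 0) (hy : y ≠ 0)
    (hz : z ≠ 0) :
    g x y * g x z * g y z * serreH x y z - g x z * g x y * g z y * serreH x z y
      - g y x * g y z * g x z * serreH y x z + g y z * g y x * g z x * serreH y z x
      + g z x * g z y * g x y * serreH z x y - g z y * g z x * g y x * serreH z y x = 0 := by
  have hh : ∀ x y z : ℂ, x ≠ 0 → y ≠ 0 → z ≠ 0 →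
      serreH x y z = (y ^ 2 * z - x ^ 2 * z - z ^ 2 * x + x * y ^ 2) * (x * y * z)⁻¹ := by
    intro x y z hx hy hz
    unfold serreH
    field_simp
  rw [hh x y z hx hy hz, hh x z y hx hz hy, hh y x z hy hx hz, hh y z x hy hz hx, hh z x y hz hx hy,
    hh z y x hz hy hx, show x * z * y = x * y * z by ring, show y * x * z = x * y * z by ring,
    show y * z * x = x * y * z by ring, show z * x * y = x * y * z by ring,
    show z * y * x = x * y * z by ring]
  simp only [hg]
  ring

theorem gval_eq {q₁ q₂ q₃ : ℂ} (hq : q₁ * q₂ * q₃ = 1) (x y : ℂ) :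
    gval q₁ q₂ q₃ x y = x ^ 3 - (q₁ + q₂ + q₃) * x ^ 2 * y
      + (q₁ * q₂ + q₁ * q₃ + q₂ * q₃) * x * y ^ 2 - y ^ 3 := by
  unfold gval
  linear_combination (-y ^ 3) * hq

/-- The cubic relation for three distinct tensor factors at `x`, `y`, `z`, in this order: each
summand is the product of the structure functions for one order of action. -/
theorem serre_gam_distinct {q₁ q₂ q₃ x y z : ℂ} (hq : q₁ * q₂ * q₃ = 1) (hx : x ≠ 0) (hy : y ≠ 0)
    (hz : z ≠ 0) (hxy : gden q₁ y x ≠ 0) (hxz : gden q₁ z x ≠ 0) (hyz : gden q₁ z y ≠ 0) :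
    gam q₁ q₂ q₃ (q₁ * x) y 1 * (gam q₁ q₂ q₃ (q₁ * x) z 1 * gam q₁ q₂ q₃ (q₁ * y) z 1) *
        serreH x y z
      + gam q₁ q₂ q₃ (q₁ * x) y 1 * (gam q₁ q₂ q₃ (q₁ * x) z 1 * gam q₁ q₂ q₃ y z 1) *
        serreH x z y
      + gam q₁ q₂ q₃ x y 1 * (gam q₁ q₂ q₃ (q₁ * x) z 1 * gam q₁ q₂ q₃ (q₁ * y) z 1) *
        serreH y x z
      + gam q₁ q₂ q₃ x y 1 * (gam q₁ q₂ q₃ x z 1 * gam q₁ q₂ q₃ (q₁ * y) z 1) * serreH y z x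
      + gam q₁ q₂ q₃ (q₁ * x) y 1 * (gam q₁ q₂ q₃ x z 1 * gam q₁ q₂ q₃ y z 1) * serreH z x y
      + gam q₁ q₂ q₃ x y 1 * (gam q₁ q₂ q₃ x z 1 * gam q₁ q₂ q₃ y z 1) * serreH z y x = 0 := by
  rw [gam_eq_div hq hxy, gam_eq_div hq hxz, gam_eq_div hq hyz, gam_mul_eq_div hq hxy,
    gam_mul_eq_div hq hxz, gam_mul_eq_div hq hyz]
  have key := gval_sym_sum _ _ x y z (gval q₁ q₂ q₃) (gval_eq hq) hx hy hz
  have h3 := congrArg (fun w => -q₁ ^ 3 * w / (gden q₁ y x * gden q₁ z x * gden q₁ z y)) key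
  simp only [mul_zero, zero_div] at h3
  rw [← h3]
  field_simp
  ring

/-- The cubic relation when the factor at `x` is used twice and comes after the one at `y`. -/
theorem serre_gam_upper {q₁ q₂ q₃ x y : ℂ} (h1 : q₁ ≠ 0) (h3 : q₃ ≠ 0) (hq : q₂ = q₁⁻¹ * q₃⁻¹)
    (hx : x ≠ 0) (hy : y ≠ 0)
    (a0 : x - y ≠ 0) (a1 : x - q₁ * y ≠ 0) (a2 : q₁ * x - y ≠ 0) (a3 : q₁ * (q₁ * x) - y ≠ 0) :
    gam q₁ q₂ q₃ y x 1 * gam q₁ q₂ q₃ y (q₁ * x) 1 * serreH x (q₁ * x) y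
      + gam q₁ q₂ q₃ y x 1 * gam q₁ q₂ q₃ (q₁ * y) (q₁ * x) 1 * serreH x y (q₁ * x)
      + gam q₁ q₂ q₃ (q₁ * y) x 1 * gam q₁ q₂ q₃ (q₁ * y) (q₁ * x) 1 * serreH y x (q₁ * x) = 0 := by
  subst hq
  unfold serreH
  have b1 : x - q₁⁻¹ * y ≠ 0 := by
    intro h; apply a2; field_simp at h; linear_combination h
  have b2 : q₁ * x - q₁⁻¹ * y ≠ 0 := by
    intro h; apply a3; field_simp at h; linear_combination h
  have e1 : gam q₁ (q₁⁻¹ * q₃⁻¹) q₃ y x 1 =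
      (x - q₃ * y) * (q₁ * q₃ * x - y) / (q₃ * (q₁ * x - y) * (x - y)) := by
    simp only [gam, factor, smul_eq_mul, mul_one]; field_simp
  have e2 : gam q₁ (q₁⁻¹ * q₃⁻¹) q₃ y (q₁ * x) 1 =
      (q₁ * x - q₃ * y) * (q₁ * q₃ * (q₁ * x) - y) / (q₃ * (q₁ * (q₁ * x) - y) * (q₁ * x - y)) := by
    simp only [gam, factor, smul_eq_mul, mul_one]; field_simp
  have e3 : gam q₁ (q₁⁻¹ * q₃⁻¹) q₃ (q₁ * y) x 1 =
      (x - q₃ * (q₁ * y)) * (q₃ * x - y) / (q₃ * (x - y) * (x - q₁ * y)) := by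
    simp only [gam, factor, smul_eq_mul, mul_one]; field_simp
  have e4 : gam q₁ (q₁⁻¹ * q₃⁻¹) q₃ (q₁ * y) (q₁ * x) 1 =
      (x - q₃ * y) * (q₁ * q₃ * x - y) / (q₃ * (q₁ * x - y) * (x - y)) := by
    have : q₁ * x - q₁ * y ≠ 0 := by rw [← mul_sub]; exact mul_ne_zero h1 a0
    simp only [gam, factor, smul_eq_mul, mul_one]; field_simp
  rw [e1, e2, e3, e4]
  clear e1 e2 e3 e4 b1 b2
  obtain ⟨A, hA⟩ : ∃ A, A = x - y := ⟨_, rfl⟩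
  obtain ⟨B, hB⟩ : ∃ A, A = x - q₁ * y := ⟨_, rfl⟩
  obtain ⟨C, hC⟩ : ∃ A, A = q₁ * x - y := ⟨_, rfl⟩
  obtain ⟨D, hD⟩ : ∃ A, A = q₁ * (q₁ * x) - y := ⟨_, rfl⟩
  rw [← hA] at a0 ⊢
  rw [← hB] at a1 ⊢
  rw [← hC] at a2
  rw [← hD] at a3 ⊢
  simp only [← hC]
  field_simp
  rw [hA, hB, hC, hD]
  ring

/-- The cubic relation when the factor at `x` is used twice and comes before the one at `y`. -/
theorem serre_gam_lower {q₁ q₂ q₃ x y : ℂ} (h1 : q₁ ≠ 0) (h3 : q₃ ≠ 0) (hq : q₂ = q₁⁻¹ * q₃⁻¹)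
    (hx : x ≠ 0) (hy : y ≠ 0)
    (a0 : y - x ≠ 0) (a1 : q₁ * y - x ≠ 0) (a2 : y - q₁ * x ≠ 0) (a3 : y - q₁ * (q₁ * x) ≠ 0) :
    gam q₁ q₂ q₃ (q₁ * (q₁ * x)) y 1 * serreH x (q₁ * x) y
      + gam q₁ q₂ q₃ (q₁ * x) y 1 * serreH x y (q₁ * x)
      + gam q₁ q₂ q₃ x y 1 * serreH y x (q₁ * x) = 0 := by
  subst hq
  unfold serreH
  have b1 : y - q₁⁻¹ * x ≠ 0 := by
    intro h; apply a1; field_simp at h; linear_combination h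
  have e1 : gam q₁ (q₁⁻¹ * q₃⁻¹) q₃ x y 1 =
      (y - q₃ * x) * (q₁ * q₃ * y - x) / (q₃ * (q₁ * y - x) * (y - x)) := by
    simp only [gam, factor, smul_eq_mul, mul_one]; field_simp
  have e2 : gam q₁ (q₁⁻¹ * q₃⁻¹) q₃ (q₁ * x) y 1 =
      (y - q₃ * (q₁ * x)) * (q₃ * y - x) / (q₃ * (y - x) * (y - q₁ * x)) := by
    simp only [gam, factor, smul_eq_mul, mul_one]; field_simp
  have e3 : gam q₁ (q₁⁻¹ * q₃⁻¹) q₃ (q₁ * (q₁ * x)) y 1 =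
      (y - q₃ * (q₁ * (q₁ * x))) * (q₃ * y - q₁ * x) /
        (q₃ * (y - q₁ * x) * (y - q₁ * (q₁ * x))) := by
    simp only [gam, factor, smul_eq_mul, mul_one]; field_simp
  rw [e1, e2, e3]
  clear e1 e2 e3 b1
  obtain ⟨A, hA⟩ : ∃ A, A = y - x := ⟨_, rfl⟩
  obtain ⟨B, hB⟩ : ∃ A, A = q₁ * y - x := ⟨_, rfl⟩
  obtain ⟨C, hC⟩ : ∃ A, A = y - q₁ * x := ⟨_, rfl⟩
  obtain ⟨D, hD⟩ : ∃ A, A = y - q₁ * (q₁ * x) := ⟨_, rfl⟩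
  rw [← hA] at a0 ⊢
  rw [← hB] at a1 ⊢
  rw [← hC] at a2 ⊢
  rw [← hD] at a3 ⊢
  field_simp
  rw [hA, hB, hC, hD]
  ring

/-! ### Structure coefficients and their exchange relations -/

/-- The structure coefficient of a current acting on the tensor factor `s`, where `p l` is the
support of the delta function of the factor `l`, and `I` is the set of factors that contribute. For
`e` these are the factors before `s`; for `f`, with `q₁, q₂, q₃` inverted, those after `s`. -/
def coef (q₁ q₂ q₃ : ℂ) (b : ℂ → ℂ) (I : Finset ℕ) (p : ℕ → ℂ) (s : ℕ) : ℂ :=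
  b (p s) * ∏ l ∈ I, gam q₁ q₂ q₃ (p l) (p s) 1

/-- The supports after one action on the factor `t`. -/
def move (q₁ : ℂ) (p : ℕ → ℂ) (t : ℕ) : ℕ → ℂ := Function.update p t (q₁ * p t)

theorem move_self (q₁ : ℂ) (p : ℕ → ℂ) (t : ℕ) : move q₁ p t t = q₁ * p t := by simp [move]

theorem move_ne (q₁ : ℂ) (p : ℕ → ℂ) {t l : ℕ} (h : l ≠ t) : move q₁ p t l = p l := by
  simp [move, h]

theorem coef_congr {q₁ q₂ q₃ : ℂ} {b : ℂ → ℂ} {I : Finset ℕ} {p p' : ℕ → ℂ} {s : ℕ}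
    (hs : p' s = p s) (h : ∀ l ∈ I, p' l = p l) :
    coef q₁ q₂ q₃ b I p' s = coef q₁ q₂ q₃ b I p s := by
  unfold coef
  rw [hs]
  congr 1
  exact Finset.prod_congr rfl fun l hl => by rw [h l hl]

theorem coef_move {q₁ q₂ q₃ a : ℂ} {b : ℂ → ℂ} {I : Finset ℕ} {p : ℕ → ℂ} {s t : ℕ}
    (hst : s ≠ t) (ht : t ∉ I) :
    coef q₁ q₂ q₃ b I (move a p t) s = coef q₁ q₂ q₃ b I p s :=
  coef_congr (move_ne _ _ hst) fun _ hl => move_ne _ _ fun h => ht (h ▸ hl)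

theorem coef_eq_mul {q₁ q₂ q₃ : ℂ} {b : ℂ → ℂ} {I : Finset ℕ} {p : ℕ → ℂ} {s t : ℕ} (ht : t ∈ I) :
    coef q₁ q₂ q₃ b I p s =
      coef q₁ q₂ q₃ b (I.erase t) p s * gam q₁ q₂ q₃ (p t) (p s) 1 := by
  unfold coef
  rw [← Finset.prod_erase_mul _ _ ht, mul_assoc]

theorem coef_move_eq_mul {q₁ q₂ q₃ a : ℂ} {b : ℂ → ℂ} {I : Finset ℕ} {p : ℕ → ℂ} {s t : ℕ}
    (hst : s ≠ t) (ht : t ∈ I) :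
    coef q₁ q₂ q₃ b I (move a p t) s =
      coef q₁ q₂ q₃ b (I.erase t) p s * gam q₁ q₂ q₃ (a * p t) (p s) 1 := by
  rw [coef_eq_mul ht, coef_move hst (by simp), move_self, move_ne _ _ hst]

/-- The coefficients of the two orders of action on distinct factors `t` and `s`. -/
theorem coef_exchange {q₁ q₂ q₃ : ℂ} (hq : q₁ * q₂ * q₃ = 1) {b : ℂ → ℂ} {I : ℕ → Finset ℕ}
    {p : ℕ → ℂ} {s t : ℕ} (hst : s ≠ t) (ht : t ∈ I s) (hs : s ∉ I t)
    (hd : gden q₁ (p s) (p t) ≠ 0) :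
    coef q₁ q₂ q₃ b (I t) p t * coef q₁ q₂ q₃ b (I s) (move q₁ p t) s *
        gval q₁ q₂ q₃ (p s) (p t) =
      -(coef q₁ q₂ q₃ b (I s) p s * coef q₁ q₂ q₃ b (I t) (move q₁ p s) t *
        gval q₁ q₂ q₃ (p t) (p s)) := by
  rw [coef_move hst.symm hs, coef_move_eq_mul hst ht, coef_eq_mul (p := p) ht,
    gam_eq_div hq hd, gam_mul_eq_div hq hd]
  ring

/-- The coefficient, in `[e₀, [e₁, e₋₁]]`, of the action on the factors `x`, `y`, `z` in this
order. -/
def serreTerm (q₁ q₂ q₃ : ℂ) (b : ℂ → ℂ) (I : ℕ → Finset ℕ) (p : ℕ → ℂ) (x y z : ℕ) : ℂ :=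
  coef q₁ q₂ q₃ b (I x) p x * coef q₁ q₂ q₃ b (I y) (move q₁ p x) y *
    coef q₁ q₂ q₃ b (I z) (move q₁ (move q₁ p x) y) z *
    serreH (p x) (move q₁ p x y) (move q₁ (move q₁ p x) y z)

theorem serreTerm_distinct {q₁ q₂ q₃ : ℂ} (hq : q₁ * q₂ * q₃ = 1) {b : ℂ → ℂ} {I : ℕ → Finset ℕ}
    {p : ℕ → ℂ} (hp : ∀ l, p l ≠ 0) {x y z : ℕ} (hxy : x ≠ y) (hxz : x ≠ z) (hyz : y ≠ z)
    (h1 : x ∈ I y) (h2 : x ∈ I z) (h3 : y ∈ I z) (h4 : y ∉ I x) (h5 : z ∉ I x) (h6 : z ∉ I y)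
    (d1 : gden q₁ (p y) (p x) ≠ 0) (d2 : gden q₁ (p z) (p x) ≠ 0)
    (d3 : gden q₁ (p z) (p y) ≠ 0) :
    serreTerm q₁ q₂ q₃ b I p x y z + serreTerm q₁ q₂ q₃ b I p x z y
      + serreTerm q₁ q₂ q₃ b I p y x z + serreTerm q₁ q₂ q₃ b I p y z x
      + serreTerm q₁ q₂ q₃ b I p z x y + serreTerm q₁ q₂ q₃ b I p z y x = 0 := by
  set A := coef q₁ q₂ q₃ b (I x) p x
  set B := coef q₁ q₂ q₃ b ((I y).erase x) p y
  set C := coef q₁ q₂ q₃ b (((I z).erase x).erase y) p z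
  have hA : ∀ p' : ℕ → ℂ, (∀ l, l ≠ y → l ≠ z → p' l = p l) →
      coef q₁ q₂ q₃ b (I x) p' x = A := fun p' h =>
    coef_congr (h x hxy hxz) fun l hl => h l (fun e => h4 (e ▸ hl)) (fun e => h5 (e ▸ hl))
  have hB : ∀ p' : ℕ → ℂ, (∀ l, l ≠ x → l ≠ z → p' l = p l) →
      coef q₁ q₂ q₃ b (I y) p' y = B * gam q₁ q₂ q₃ (p' x) (p y) 1 := fun p' h => by
    rw [coef_eq_mul h1, h y hxy.symm hyz]
    congr 1
    exact coef_congr (h y hxy.symm hyz) fun l hl =>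
      h l (Finset.ne_of_mem_erase hl) (fun e => h6 (e ▸ Finset.mem_of_mem_erase hl))
  have hC : ∀ p' : ℕ → ℂ, (∀ l, l ≠ x → l ≠ y → p' l = p l) →
      coef q₁ q₂ q₃ b (I z) p' z =
        C * gam q₁ q₂ q₃ (p' y) (p z) 1 * gam q₁ q₂ q₃ (p' x) (p z) 1 := fun p' h => by
    rw [coef_eq_mul h2, coef_eq_mul (t := y) (Finset.mem_erase.2 ⟨hxy.symm, h3⟩),
      h z hxz.symm hyz.symm]
    congr 2
    exact coef_congr (h z hxz.symm hyz.symm) fun l hl =>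
      h l (Finset.ne_of_mem_erase (Finset.mem_of_mem_erase hl)) (Finset.ne_of_mem_erase hl)
  have key := serre_gam_distinct hq (hp x) (hp y) (hp z) d1 d2 d3
  have m : ∀ (p' : ℕ → ℂ) (i l : ℕ), l ≠ i → move q₁ p' i l = p' l := fun p' i l h => move_ne _ _ h
  unfold serreTerm
  rw [hA p fun _ _ _ => rfl,
    hA (move q₁ p y) fun l h _ => m _ _ _ h,
    hA (move q₁ p z) fun l _ h => m _ _ _ h,
    hA (move q₁ (move q₁ p y) z) fun l h h' => by rw [m _ _ _ h', m _ _ _ h],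
    hA (move q₁ (move q₁ p z) y) fun l h h' => by rw [m _ _ _ h, m _ _ _ h'],
    hB p fun _ _ _ => rfl,
    hB (move q₁ p x) fun l h _ => m _ _ _ h,
    hB (move q₁ p z) fun l _ h => m _ _ _ h,
    hB (move q₁ (move q₁ p x) z) fun l h h' => by rw [m _ _ _ h', m _ _ _ h],
    hB (move q₁ (move q₁ p z) x) fun l h h' => by rw [m _ _ _ h, m _ _ _ h'],
    hC p fun _ _ _ => rfl,
    hC (move q₁ p x) fun l h _ => m _ _ _ h,
    hC (move q₁ p y) fun l _ h => m _ _ _ h,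
    hC (move q₁ (move q₁ p x) y) fun l h h' => by rw [m _ _ _ h', m _ _ _ h],
    hC (move q₁ (move q₁ p y) x) fun l h h' => by rw [m _ _ _ h, m _ _ _ h']]
  simp only [move_self, m _ _ _ hxy, m _ _ _ hxy.symm, m _ _ _ hxz, m _ _ _ hxz.symm, m _ _ _ hyz,
    m _ _ _ hyz.symm]
  linear_combination (A * B * C) * key

/-- The factor `s` is used twice, and `t` precedes it. -/
theorem serreTerm_upper {q₁ q₂ q₃ : ℂ} (hq : q₁ * q₂ * q₃ = 1) {b : ℂ → ℂ} {I : ℕ → Finset ℕ}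
    {p : ℕ → ℂ} (hp : ∀ l, p l ≠ 0) {s t : ℕ} (hst : s ≠ t) (h1 : t ∈ I s) (h2 : s ∉ I t)
    (h3 : s ∉ I s) (d : gden q₁ (p s) (p t) ≠ 0) (d' : q₁ * (q₁ * p s) ≠ p t) :
    serreTerm q₁ q₂ q₃ b I p s s t + serreTerm q₁ q₂ q₃ b I p s t s
      + serreTerm q₁ q₂ q₃ b I p t s s = 0 := by
  have hq1 : q₁ ≠ 0 := by rintro rfl; simp at hq
  have hq3 : q₃ ≠ 0 := by rintro rfl; simp at hq
  have hq2 : q₂ = q₁⁻¹ * q₃⁻¹ := by field_simp; linear_combination hq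
  have hts := hst.symm
  have hse : s ∉ (I s).erase t := fun h => h3 (Finset.mem_of_mem_erase h)
  simp only [gden, ne_eq, mul_eq_zero, not_or] at d
  have key := serre_gam_upper hq1 hq3 hq2 (hp s) (hp t) d.1.1 d.1.2 d.2 (sub_ne_zero.2 d')
  unfold serreTerm
  have e1 : move q₁ (move q₁ p s) t s = q₁ * p s := by rw [move_ne _ _ hst, move_self]
  have e2 : move q₁ (move q₁ p t) s s = q₁ * p s := by rw [move_self, move_ne _ _ hst]
  set R₂ := coef q₁ q₂ q₃ b ((I s).erase t) (move q₁ p s) s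
  have c1 : coef q₁ q₂ q₃ b (I s) (move q₁ p s) s = R₂ * gam q₁ q₂ q₃ (p t) (q₁ * p s) 1 := by
    rw [coef_eq_mul h1, move_ne _ _ hts, move_self]
  have c2 : coef q₁ q₂ q₃ b (I s) (move q₁ (move q₁ p s) t) s
      = R₂ * gam q₁ q₂ q₃ (q₁ * p t) (q₁ * p s) 1 := by
    rw [coef_move_eq_mul hst h1, move_self, move_ne _ _ hts]
  have c3 : coef q₁ q₂ q₃ b (I s) (move q₁ (move q₁ p t) s) s
      = R₂ * gam q₁ q₂ q₃ (q₁ * p t) (q₁ * p s) 1 := by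
    rw [← c2]
    congr 1
    ext l
    simp only [move, Function.update_apply]
    split_ifs <;> simp_all
  rw [c1, c2, c3, coef_eq_mul (p := p) h1, coef_move_eq_mul (p := p) hst h1,
    coef_move (p := move q₁ p s) hts h2, coef_move (p := p) hts h2, e1, e2, move_self,
    move_ne _ _ hst, move_ne _ (move q₁ p s) hts, move_ne _ p hts]
  linear_combination (coef q₁ q₂ q₃ b ((I s).erase t) p s * R₂ * coef q₁ q₂ q₃ b (I t) p t) * key

/-- The factor `s` is used twice, and it precedes `t`. -/
theorem serreTerm_lower {q₁ q₂ q₃ : ℂ} (hq : q₁ * q₂ * q₃ = 1) {b : ℂ → ℂ} {I : ℕ → Finset ℕ}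
    {p : ℕ → ℂ} (hp : ∀ l, p l ≠ 0) {s t : ℕ} (hst : s ≠ t) (h1 : s ∈ I t) (h2 : t ∉ I s)
    (h3 : s ∉ I s) (d : gden q₁ (p t) (p s) ≠ 0) (d' : p t ≠ q₁ * (q₁ * p s)) :
    serreTerm q₁ q₂ q₃ b I p s s t + serreTerm q₁ q₂ q₃ b I p s t s
      + serreTerm q₁ q₂ q₃ b I p t s s = 0 := by
  have hq1 : q₁ ≠ 0 := by rintro rfl; simp at hq
  have hq3 : q₃ ≠ 0 := by rintro rfl; simp at hq
  have hq2 : q₂ = q₁⁻¹ * q₃⁻¹ := by field_simp; linear_combination hq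
  have hts := hst.symm
  simp only [gden, ne_eq, mul_eq_zero, not_or] at d
  have key := serre_gam_lower hq1 hq3 hq2 (hp s) (hp t) d.1.1 d.2 d.1.2 (sub_ne_zero.2 d')
  unfold serreTerm
  have e1 : move q₁ (move q₁ p s) t s = q₁ * p s := by rw [move_ne _ _ hst, move_self]
  have e2 : move q₁ (move q₁ p t) s s = q₁ * p s := by rw [move_self, move_ne _ _ hst]
  set T := coef q₁ q₂ q₃ b ((I t).erase s) p t
  have c1 : coef q₁ q₂ q₃ b (I t) (move q₁ (move q₁ p s) s) t
      = T * gam q₁ q₂ q₃ (q₁ * (q₁ * p s)) (p t) 1 := by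
    rw [coef_move_eq_mul hts h1, coef_move hts (by simp), move_self, move_ne _ _ hts]
  have c2 : coef q₁ q₂ q₃ b (I s) (move q₁ (move q₁ p t) s) s
      = coef q₁ q₂ q₃ b (I s) (move q₁ p s) s := by
    refine coef_congr (by rw [e2, move_self]) fun l hl => ?_
    have hls : l ≠ s := fun h => h3 (h ▸ hl)
    have hlt : l ≠ t := fun h => h2 (h ▸ hl)
    rw [move_ne _ _ hls, move_ne _ _ hlt, move_ne _ _ hls]
  rw [c1, c2, coef_move (p := move q₁ p s) hst h2, coef_move (p := p) hst h2,
    coef_move_eq_mul (p := p) hts h1, coef_eq_mul (p := p) h1, e1, e2, move_self,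
    move_ne _ _ hst, move_ne _ (move q₁ p s) hts, move_ne _ p hts]
  linear_combination
    (coef q₁ q₂ q₃ b (I s) p s * coef q₁ q₂ q₃ b (I s) (move q₁ p s) s * T) * key

theorem serreTerm_self {q₁ q₂ q₃ : ℂ} (hq1 : q₁ ≠ 0) {b : ℂ → ℂ} {I : ℕ → Finset ℕ} {p : ℕ → ℂ}
    {s : ℕ} (hp : p s ≠ 0) : serreTerm q₁ q₂ q₃ b I p s s s = 0 := by
  have h : serreH (p s) (move q₁ p s s) (move q₁ (move q₁ p s) s s) = 0 := by
    simp only [move_self, serreH]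
    field_simp
    ring
  rw [serreTerm, h, mul_zero]

/-! ### Resonances between the supports -/

/-- The assumptions on the parameters: `q₁ ^ (1 - r) * q₃ ^ (k + 1) = 1` is, up to powers, the only
relation between `q₁` and `q₃`. -/
structure Resonant (k r : ℕ) (q₁ q₂ q₃ u : ℂ) : Prop where
  one_le : 1 ≤ k
  two_le : 2 ≤ r
  prod_eq : q₁ * q₂ * q₃ = 1
  u_ne : u ≠ 0
  pow_eq_one_iff : ∀ n m : ℤ, q₁ ^ n * q₃ ^ m = 1 ↔
    ∃ α : ℤ, n = (1 - (r : ℤ)) * α ∧ m = ((k : ℤ) + 1) * α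

/-- `q₁ ^ lam_s q₃ ^ s u`: the support of the delta function with which `e(z)` acts on the
`s`-th tensor factor of `|lam⟩`. -/
def pt (q₁ q₃ u : ℂ) (lam : ℕ → ℤ) (s : ℕ) : ℂ := q₁ ^ lam s * q₃ ^ (s : ℤ) * u

namespace Resonant

variable {k r : ℕ} {q₁ q₂ q₃ u : ℂ} {c : ℕ → ℤ} (H : Resonant k r q₁ q₂ q₃ u) {lam mu : ℕ → ℤ}
include H

theorem q₁_ne : q₁ ≠ 0 := by rintro rfl; simpa using H.prod_eq
theorem q₂_ne : q₂ ≠ 0 := by rintro rfl; simpa using H.prod_eq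
theorem q₃_ne : q₃ ≠ 0 := by rintro rfl; simpa using H.prod_eq

theorem q₂_eq : q₂ = q₁⁻¹ * q₃⁻¹ := by
  have := H.q₁_ne
  have := H.q₃_ne
  field_simp
  linear_combination H.prod_eq

theorem q₁_ne_one : q₁ ≠ 1 := by
  intro h
  obtain ⟨α, h1, h2⟩ := (H.pow_eq_one_iff 1 0).1 (by simp [h])
  have : α = 0 := by
    rcases mul_eq_zero.1 h2.symm with h | h
    · omega
    · exact h
  simp [this] at h1

theorem pt_ne_zero (lam : ℕ → ℤ) (s : ℕ) : pt q₁ q₃ u lam s ≠ 0 :=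
  mul_ne_zero (mul_ne_zero (zpow_ne_zero _ H.q₁_ne) (zpow_ne_zero _ H.q₃_ne)) H.u_ne

theorem pt_shift_self (lam : ℕ → ℤ) (s : ℕ) (d : ℤ) :
    pt q₁ q₃ u (shift lam s d) s = q₁ ^ d * pt q₁ q₃ u lam s := by
  rw [pt, shift_self, zpow_add₀ H.q₁_ne, pt]
  ring

theorem pt_eq_iff (s t : ℕ) (e f : ℤ) :
    q₁ ^ e * q₃ ^ f * pt q₁ q₃ u lam t = pt q₁ q₃ u mu s ↔
      ∃ α : ℤ, lam t + e - mu s = (1 - (r : ℤ)) * α ∧ (t : ℤ) + f - s = ((k : ℤ) + 1) * α := by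
  have h1 := H.q₁_ne
  have h3 := H.q₃_ne
  rw [← H.pow_eq_one_iff, zpow_sub₀ h1, zpow_add₀ h1, zpow_sub₀ h3, zpow_add₀ h3]
  have h4 : q₁ ^ mu s ≠ 0 := zpow_ne_zero _ h1
  have h5 : q₃ ^ (s : ℤ) ≠ 0 := zpow_ne_zero _ h3
  have hu := H.u_ne
  rw [div_mul_div_comm, div_eq_one_iff_eq (mul_ne_zero h4 h5)]
  unfold pt
  constructor
  · intro h
    apply mul_right_cancel₀ hu
    linear_combination h
  · intro h
    linear_combination u * h

theorem pt_eq_q₃_mul {s : ℕ} (h : lam s = lam (s + 1)) :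
    pt q₁ q₃ u lam (s + 1) = q₃ * pt q₁ q₃ u lam s := by
  rw [pt, pt, ← h]
  push_cast
  rw [zpow_add_one₀ H.q₃_ne]
  ring

theorem pt_eq_q₂_mul {s : ℕ} (h : lam s - lam (s + k) = r) :
    pt q₁ q₃ u lam (s + k) = q₂ * pt q₁ q₃ u lam s := by
  have h1 := (H.pt_eq_iff (lam := lam) (mu := lam) (s + k) s (-1) (-1)).2
    ⟨-1, by linarith, by push_cast; ring⟩
  rw [← h1, H.q₂_eq, zpow_neg_one, zpow_neg_one]

/-- Since `k` consecutive gaps add up to at least `r`, a coincidence `q₁ ^ e x_t = x_s` with `s < t`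
spans at most `e` periods of length `k + 1`. -/
theorem exists_of_pt_eq (hS : lam ∈ S k r c) {s t : ℕ} (hst : s < t) {e : ℤ}
    (h : q₁ ^ e * pt q₁ q₃ u lam t = pt q₁ q₃ u lam s) :
    ∃ n : ℕ, 1 ≤ n ∧ (n : ℤ) ≤ e ∧ t = s + n * (k + 1) ∧ lam s - lam t = n * ((r : ℤ) - 1) + e := by
  obtain ⟨α, h1, h2⟩ := (H.pt_eq_iff (lam := lam) (mu := lam) s t e 0).1 (by simpa using h)
  have hα : 1 ≤ α := by
    by_contra hα
    have : ((k : ℤ) + 1) * α ≤ 0 := mul_nonpos_of_nonneg_of_nonpos (by omega) (by omega)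
    omega
  lift α to ℕ using by omega
  have h3 : t = s + α * (k + 1) := by
    have : (t : ℤ) = s + α * (k + 1) := by linarith
    exact_mod_cast this
  have h4 := le_sub_of_mem_S hS s t α (by rw [h3]; nlinarith)
  refine ⟨α, by exact_mod_cast hα, by linarith, h3, by linarith⟩

theorem pt_ne_of_nonpos (hS : lam ∈ S k r c) {s t : ℕ} (hst : s < t) {e : ℤ} (he : e ≤ 0) :
    q₁ ^ e * pt q₁ q₃ u lam t ≠ pt q₁ q₃ u lam s := by
  intro h
  obtain ⟨n, h1, h2, -⟩ := H.exists_of_pt_eq hS hst h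
  omega

/-- If `q₁ x_t = x_s` with `s < t`, the gap conditions at `s` and `s + 1` are both saturated; after
a change of `lam` that keeps it admissible, the changes at `s`, `s + 1`, `s + k`, `t` decrease. -/
theorem shape_of_pt_eq (hS : lam ∈ S k r c) (hS' : mu ∈ S k r c) {s t : ℕ} (hst : s < t)
    (h : q₁ * pt q₁ q₃ u lam t = pt q₁ q₃ u lam s) :
    t = s + k + 1 ∧ k ≠ 1 ∧
      mu (s + 1) - lam (s + 1) ≤ mu s - lam s ∧ mu t - lam t ≤ mu (s + 1) - lam (s + 1) ∧
      mu (s + k) - lam (s + k) ≤ mu s - lam s ∧ mu t - lam t ≤ mu (s + k) - lam (s + k) := by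
  have hr := H.two_le
  obtain ⟨n, h1, h2, h3, h4⟩ := H.exists_of_pt_eq hS hst (e := 1) (by simpa using h)
  obtain rfl : n = 1 := by omega
  obtain rfl : t = s + k + 1 := by omega
  have a1 := hS.1 (Nat.le_succ s)
  have a2 := hS.1 (Nat.le_succ (s + k))
  have a3 := hS.2.1 s
  have a4 := hS.2.1 (s + 1)
  have b1 := hS'.1 (Nat.le_succ s)
  have b2 := hS'.1 (Nat.le_succ (s + k))
  have b3 := hS'.2.1 s
  have b4 := hS'.2.1 (s + 1)
  rw [show s + 1 + k = s + k + 1 by ring] at a4 b4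
  simp only [Nat.succ_eq_add_one] at a1 a2 b1 b2
  push_cast at h4
  refine ⟨rfl, ?_, by omega, by omega, by omega, by omega⟩
  rintro rfl
  omega

/-- The separation of supports of the factors `s < t`, if both are moved in the same direction and
the result is admissible. -/
theorem separated_of_same_direction (hS : lam ∈ S k r c) (hS' : mu ∈ S k r c) {s t : ℕ}
    (hst : s < t)
    (h : q₁ * pt q₁ q₃ u lam t = pt q₁ q₃ u lam s →
      t = s + k + 1 → k ≠ 1 → mu (s + 1) - lam (s + 1) ≤ mu s - lam s →
      mu t - lam t ≤ mu (s + 1) - lam (s + 1) → mu (s + k) - lam (s + k) ≤ mu s - lam s →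
      mu t - lam t ≤ mu (s + k) - lam (s + k) → False) :
    pt q₁ q₃ u lam t ≠ pt q₁ q₃ u lam s ∧ q₁ * pt q₁ q₃ u lam t ≠ pt q₁ q₃ u lam s ∧
      pt q₁ q₃ u lam t ≠ q₁ * pt q₁ q₃ u lam s := by
  refine ⟨?_, fun h' => ?_, fun h' => ?_⟩
  · simpa using H.pt_ne_of_nonpos hS hst le_rfl
  · obtain ⟨h1, h2, h3, h4, h5, h6⟩ := H.shape_of_pt_eq hS hS' hst h'
    exact h h' h1 h2 h3 h4 h5 h6
  · refine H.pt_ne_of_nonpos hS hst (e := -1) (by norm_num) ?_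
    rw [h', zpow_neg_one, inv_mul_cancel_left₀ H.q₁_ne]

/-- The resonance `q₁ ^ 2 x_t = x_s` leaves the gap conditions between `s` and `t` at most one step
away from saturation, which is incompatible with moving `t` up relative to `s` as in `h` and `h'`. -/
theorem pt_ne_of_two (hS : lam ∈ S k r c) (hS' : mu ∈ S k r c) {s t : ℕ} (hst : s < t)
    (h : mu s - lam s < mu t - lam t)
    (h' : (s + 1 ≠ t → mu (s + 1) = lam (s + 1)) ∧ (0 < mu s - lam s ∨ mu t - lam t < 0) ∨
      mu s - lam s + 2 ≤ mu t - lam t) :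
    q₁ * (q₁ * pt q₁ q₃ u lam t) ≠ pt q₁ q₃ u lam s := by
  have hr := H.two_le
  have hk := H.one_le
  intro he
  obtain ⟨n, h1, h2, h3, h4⟩ := H.exists_of_pt_eq hS hst (e := 2) (by
    rw [← he, zpow_two, mul_assoc])
  obtain rfl | rfl : n = 1 ∨ n = 2 := by omega
  · obtain rfl : t = s + k + 1 := by omega
    have a1 := hS.1 (Nat.le_succ s)
    have a4 := hS.2.1 (s + 1)
    have b1 := hS'.1 (Nat.le_succ s)
    have b4 := hS'.2.1 (s + 1)
    have b5 := le_sub_of_mem_S hS' s (s + k + 1) 1 (by omega)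
    rw [show s + 1 + k = s + k + 1 by ring] at a4 b4
    simp only [Nat.succ_eq_add_one] at a1 b1
    push_cast at h4 b5
    rw [show (s + 1 ≠ s + k + 1 → mu (s + 1) = lam (s + 1)) ↔ mu (s + 1) = lam (s + 1) from
      ⟨fun h => h (by omega), fun h _ => h⟩] at h'
    omega
  · have b := le_sub_of_mem_S hS' s t 2 (by omega)
    push_cast at h4 b
    omega

end Resonant

/-! ### The structure coefficients on admissible sequences -/

theorem gam_inv {q₁ q₂ q₃ : ℂ} (hq : q₁ * q₂ * q₃ = 1) (x z : ℂ) :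
    gam q₁⁻¹ q₂⁻¹ q₃⁻¹ (q₁⁻¹ * x) z 1 = gam q₁ q₂ q₃ x z 1 := by
  have h1 : q₁ ≠ 0 := by rintro rfl; simp at hq
  have h2 : q₃⁻¹ * (q₁⁻¹ * x) = q₂ * x := by
    have h3 : q₃ ≠ 0 := by rintro rfl; simp at hq
    field_simp
    linear_combination (-x) * hq
  have h3 : q₂⁻¹ * (q₁⁻¹ * x) = q₃ * x := by
    have h3 : q₂ ≠ 0 := by rintro rfl; simp at hq
    field_simp
    linear_combination (-x) * hq
  rw [gam, gam, h2, h3, inv_inv, mul_inv_cancel_left₀ h1]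
  simp only [factor]
  ring

/-- The contribution `∏ (1 - q₃ x_l / z) / (1 - x_l / z)`, over the period `N ≤ l < N + k`, of the
tensor factors from `N` on: their infinite product telescopes, because `x_{l + k} = q₂ x_l` in the
tail. -/
def tailProd {R : Type} [CommRing R] [Algebra ℂ R] [Inv R] (q₁ q₃ u : ℂ) (k N : ℕ) (lam : ℕ → ℤ)
    (z y : R) : R :=
  ∏ l ∈ Finset.Ico N (N + k), factor (q₃ * pt q₁ q₃ u lam l) (pt q₁ q₃ u lam l) z y

/-- The coefficient of `|lam + 1_s⟩` in `e(z) |lam⟩`. -/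
def eCo (q₁ q₂ q₃ u : ℂ) (lam : ℕ → ℤ) (s : ℕ) : ℂ :=
  coef q₁ q₂ q₃ (fun _ => (1 - q₁)⁻¹) (Finset.range s) (pt q₁ q₃ u lam) s

/-- The support of the delta function with which `f(z)` acts on the `s`-th factor. -/
def ptF (q₁ q₃ u : ℂ) (lam : ℕ → ℤ) (s : ℕ) : ℂ := q₁⁻¹ * pt q₁ q₃ u lam s

/-- The coefficient of `|lam - 1_s⟩` in `f(z) |lam⟩`, computed from the first `N` factors. The
currents `f` have the structure of the currents `e` for the inverse parameters and the reversed
order of the factors. -/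
def fCo (q₁ q₂ q₃ u : ℂ) (k N : ℕ) (lam : ℕ → ℤ) (s : ℕ) : ℂ :=
  coef q₁⁻¹ q₂⁻¹ q₃⁻¹ (fun z => -(1 - q₁⁻¹)⁻¹ * tailProd q₁ q₃ u k N lam z 1) (Finset.Ioo s N)
    (ptF q₁ q₃ u lam) s

theorem pt_shift {q₁ : ℂ} (q₃ u : ℂ) (hq : q₁ ≠ 0) (lam : ℕ → ℤ) (s : ℕ) :
    pt q₁ q₃ u (shift lam s 1) = move q₁ (pt q₁ q₃ u lam) s := by
  ext l
  by_cases h : l = s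
  · subst h
    rw [move_self, pt, shift_self, zpow_add_one₀ hq, pt]
    ring
  · rw [move_ne _ _ h, pt, shift_ne _ h, pt]

theorem pt_lower {q₁ : ℂ} (q₃ u : ℂ) (hq : q₁ ≠ 0) (lam : ℕ → ℤ) (s : ℕ) :
    pt q₁ q₃ u (shift lam s (-1)) = move q₁⁻¹ (pt q₁ q₃ u lam) s := by
  ext l
  by_cases h : l = s
  · subst h
    rw [move_self, pt, shift_self, zpow_add₀ hq, zpow_neg_one, pt]
    ring
  · rw [move_ne _ _ h, pt, shift_ne _ h, pt]

theorem ptF_shift {q₁ : ℂ} (q₃ u : ℂ) (hq : q₁ ≠ 0) (lam : ℕ → ℤ) (s : ℕ) :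
    ptF q₁ q₃ u (shift lam s (-1)) = move q₁⁻¹ (ptF q₁ q₃ u lam) s := by
  ext l
  unfold ptF
  rw [pt_lower q₃ u hq]
  by_cases h : l = s
  · subst h
    rw [move_self, move_self]
  · rw [move_ne _ _ h, move_ne _ _ h]

theorem tailProd_congr {R : Type} [CommRing R] [Algebra ℂ R] [Inv R] {q₁ q₃ u : ℂ} {k N : ℕ}
    {lam mu : ℕ → ℤ} (h : ∀ l, N ≤ l → lam l = mu l) (z y : R) :
    tailProd q₁ q₃ u k N lam z y = tailProd q₁ q₃ u k N mu z y := by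
  refine Finset.prod_congr rfl fun l hl => ?_
  simp only [pt, h l (Finset.mem_Ico.1 hl).1]

theorem tailProd_shift {R : Type} [CommRing R] [Algebra ℂ R] [Inv R] {q₁ q₃ u : ℂ} {k N : ℕ}
    {lam : ℕ → ℤ} {s : ℕ} (hs : s < N) (d : ℤ) (z y : R) :
    tailProd q₁ q₃ u k N (shift lam s d) z y = tailProd q₁ q₃ u k N lam z y :=
  tailProd_congr (fun _ hl => shift_ne _ (by omega) d) z y

namespace Resonant

variable {k r : ℕ} {q₁ q₂ q₃ u : ℂ} {c : ℕ → ℤ} (H : Resonant k r q₁ q₂ q₃ u) {lam mu : ℕ → ℤ}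
include H

theorem inv_prod_eq : q₁⁻¹ * q₂⁻¹ * q₃⁻¹ = 1 := by
  rw [← mul_inv, ← mul_inv, H.prod_eq, inv_one]

theorem fCo_eq (N : ℕ) (lam : ℕ → ℤ) (s : ℕ) :
    fCo q₁ q₂ q₃ u k N lam s = -(1 - q₁⁻¹)⁻¹ * tailProd q₁ q₃ u k N lam (ptF q₁ q₃ u lam s) 1 *
      ∏ l ∈ Finset.Ioo s N, gam q₁ q₂ q₃ (pt q₁ q₃ u lam l) (ptF q₁ q₃ u lam s) 1 := by
  unfold fCo coef
  congr 1
  refine Finset.prod_congr rfl fun l _ => ?_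
  rw [ptF, gam_inv H.prod_eq]

theorem gam_eq_zero_of_eq {s : ℕ} (h : lam s = lam (s + 1)) :
    gam q₁ q₂ q₃ (pt q₁ q₃ u lam s) (pt q₁ q₃ u lam (s + 1)) 1 = 0 := by
  simp [gam, factor, H.pt_eq_q₃_mul h]

theorem gam_eq_zero_of_gap {s : ℕ} (h : lam s - lam (s + k) = r) :
    gam q₁ q₂ q₃ (pt q₁ q₃ u lam s) (pt q₁ q₃ u lam (s + k)) 1 = 0 := by
  simp [gam, factor, H.pt_eq_q₂_mul h]

theorem gam_lower_eq_zero_of_eq {s : ℕ} (h : lam s = lam (s + 1)) :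
    gam q₁ q₂ q₃ (pt q₁ q₃ u lam (s + 1)) (ptF q₁ q₃ u lam s) 1 = 0 := by
  have h3 := H.q₃_ne
  have : q₂ * pt q₁ q₃ u lam (s + 1) = q₁⁻¹ * pt q₁ q₃ u lam s := by
    rw [H.pt_eq_q₃_mul h, H.q₂_eq]
    field_simp
  simp [gam, factor, ptF, this]

theorem factor_lower_eq_zero_of_gap {s : ℕ} (h : lam s - lam (s + k) = r) :
    factor (q₃ * pt q₁ q₃ u lam (s + k)) (pt q₁ q₃ u lam (s + k)) (ptF q₁ q₃ u lam s) 1 = 0 := by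
  have h3 := H.q₃_ne
  have : q₃ * pt q₁ q₃ u lam (s + k) = q₁⁻¹ * pt q₁ q₃ u lam s := by
    rw [H.pt_eq_q₂_mul h, H.q₂_eq]
    field_simp
  simp [factor, ptF, this]

theorem gam_lower_eq_zero_of_gap {s : ℕ} (h : lam s - lam (s + k) = r) :
    gam q₁ q₂ q₃ (pt q₁ q₃ u lam (s + k)) (ptF q₁ q₃ u lam s) 1 = 0 := by
  have h3 := H.q₃_ne
  have : q₃ * pt q₁ q₃ u lam (s + k) = q₁⁻¹ * pt q₁ q₃ u lam s := by
    rw [H.pt_eq_q₂_mul h, H.q₂_eq]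
    field_simp
  simp [gam, factor, ptF, this]

/-- `e(z)` preserves admissibility. -/
theorem eCo_eq_zero (hS : lam ∈ S k r c) {s : ℕ} (hs : shift lam s 1 ∉ S k r c) :
    eCo q₁ q₂ q₃ u lam s = 0 := by
  have hk := H.one_le
  rw [raise_mem_S_iff hk hS] at hs
  unfold eCo coef
  refine mul_eq_zero_of_right _ ?_
  by_cases h1 : ∀ j, j + 1 = s → lam s < lam j
  · have h2 : ¬ ∀ j, j + k = s → (r : ℤ) < lam j - lam s := fun h => hs ⟨h1, h⟩
    push Not at h2
    obtain ⟨j, rfl, hj⟩ := h2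
    exact Finset.prod_eq_zero (i := j) (by simp; omega)
      (H.gam_eq_zero_of_gap (le_antisymm hj (hS.2.1 j)))
  · push Not at h1
    obtain ⟨j, rfl, hj⟩ := h1
    exact Finset.prod_eq_zero (i := j) (by simp)
      (H.gam_eq_zero_of_eq (le_antisymm hj (hS.1 (Nat.le_succ j))))

/-- `f(z)` preserves admissibility. -/
theorem fCo_eq_zero (hS : lam ∈ S k r c) {N : ℕ} (hN : Settled k r c N lam) {s : ℕ} (hsN : s < N)
    (hs : shift lam s (-1) ∉ S k r c) : fCo q₁ q₂ q₃ u k N lam s = 0 := by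
  have hk := H.one_le
  rw [lower_mem_S_iff hk hS] at hs
  rw [H.fCo_eq]
  by_cases h1 : lam s - lam (s + k) = r
  · by_cases h2 : s + k < N
    · exact mul_eq_zero_of_right _ (Finset.prod_eq_zero (i := s + k) (by simp; omega)
        (H.gam_lower_eq_zero_of_gap h1))
    · refine mul_eq_zero_of_left (mul_eq_zero_of_right _ ?_) _
      exact Finset.prod_eq_zero (i := s + k) (by simp; omega) (H.factor_lower_eq_zero_of_gap h1)
  · have h2 := hS.2.1 s
    have h3 : lam s = lam (s + 1) := by
      have h4 := hS.1 (Nat.le_succ s)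
      simp only [Nat.succ_eq_add_one] at h4
      by_contra h5
      exact hs ⟨by omega, by omega⟩
    have h4 : s + k < N := by
      by_contra h5
      have := hN.gap hk (j := s) (by omega)
      omega
    exact mul_eq_zero_of_right _ (Finset.prod_eq_zero (i := s + 1) (by simp; omega)
      (H.gam_lower_eq_zero_of_eq h3))

/-- One factor of the tail telescopes into the product over a period. -/
theorem tailProd_eq {R : Type} [CommRing R] [Algebra ℂ R] [Inv R] {N : ℕ}
    (hN : Settled k r c N lam) {z y : R}
    (h1 : (z - (q₁⁻¹ * pt q₁ q₃ u lam N) • y) * (z - (q₁⁻¹ * pt q₁ q₃ u lam N) • y)⁻¹ = 1)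
    (h2 : (z - (q₂ * pt q₁ q₃ u lam N) • y) * (z - (q₂ * pt q₁ q₃ u lam N) • y)⁻¹ = 1) :
    tailProd q₁ q₃ u k N lam z y =
      tailProd q₁ q₃ u k (N + 1) lam z y * gam q₁ q₂ q₃ (pt q₁ q₃ u lam N) z y := by
  have hk := H.one_le
  have h3 : pt q₁ q₃ u lam (N + k) = q₂ * pt q₁ q₃ u lam N :=
    H.pt_eq_q₂_mul (by have := hN.gap hk (j := N) (by omega); omega)
  have h4 : q₃ * (q₂ * pt q₁ q₃ u lam N) = q₁⁻¹ * pt q₁ q₃ u lam N := by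
    have := H.q₃_ne
    rw [H.q₂_eq]
    field_simp
  unfold tailProd
  rw [Finset.prod_eq_prod_Ico_succ_bot (by omega), show N + 1 + k = N + k + 1 by ring,
    Finset.prod_Ico_succ_top (by omega), h3]
  simp only [gam, factor, h4]
  set A := z - (q₁⁻¹ * pt q₁ q₃ u lam N) • y
  set B := z - (q₂ * pt q₁ q₃ u lam N) • y
  set P := ∏ l ∈ Finset.Ico (N + 1) (N + k), (z - (q₃ * pt q₁ q₃ u lam l) • y) *
    (z - pt q₁ q₃ u lam l • y)⁻¹
  set C := z - (q₃ * pt q₁ q₃ u lam N) • y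
  set D := (z - pt q₁ q₃ u lam N • y)⁻¹
  linear_combination (-(P * C * D) * B * B⁻¹) * h1 - (P * C * D) * h2

/-- The coefficients of `f(z)` become stationary. -/
theorem fCo_succ (hS : lam ∈ S k r c) {N : ℕ} (hN : Settled k r c N lam) {s : ℕ}
    (hs : shift lam s (-1) ∈ S k r c) :
    fCo q₁ q₂ q₃ u k (N + 1) lam s = fCo q₁ q₂ q₃ u k N lam s := by
  have hk := H.one_le
  have hsN := hN.lt_of_lower_mem hk hS hs
  have h1 : ptF q₁ q₃ u lam s - q₁⁻¹ * pt q₁ q₃ u lam N ≠ 0 := by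
    rw [ptF, ← mul_sub]
    refine mul_ne_zero (inv_ne_zero H.q₁_ne) (sub_ne_zero.2 fun h => ?_)
    exact H.pt_ne_of_nonpos hS (s := s) (t := N) (by omega) le_rfl (by rw [h]; simp)
  have h2 : ptF q₁ q₃ u lam s - q₂ * pt q₁ q₃ u lam N ≠ 0 := by
    intro h
    have h3 : q₁ ^ (0 : ℤ) * q₃ ^ (-1 : ℤ) * pt q₁ q₃ u lam N = pt q₁ q₃ u lam s := by
      have e1 := H.q₁_ne
      have e3 := H.q₃_ne
      rw [ptF, H.q₂_eq] at h
      simp only [zpow_zero, zpow_neg_one, one_mul]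
      field_simp at h ⊢
      linear_combination -h
    obtain ⟨α, a1, a2⟩ := (H.pt_eq_iff (lam := lam) (mu := lam) s N 0 (-1)).1 h3
    have hα : 1 ≤ α := by
      by_contra hα
      have : ((k : ℤ) + 1) * α ≤ 0 := mul_nonpos_of_nonneg_of_nonpos (by omega) (by omega)
      omega
    lift α to ℕ using by omega
    have a3 : N = s + α * (k + 1) + 1 := by
      have : (N : ℤ) = s + α * (k + 1) + 1 := by linarith
      exact_mod_cast this
    have a4 := le_sub_of_mem_S hS s N α (by rw [a3]; nlinarith)
    linarith
  rw [H.fCo_eq, H.fCo_eq, H.tailProd_eq hN (z := ptF q₁ q₃ u lam s) (y := 1)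
    (by rw [smul_eq_mul, mul_one]; exact mul_inv_cancel₀ h1)
    (by rw [smul_eq_mul, mul_one]; exact mul_inv_cancel₀ h2),
    show Finset.Ioo s (N + 1) = Finset.Ico (s + 1) (N + 1) by ext; simp,
    Finset.prod_Ico_succ_top (by omega),
    show Finset.Ico (s + 1) N = Finset.Ioo s N by ext; simp]
  ring

end Resonant

/-- The eigenvalue of `ψ^±(z)` on `|lam⟩`, computed from the first `N` factors. -/
def psiSer (q₁ q₂ q₃ u : ℂ) (k : ℕ) (ε : Sgn) (N : ℕ) (lam : ℕ → ℤ) : PowerSeries ℂ :=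
  expand ε (tailProd q₁ q₃ u k N lam) *
    ∏ l ∈ Finset.range N, expand ε (gam q₁ q₂ q₃ (pt q₁ q₃ u lam l))

theorem expand_tailProd (ε : Sgn) (q₁ q₃ u : ℂ) (k N : ℕ) (lam : ℕ → ℤ) :
    expand ε (tailProd q₁ q₃ u k N lam) = ∏ l ∈ Finset.Ico N (N + k),
      (lin ε (q₃ * pt q₁ q₃ u lam l) * (lin ε (pt q₁ q₃ u lam l))⁻¹) := by
  cases ε <;> rfl

namespace Resonant

variable {k r : ℕ} {q₁ q₂ q₃ u : ℂ} {c : ℕ → ℤ} (H : Resonant k r q₁ q₂ q₃ u) {lam mu : ℕ → ℤ}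
include H

theorem psiSer_succ (ε : Sgn) {N : ℕ} (hN : Settled k r c N lam) :
    psiSer q₁ q₂ q₃ u k ε (N + 1) lam = psiSer q₁ q₂ q₃ u k ε N lam := by
  have h : expand ε (tailProd q₁ q₃ u k N lam) = expand ε (tailProd q₁ q₃ u k (N + 1) lam) *
      expand ε (gam q₁ q₂ q₃ (pt q₁ q₃ u lam N)) := by
    have h1 := lin_mul_inv ε (mul_ne_zero (inv_ne_zero H.q₁_ne) (H.pt_ne_zero lam N))
    have h2 := lin_mul_inv ε (mul_ne_zero H.q₂_ne (H.pt_ne_zero lam N))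
    cases ε
    · exact H.tailProd_eq hN h1 h2
    · exact H.tailProd_eq hN h1 h2
  rw [psiSer, psiSer, h, Finset.prod_range_succ]
  ring

theorem psiSer_eq (ε : Sgn) {N M : ℕ} (hN : Settled k r c N lam) (hNM : N ≤ M) :
    psiSer q₁ q₂ q₃ u k ε M lam = psiSer q₁ q₂ q₃ u k ε N lam := by
  induction M, hNM using Nat.le_induction with
  | base => rfl
  | succ M hM ih => rw [H.psiSer_succ ε (hN.mono hM), ih]

theorem fCo_stable (hS : lam ∈ S k r c) {N M : ℕ} (hN : Settled k r c N lam) (hNM : N ≤ M) {s : ℕ}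
    (hs : shift lam s (-1) ∈ S k r c) :
    fCo q₁ q₂ q₃ u k M lam s = fCo q₁ q₂ q₃ u k N lam s := by
  induction M, hNM using Nat.le_induction with
  | base => rfl
  | succ M hM ih => rw [H.fCo_succ hS (hN.mono hM) hs, ih]

end Resonant

/-! ### The operators on the semi-infinite space -/

/-- The space with basis `S^{k,r}_c`, a model of `W^{k,r}_c(u)`. -/
abbrev U (k r : ℕ) (c : ℕ → ℤ) : Type := S k r c →₀ ℂ

/-- The identification of the basis vectors of the model with the vectors `|lam⟩`. -/
def toW (k r : ℕ) (c : ℕ → ℤ) : U k r c ≃ₗ[ℂ] W k r c :=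
  (Finsupp.supportedEquivFinsupp (S k r c)).symm.trans
    (LinearEquiv.ofEq _ (W k r c) (Finsupp.supported_eq_span_single ℂ (S k r c)))

theorem toW_single {k r : ℕ} {c : ℕ → ℤ} (lam : S k r c) :
    toW k r c (Finsupp.single lam 1) = ketW lam := by
  apply Subtype.ext
  exact Finsupp.supportedEquivFinsupp_symm_single (R := ℂ) (S k r c) lam (1 : ℂ)

open Classical in
/-- The basis vector `|mu⟩`, which is zero if `mu` is not admissible. -/
def vec (k r : ℕ) (c : ℕ → ℤ) (mu : ℕ → ℤ) : U k r c :=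
  if h : mu ∈ S k r c then Finsupp.single ⟨mu, h⟩ 1 else 0

theorem vec_of_mem {k r : ℕ} {c : ℕ → ℤ} {mu : ℕ → ℤ} (h : mu ∈ S k r c) :
    vec k r c mu = Finsupp.single ⟨mu, h⟩ 1 := dif_pos h

theorem vec_of_notMem {k r : ℕ} {c : ℕ → ℤ} {mu : ℕ → ℤ} (h : mu ∉ S k r c) :
    vec k r c mu = 0 := dif_neg h

theorem end_ext {k r : ℕ} {c : ℕ → ℤ} {X Y : Module.End ℂ (U k r c)}
    (h : ∀ lam ∈ S k r c, X (vec k r c lam) = Y (vec k r c lam)) : X = Y := by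
  refine Finsupp.lhom_ext' fun lam => LinearMap.ext_ring ?_
  have := h lam.1 lam.2
  rwa [vec_of_mem lam.2] at this

/-- A number of factors at which `lam` is settled. -/
def stab {k r : ℕ} {c : ℕ → ℤ} (lam : S k r c) : ℕ := (exists_settled lam.2).choose

theorem settled_stab {k r : ℕ} {c : ℕ → ℤ} (lam : S k r c) :
    Settled k r c (stab lam) lam.1 := (exists_settled lam.2).choose_spec

/-- The mode `z ^ (-n)` of the current that moves the `s`-th part of `lam` by `d`, with the delta
function supported at `p lam s` and the coefficient `co N lam s` computed from `N` factors. -/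
def stepAct (k r : ℕ) (c : ℕ → ℤ) (d : ℤ) (co : ℕ → (ℕ → ℤ) → ℕ → ℂ) (p : (ℕ → ℤ) → ℕ → ℂ)
    (n : ℤ) : Module.End ℂ (U k r c) :=
  Finsupp.linearCombination ℂ fun lam => ∑ s ∈ Finset.range (stab lam),
    (co (stab lam) lam.1 s * p lam.1 s ^ n) • vec k r c (shift lam.1 s d)

/-- The modes `X n` act on admissible vectors by moving one part by `d = ± 1`; the coefficients of
the forbidden moves vanish. -/
structure IsStep (k r : ℕ) (c : ℕ → ℤ) (d : ℤ) (co : ℕ → (ℕ → ℤ) → ℕ → ℂ) (p : (ℕ → ℤ) → ℕ → ℂ)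
    (X : ℤ → Module.End ℂ (U k r c)) : Prop where
  one_le : 1 ≤ k
  dir : d = 1 ∨ d = -1
  vanish : ∀ N lam s, lam ∈ S k r c → Settled k r c N lam → s < N → shift lam s d ∉ S k r c →
    co N lam s = 0
  act : ∀ N lam n, lam ∈ S k r c → Settled k r c N lam → X n (vec k r c lam) =
    ∑ s ∈ Finset.range N, (co N lam s * p lam s ^ n) • vec k r c (shift lam s d)

theorem isStep_stepAct {k r : ℕ} {c : ℕ → ℤ} {d : ℤ} {co : ℕ → (ℕ → ℤ) → ℕ → ℂ}
    {p : (ℕ → ℤ) → ℕ → ℂ} (hk : 1 ≤ k) (hd : d = 1 ∨ d = -1)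
    (hv : ∀ N lam s, lam ∈ S k r c → Settled k r c N lam → s < N → shift lam s d ∉ S k r c →
      co N lam s = 0)
    (hco : ∀ N M lam s, lam ∈ S k r c → Settled k r c N lam → N ≤ M → shift lam s d ∈ S k r c →
      co M lam s = co N lam s) :
    IsStep k r c d co p (stepAct k r c d co p) := by
  refine ⟨hk, hd, hv, fun N lam n hS hN => ?_⟩
  have key : ∀ N M, Settled k r c N lam → N ≤ M →
      ∑ s ∈ Finset.range M, (co M lam s * p lam s ^ n) • vec k r c (shift lam s d) =
        ∑ s ∈ Finset.range N, (co N lam s * p lam s ^ n) • vec k r c (shift lam s d) := by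
    intro N M hN hNM
    symm
    rw [← Finset.sum_subset (Finset.range_mono hNM)]
    · refine Finset.sum_congr rfl fun s _ => ?_
      by_cases h : shift lam s d ∈ S k r c
      · rw [hco N M lam s hS hN hNM h]
      · simp [vec_of_notMem h]
    · intro s _ hs
      have h : shift lam s d ∉ S k r c := fun h =>
        hs (Finset.mem_range.2 (hN.shift hk hS hd h le_rfl).1)
      simp [vec_of_notMem h]
  have h1 : stepAct k r c d co p n (vec k r c lam) =
      ∑ s ∈ Finset.range (stab ⟨lam, hS⟩),
        (co (stab ⟨lam, hS⟩) lam s * p lam s ^ n) • vec k r c (shift lam s d) := by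
    rw [vec_of_mem hS, stepAct, Finsupp.linearCombination_single, one_smul]
  rw [h1, ← key _ (max N (stab ⟨lam, hS⟩)) (settled_stab ⟨lam, hS⟩) (le_max_right _ _),
    key N _ hN (le_max_left _ _)]

theorem IsStep.act_act {k r : ℕ} {c : ℕ → ℤ} {d d' : ℤ} {co co' : ℕ → (ℕ → ℤ) → ℕ → ℂ}
    {p p' : (ℕ → ℤ) → ℕ → ℂ} {X X' : ℤ → Module.End ℂ (U k r c)}
    (hX : IsStep k r c d co p X) (hX' : IsStep k r c d' co' p' X') {N M : ℕ} {lam : ℕ → ℤ}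
    (hS : lam ∈ S k r c) (hN : Settled k r c N lam) (hM : N + k + 1 ≤ M) (i j : ℤ) :
    X i (X' j (vec k r c lam)) = ∑ t ∈ Finset.range M, ∑ s ∈ Finset.range M,
      (co' M lam t * co M (shift lam t d') s * (p (shift lam t d') s ^ i * p' lam t ^ j)) •
        vec k r c (shift (shift lam t d') s d) := by
  have hNM := hN.mono (show N ≤ M by omega)
  rw [hX'.act M lam j hS hNM, map_sum]
  refine Finset.sum_congr rfl fun t ht => ?_
  rw [map_smul]
  by_cases h : shift lam t d' ∈ S k r c
  · rw [hX.act M _ i h (hN.shift hX.one_le hS hX'.dir h hM).2, Finset.smul_sum]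
    refine Finset.sum_congr rfl fun s _ => ?_
    rw [smul_smul]
    congr 1
    ring
  · simp [hX'.vanish M lam t hS hNM (Finset.mem_range.1 ht) h]

theorem IsStep.act_act_act {k r : ℕ} {c : ℕ → ℤ} {d : ℤ} {co : ℕ → (ℕ → ℤ) → ℕ → ℂ}
    {p : (ℕ → ℤ) → ℕ → ℂ} {X : ℤ → Module.End ℂ (U k r c)}
    (hX : IsStep k r c d co p X) {N M : ℕ} {lam : ℕ → ℤ}
    (hS : lam ∈ S k r c) (hN : Settled k r c N lam) (hM : N + (k + 1) + (k + 1) ≤ M) (i j l : ℤ) :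
    X i (X j (X l (vec k r c lam))) =
      ∑ a ∈ Finset.range M, ∑ b ∈ Finset.range M, ∑ e ∈ Finset.range M,
      (co M lam a * co M (shift lam a d) b * co M (shift (shift lam a d) b d) e *
        (p (shift (shift lam a d) b d) e ^ i * p (shift lam a d) b ^ j * p lam a ^ l)) •
        vec k r c (shift (shift (shift lam a d) b d) e d) := by
  have hNM := hN.mono (show N ≤ M by omega)
  rw [hX.act M lam l hS hNM, map_sum, map_sum]
  refine Finset.sum_congr rfl fun t ht => ?_
  rw [map_smul, map_smul]
  by_cases h : shift lam t d ∈ S k r c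
  · rw [hX.act_act hX h (hN.shift hX.one_le hS hX.dir h le_rfl).2 (by omega), Finset.smul_sum]
    refine Finset.sum_congr rfl fun s _ => ?_
    rw [Finset.smul_sum]
    refine Finset.sum_congr rfl fun e _ => ?_
    rw [smul_smul]
    congr 1
    ring
  · simp [hX.vanish M lam t hS hNM (Finset.mem_range.1 ht) h]

/-- The effect of multiplication by `g(z, w)` on a product of two delta functions. -/
theorem gCoeff_monomial {q₁ q₂ q₃ x y : ℂ} (hx : x ≠ 0) (hy : y ≠ 0) (a : ℂ) (n m : ℤ) :
    a * (x ^ (n + 3) * y ^ m) - (q₁ + q₂ + q₃) * (a * (x ^ (n + 2) * y ^ (m + 1)))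
      + (q₁ * q₂ + q₁ * q₃ + q₂ * q₃) * (a * (x ^ (n + 1) * y ^ (m + 2)))
      - q₁ * q₂ * q₃ * (a * (x ^ n * y ^ (m + 3))) = a * gval q₁ q₂ q₃ x y * (x ^ n * y ^ m) := by
  have e : ∀ (x : ℂ) (_ : x ≠ 0) (n : ℤ), x ^ (n + 3) = x ^ n * x ^ 3 ∧
      x ^ (n + 2) = x ^ n * x ^ 2 ∧ x ^ (n + 1) = x ^ n * x := fun x hx n =>
    ⟨by rw [zpow_add₀ hx]; rfl, by rw [zpow_add₀ hx]; rfl, zpow_add_one₀ hx n⟩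
  obtain ⟨a1, a2, a3⟩ := e x hx n
  obtain ⟨b1, b2, b3⟩ := e y hy m
  rw [a1, a2, a3, b1, b2, b3, gval]
  ring

theorem gCoeff_apply {k r : ℕ} {c : ℕ → ℤ} (q₁ q₂ q₃ : ℂ) (P : ℤ → ℤ → Module.End ℂ (U k r c))
    (n m : ℤ) (v : U k r c) :
    gCoeff q₁ q₂ q₃ P n m v = P (n + 3) m v - (q₁ + q₂ + q₃) • P (n + 2) (m + 1) v
      + (q₁ * q₂ + q₁ * q₃ + q₂ * q₃) • P (n + 1) (m + 2) v - (q₁ * q₂ * q₃) • P n (m + 3) v := rfl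

theorem gCoeff_sum_sum {k r : ℕ} {c : ℕ → ℤ} {q₁ q₂ q₃ : ℂ}
    (P : ℤ → ℤ → Module.End ℂ (U k r c)) {v : U k r c} {M : ℕ} {a x y : ℕ → ℕ → ℂ}
    {w : ℕ → ℕ → U k r c} (hx : ∀ t s, x t s ≠ 0) (hy : ∀ t s, y t s ≠ 0)
    (h : ∀ i j, P i j v = ∑ t ∈ Finset.range M, ∑ s ∈ Finset.range M,
      (a t s * (x t s ^ i * y t s ^ j)) • w t s) (n m : ℤ) :
    gCoeff q₁ q₂ q₃ P n m v = ∑ t ∈ Finset.range M, ∑ s ∈ Finset.range M,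
      (a t s * gval q₁ q₂ q₃ (x t s) (y t s) * (x t s ^ n * y t s ^ m)) • w t s := by
  rw [gCoeff_apply, h, h (n + 2), h (n + 1), h n]
  simp only [Finset.smul_sum, ← Finset.sum_sub_distrib, ← Finset.sum_add_distrib, smul_smul,
    ← sub_smul, ← add_smul]
  refine Finset.sum_congr rfl fun t _ => Finset.sum_congr rfl fun s _ => ?_
  rw [gCoeff_monomial (hx t s) (hy t s)]

/-! ### Quadratic and cubic relations -/

/-- A current that moves the parts by `d`, whose structure coefficients are of the form `coef` for
the parameters `q₁, q₂, q₃`: the factors are totally ordered, `I N s` is the set of those that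
precede `s`, and the supports of the delta functions are separated where this is needed. It covers
both `e` and, for the inverse parameters, `f`. -/
structure IsCurrent (k r : ℕ) (c : ℕ → ℤ) (d : ℤ) (q₁ q₂ q₃ : ℂ) (b : ℕ → (ℕ → ℤ) → ℂ → ℂ)
    (I : ℕ → ℕ → Finset ℕ) (p : (ℕ → ℤ) → ℕ → ℂ) (X : ℤ → Module.End ℂ (U k r c)) : Prop where
  step : IsStep k r c d (fun N lam s => coef q₁ q₂ q₃ (b N lam) (I N s) (p lam) s) p X
  prod_eq : q₁ * q₂ * q₃ = 1
  ne_zero : ∀ lam s, p lam s ≠ 0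
  shift_eq : ∀ lam t, p (shift lam t d) = move q₁ (p lam) t
  base_eq : ∀ N lam t, t < N → b N (shift lam t d) = b N lam
  irrefl : ∀ N s, s ∉ I N s
  asymm : ∀ N s t, s ∈ I N t → t ∉ I N s
  total : ∀ N s t, s < N → t < N → s ≠ t → s ∈ I N t ∨ t ∈ I N s
  trans : ∀ N s t l, s ∈ I N t → t ∈ I N l → s ∈ I N l
  sep : ∀ N lam mu s t x y z, lam ∈ S k r c → mu ∈ S k r c → t ∈ I N s →
    (∀ l, l ≠ x → l ≠ y → l ≠ z → mu l = lam l) → 0 < d * (mu s - lam s) →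
    0 < d * (mu t - lam t) → gden q₁ (p lam s) (p lam t) ≠ 0
  sep_upper : ∀ N lam s t, lam ∈ S k r c → shift (shift (shift lam s d) s d) t d ∈ S k r c →
    t ∈ I N s → q₁ * (q₁ * p lam s) ≠ p lam t
  sep_lower : ∀ N lam s t, lam ∈ S k r c → s ∈ I N t → p lam t ≠ q₁ * (q₁ * p lam s)

namespace IsCurrent

variable {k r : ℕ} {c : ℕ → ℤ} {d : ℤ} {q₁ q₂ q₃ : ℂ} {b : ℕ → (ℕ → ℤ) → ℂ → ℂ}
  {I : ℕ → ℕ → Finset ℕ} {p : (ℕ → ℤ) → ℕ → ℂ} {X : ℤ → Module.End ℂ (U k r c)}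
  (hX : IsCurrent k r c d q₁ q₂ q₃ b I p X) {lam : ℕ → ℤ} {N : ℕ}
include hX

theorem d_sq : 0 < d * d := by
  rcases hX.step.dir with h | h <;> simp [h]

theorem q₁_ne : q₁ ≠ 0 := by
  rintro rfl
  simpa using hX.prod_eq

theorem exchange (hS : lam ∈ S k r c) {s t : ℕ} (hs : s < N) (ht : t < N) (hst : s ≠ t)
    (hmu : shift (shift lam t d) s d ∈ S k r c) :
    coef q₁ q₂ q₃ (b N lam) (I N t) (p lam) t *
        coef q₁ q₂ q₃ (b N (shift lam t d)) (I N s) (p (shift lam t d)) s *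
        gval q₁ q₂ q₃ (p (shift lam t d) s) (p lam t) =
      -(coef q₁ q₂ q₃ (b N lam) (I N s) (p lam) s *
        coef q₁ q₂ q₃ (b N (shift lam s d)) (I N t) (p (shift lam s d)) t *
        gval q₁ q₂ q₃ (p (shift lam s d) t) (p lam s)) := by
  have hsep : ∀ s t : ℕ, s ≠ t → shift (shift lam t d) s d ∈ S k r c → t ∈ I N s →
      gden q₁ (p lam s) (p lam t) ≠ 0 := by
    intro s t hst hmu h
    refine hX.sep N lam _ s t s t t hS hmu h (fun l h1 h2 _ => ?_) ?_ ?_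
    · rw [shift_ne _ h1, shift_ne _ h2]
    · rw [shift_self, shift_ne _ hst]
      simpa using hX.d_sq
    · rw [shift_ne _ hst.symm, shift_self]
      simpa using hX.d_sq
  rw [hX.base_eq _ _ _ ht, hX.base_eq _ _ _ hs, hX.shift_eq, hX.shift_eq, move_ne _ _ hst,
    move_ne _ _ hst.symm]
  rcases hX.total N t s ht hs hst.symm with h | h
  · exact coef_exchange hX.prod_eq hst h (hX.asymm _ _ _ h) (hsep s t hst hmu h)
  · rw [eq_neg_iff_add_eq_zero, add_comm, ← eq_neg_iff_add_eq_zero]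
    exact coef_exchange hX.prod_eq hst.symm h (hX.asymm _ _ _ h)
      (hsep t s hst.symm (by rwa [shift_comm]) h)

theorem quadratic (n m : ℤ) :
    gCoeff q₁ q₂ q₃ (fun i j => X i * X j) n m = -gCoeff q₁ q₂ q₃ (fun j i => X j * X i) m n := by
  refine end_ext fun lam hS => ?_
  obtain ⟨N, hN⟩ := exists_settled hS
  rw [LinearMap.neg_apply]
  rw [gCoeff_sum_sum _ (fun _ _ => hX.ne_zero _ _) (fun _ _ => hX.ne_zero _ _)
      fun i j => hX.step.act_act hX.step hS hN le_rfl i j,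
    gCoeff_sum_sum _ (fun _ _ => hX.ne_zero _ _) (fun _ _ => hX.ne_zero _ _)
      fun i j => hX.step.act_act hX.step hS hN le_rfl i j, Finset.sum_comm,
    ← Finset.sum_neg_distrib]
  refine Finset.sum_congr rfl fun s hs => ?_
  rw [← Finset.sum_neg_distrib]
  refine Finset.sum_congr rfl fun t ht => ?_
  rw [← neg_smul, shift_comm lam s t]
  by_cases hmu : shift (shift lam t d) s d ∈ S k r c
  · congr 1
    by_cases hst : s = t
    · subst hst
      have h : gval q₁ q₂ q₃ (p (shift lam s d) s) (p lam s) = 0 := by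
        rw [hX.shift_eq, move_self, gval]
        ring
      rw [h]
      ring
    · have h := hX.exchange hS (Finset.mem_range.1 hs) (Finset.mem_range.1 ht) hst hmu
      rw [h, hX.shift_eq, hX.shift_eq, move_ne _ _ hst, move_ne _ _ (Ne.symm hst)]
      ring
  · rw [vec_of_notMem hmu, smul_zero, smul_zero]

theorem serreTerm_eq {x y z : ℕ} (hx : x < N) (hy : y < N) :
    coef q₁ q₂ q₃ (b N lam) (I N x) (p lam) x *
      coef q₁ q₂ q₃ (b N (shift lam x d)) (I N y) (p (shift lam x d)) y *
      coef q₁ q₂ q₃ (b N (shift (shift lam x d) y d)) (I N z) (p (shift (shift lam x d) y d)) z *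
      serreH (p lam x) (p (shift lam x d) y) (p (shift (shift lam x d) y d) z) =
    serreTerm q₁ q₂ q₃ (b N lam) (I N) (p lam) x y z := by
  simp only [serreTerm, hX.base_eq _ _ _ hy, hX.base_eq _ _ _ hx, hX.shift_eq]

/-- The six orders in which `x`, `y`, `z` can be moved. -/
theorem serreTerm_sum (hS : lam ∈ S k r c) {x y z : ℕ} (hx : x < N) (hy : y < N) (hz : z < N)
    (hmu : shift (shift (shift lam x d) y d) z d ∈ S k r c) :
    serreTerm q₁ q₂ q₃ (b N lam) (I N) (p lam) x y z
      + serreTerm q₁ q₂ q₃ (b N lam) (I N) (p lam) x z y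
      + serreTerm q₁ q₂ q₃ (b N lam) (I N) (p lam) y x z
      + serreTerm q₁ q₂ q₃ (b N lam) (I N) (p lam) y z x
      + serreTerm q₁ q₂ q₃ (b N lam) (I N) (p lam) z x y
      + serreTerm q₁ q₂ q₃ (b N lam) (I N) (p lam) z y x = 0 := by
  have h0 := hX.ne_zero lam
  have hdd := hX.d_sq
  have hdist : ∀ x y z : ℕ, shift (shift (shift lam x d) y d) z d ∈ S k r c →
      x ≠ y → x ≠ z → y ≠ z → x ∈ I N y → y ∈ I N z →
      serreTerm q₁ q₂ q₃ (b N lam) (I N) (p lam) x y z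
      + serreTerm q₁ q₂ q₃ (b N lam) (I N) (p lam) x z y
      + serreTerm q₁ q₂ q₃ (b N lam) (I N) (p lam) y x z
      + serreTerm q₁ q₂ q₃ (b N lam) (I N) (p lam) y z x
      + serreTerm q₁ q₂ q₃ (b N lam) (I N) (p lam) z x y
      + serreTerm q₁ q₂ q₃ (b N lam) (I N) (p lam) z y x = 0 := by
    intro x y z hmu hxy hxz hyz h1 h3
    have h2 := hX.trans _ _ _ _ h1 h3
    have ho : ∀ l, l ≠ x → l ≠ y → l ≠ z → shift (shift (shift lam x d) y d) z d l = lam l :=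
      fun l a1 a2 a3 => by rw [shift_ne _ a3, shift_ne _ a2, shift_ne _ a1]
    have hx : 0 < d * (shift (shift (shift lam x d) y d) z d x - lam x) := by
      rw [shift_ne _ hxz, shift_ne _ hxy, shift_self]; simpa using hdd
    have hy : 0 < d * (shift (shift (shift lam x d) y d) z d y - lam y) := by
      rw [shift_ne _ hyz, shift_self, shift_ne _ hxy.symm]; simpa using hdd
    have hz : 0 < d * (shift (shift (shift lam x d) y d) z d z - lam z) := by
      rw [shift_self, shift_ne _ hyz.symm, shift_ne _ hxz.symm]; simpa using hdd
    exact serreTerm_distinct hX.prod_eq h0 hxy hxz hyz h1 h2 h3 (hX.asymm _ _ _ h1)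
      (hX.asymm _ _ _ h2) (hX.asymm _ _ _ h3)
      (hX.sep N lam _ y x x y z hS hmu h1 ho hy hx) (hX.sep N lam _ z x x y z hS hmu h2 ho hz hx)
      (hX.sep N lam _ z y x y z hS hmu h3 ho hz hy)
  have htwice : ∀ s t : ℕ, s < N → t < N → s ≠ t →
      shift (shift (shift lam s d) s d) t d ∈ S k r c →
      serreTerm q₁ q₂ q₃ (b N lam) (I N) (p lam) s s t
      + serreTerm q₁ q₂ q₃ (b N lam) (I N) (p lam) s t s
      + serreTerm q₁ q₂ q₃ (b N lam) (I N) (p lam) t s s = 0 := by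
    intro s t hs ht hst hmu
    have ho : ∀ l, l ≠ s → l ≠ s → l ≠ t → shift (shift (shift lam s d) s d) t d l = lam l :=
      fun l a1 a2 a3 => by rw [shift_ne _ a3, shift_ne _ a2, shift_ne _ a1]
    have h1 : 0 < d * (shift (shift (shift lam s d) s d) t d s - lam s) := by
      rw [shift_ne _ hst, shift_self, shift_self]
      linarith
    have h2 : 0 < d * (shift (shift (shift lam s d) s d) t d t - lam t) := by
      rw [shift_self, shift_ne _ hst.symm, shift_ne _ hst.symm]; simpa using hdd
    rcases hX.total N t s ht hs hst.symm with h | h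
    · exact serreTerm_upper hX.prod_eq h0 hst h (hX.asymm _ _ _ h) (hX.irrefl _ _)
        (hX.sep N lam _ s t s s t hS hmu h ho h1 h2) (hX.sep_upper N lam s t hS hmu h)
    · exact serreTerm_lower hX.prod_eq h0 hst h (hX.asymm _ _ _ h) (hX.irrefl _ _)
        (hX.sep N lam _ t s s s t hS hmu h ho h2 h1) (hX.sep_lower N lam s t hS h)
  have c12 : ∀ x y z : ℕ, shift (shift (shift lam x d) y d) z d =
      shift (shift (shift lam y d) x d) z d := fun x y z => by rw [shift_comm lam x y]
  have c23 : ∀ x y z : ℕ, shift (shift (shift lam x d) y d) z d =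
      shift (shift (shift lam x d) z d) y d := fun x y z => shift_comm _ _ _ _ _
  by_cases hxy : x = y
  · subst hxy
    by_cases hxz : x = z
    · subst hxz
      rw [serreTerm_self hX.q₁_ne (h0 _)]
      ring
    · linear_combination 2 * htwice x z hx hz hxz hmu
  by_cases hxz : x = z
  · subst hxz
    linear_combination 2 * htwice x y hx hy hxy (by rwa [c23])
  by_cases hyz : y = z
  · subst hyz
    linear_combination 2 * htwice y x hy hx (Ne.symm hxy) (by rwa [c23, c12])
  have hyx := Ne.symm hxy
  have hzx := Ne.symm hxz
  have hzy := Ne.symm hyz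
  rcases hX.total N x y hx hy hxy with a | a <;> rcases hX.total N y z hy hz hyz with e | e <;>
    rcases hX.total N x z hx hz hxz with f | f
  · exact hdist x y z hmu hxy hxz hyz a e
  · exact absurd (hX.trans _ _ _ _ a e) (hX.asymm _ _ _ f)
  · linear_combination hdist x z y (by rwa [c23]) hxz hxy hzy f e
  · linear_combination hdist z x y (by rwa [c12, c23]) hzx hzy hxy f a
  · linear_combination hdist y x z (by rwa [c12]) hyx hyz hxz a f
  · linear_combination hdist y z x (by rwa [c23, c12]) hyz hyx hzx e f
  · exact absurd (hX.trans _ _ _ _ f e) (hX.asymm _ _ _ a)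
  · linear_combination hdist z y x (by rwa [c23, c12, c23]) hzy hzx hyx e a

theorem serre : ⁅X 0, ⁅X 1, X (-1)⁆⁆ = 0 := by
  refine end_ext fun lam hS => ?_
  obtain ⟨N, hN⟩ := exists_settled hS
  set M := N + (k + 1) + (k + 1)
  have h := hX.step.act_act_act hS hN (le_refl M)
  have e : ⁅X 0, ⁅X 1, X (-1)⁆⁆ (vec k r c lam) =
      X 0 (X 1 (X (-1) (vec k r c lam))) - X 0 (X (-1) (X 1 (vec k r c lam)))
        - (X 1 (X (-1) (X 0 (vec k r c lam))) - X (-1) (X 1 (X 0 (vec k r c lam)))) := by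
    simp only [Ring.lie_def, LinearMap.sub_apply, Module.End.mul_apply, map_sub]
  rw [e, h, h, h, h]
  simp only [← Finset.sum_sub_distrib, ← sub_smul]
  set T := serreTerm q₁ q₂ q₃ (b M lam) (I M) (p lam)
  set V := fun x y z => vec k r c (shift (shift (shift lam x d) y d) z d)
  have hsum : ∀ x ∈ Finset.range M, ∀ y ∈ Finset.range M, ∀ z ∈ Finset.range M,
      T x y z • V x y z + T x z y • V x z y + T y x z • V y x z + T y z x • V y z x
        + T z x y • V z x y + T z y x • V z y x = 0 := by
    intro x hx y hy z hz
    have c12 : ∀ x y z : ℕ, V x y z = V y x z := fun x y z => by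
      simp only [V, shift_comm lam x y]
    have c23 : ∀ x y z : ℕ, V x y z = V x z y := fun x y z => by
      simp only [V, shift_comm (shift lam x d) y z]
    rw [c23 x z y, c12 y x z, c23 y z x, c12 y x z, c12 z x y, c23 x z y, c12 z y x, c23 y z x,
      c12 y x z]
    simp only [← add_smul]
    by_cases hmu : shift (shift (shift lam x d) y d) z d ∈ S k r c
    · rw [hX.serreTerm_sum hS (Finset.mem_range.1 hx) (Finset.mem_range.1 hy)
        (Finset.mem_range.1 hz) hmu, zero_smul]
    · simp only [V, vec_of_notMem hmu, smul_zero]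
  have hT : ∑ x ∈ Finset.range M, ∑ y ∈ Finset.range M, ∑ z ∈ Finset.range M,
      T x y z • V x y z = 0 := by
    -- symmetrization over the six orders
    have r1 := fun f : ℕ → ℕ → ℕ → U k r c => Finset.sum_comm (s := Finset.range M)
      (t := Finset.range M) (f := fun x y => ∑ z ∈ Finset.range M, f x y z)
    have r2 := fun f : ℕ → ℕ → ℕ → U k r c => Finset.sum_congr (rfl : Finset.range M = _)
      fun x _ => Finset.sum_comm (s := Finset.range M) (t := Finset.range M) (f := f x)
    have h1 := Finset.sum_congr rfl fun x hx => Finset.sum_congr rfl fun y hy =>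
      Finset.sum_congr rfl fun z hz => hsum x hx y hy z hz
    simp only [Finset.sum_add_distrib, Finset.sum_const_zero] at h1
    set A := ∑ x ∈ Finset.range M, ∑ y ∈ Finset.range M, ∑ z ∈ Finset.range M, T x y z • V x y z
    have e2 : ∑ x ∈ Finset.range M, ∑ y ∈ Finset.range M, ∑ z ∈ Finset.range M,
        T x z y • V x z y = A := r2 fun x y z => T x z y • V x z y
    have e3 : ∑ x ∈ Finset.range M, ∑ y ∈ Finset.range M, ∑ z ∈ Finset.range M,
        T y x z • V y x z = A := r1 fun x y z => T y x z • V y x z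
    have e4 : ∑ x ∈ Finset.range M, ∑ y ∈ Finset.range M, ∑ z ∈ Finset.range M,
        T y z x • V y z x = A := (r1 fun x y z => T y z x • V y z x).trans e2
    have e5 : ∑ x ∈ Finset.range M, ∑ y ∈ Finset.range M, ∑ z ∈ Finset.range M,
        T z x y • V z x y = A := (r2 fun x y z => T z x y • V z x y).trans e3
    have e6 : ∑ x ∈ Finset.range M, ∑ y ∈ Finset.range M, ∑ z ∈ Finset.range M,
        T z y x • V z y x = A := (r1 fun x y z => T z y x • V z y x).trans e5
    rw [e2, e3, e4, e5, e6] at h1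
    have h6 : (6 : ℂ) • A = 0 := by
      rw [← h1]
      module
    exact (smul_eq_zero.1 h6).resolve_left (by norm_num)
  rw [LinearMap.zero_apply, ← hT]
  refine Finset.sum_congr rfl fun x hx => Finset.sum_congr rfl fun y hy =>
    Finset.sum_congr rfl fun z _ => ?_
  congr 1
  simp only [T]
  rw [← hX.serreTerm_eq (Finset.mem_range.1 hx) (Finset.mem_range.1 hy), serreH]
  simp only [zpow_zero, zpow_one, zpow_neg_one]
  ring

end IsCurrent

/-! ### The currents `e`, `f` and `ψ` -/

/-- The modes of `e(z)`. -/
def eAct (k r : ℕ) (c : ℕ → ℤ) (q₁ q₂ q₃ u : ℂ) : ℤ → Module.End ℂ (U k r c) :=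
  stepAct k r c 1 (fun _ lam s => eCo q₁ q₂ q₃ u lam s) (pt q₁ q₃ u)

/-- The modes of `f(z)`. -/
def fAct (k r : ℕ) (c : ℕ → ℤ) (q₁ q₂ q₃ u : ℂ) : ℤ → Module.End ℂ (U k r c) :=
  stepAct k r c (-1) (fun N lam s => fCo q₁ q₂ q₃ u k N lam s) (ptF q₁ q₃ u)

/-- The coefficient of `z ^ (-i)` in `ψ^±(z)`. -/
def psiAct (k r : ℕ) (c : ℕ → ℤ) (q₁ q₂ q₃ u : ℂ) (ε : Sgn) (i : ℤ) : Module.End ℂ (U k r c) :=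
  Finsupp.linearCombination ℂ fun lam : S k r c =>
    zcoeff ε (psiSer q₁ q₂ q₃ u k ε (stab lam) lam.1) i • Finsupp.single lam 1

theorem gden_inv_ne_zero {q x y : ℂ} (hq : q ≠ 0) (h1 : y ≠ x) (h2 : q * y ≠ x) (h3 : y ≠ q * x) :
    gden q⁻¹ (q⁻¹ * x) (q⁻¹ * y) ≠ 0 := by
  have hq' := inv_ne_zero hq
  refine mul_ne_zero (mul_ne_zero ?_ ?_) ?_ <;> rw [← mul_sub] <;>
    refine mul_ne_zero hq' (sub_ne_zero.2 fun h => ?_)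
  · exact h1 h.symm
  · exact h3 (by rw [h, mul_inv_cancel_left₀ hq])
  · exact h2 (by rw [← h, mul_inv_cancel_left₀ hq])

theorem gden_ne_zero {q x y : ℂ} (h1 : y ≠ x) (h2 : q * y ≠ x) (h3 : y ≠ q * x) :
    gden q y x ≠ 0 :=
  mul_ne_zero (mul_ne_zero (sub_ne_zero.2 h1) (sub_ne_zero.2 h3)) (sub_ne_zero.2 h2)

namespace Resonant

variable {k r : ℕ} {q₁ q₂ q₃ u : ℂ} {c : ℕ → ℤ} (H : Resonant k r q₁ q₂ q₃ u) {lam mu : ℕ → ℤ}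
include H

theorem ptF_ne_zero (lam : ℕ → ℤ) (s : ℕ) : ptF q₁ q₃ u lam s ≠ 0 :=
  mul_ne_zero (inv_ne_zero H.q₁_ne) (H.pt_ne_zero lam s)

/-- Moving at most three parts, `s < t` among them, in one direction: a resonance between `s` and
`t` would force the four parts `s`, `s + 1`, `s + k`, `t` to move. -/
theorem separated (hS : lam ∈ S k r c) (hS' : mu ∈ S k r c) {s t x y z : ℕ} (hst : s < t) {d : ℤ}
    (hd : d = 1 ∨ d = -1) (h : ∀ l, l ≠ x → l ≠ y → l ≠ z → mu l = lam l)
    (hs : 0 < d * (mu s - lam s)) (ht : 0 < d * (mu t - lam t)) :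
    pt q₁ q₃ u lam t ≠ pt q₁ q₃ u lam s ∧ q₁ * pt q₁ q₃ u lam t ≠ pt q₁ q₃ u lam s ∧
      pt q₁ q₃ u lam t ≠ q₁ * pt q₁ q₃ u lam s := by
  have hk := H.one_le
  refine H.separated_of_same_direction hS hS' hst fun _ h1 h2 h3 h4 h5 h6 => ?_
  subst h1
  have e1 := h s
  have e2 := h (s + 1)
  have e3 := h (s + k)
  have e4 := h (s + k + 1)
  rcases hd with rfl | rfl <;> omega

theorem isCurrent_e :
    IsCurrent k r c 1 q₁ q₂ q₃ (fun _ _ _ => (1 - q₁)⁻¹) (fun _ s => Finset.range s) (pt q₁ q₃ u)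
      (eAct k r c q₁ q₂ q₃ u) where
  step := isStep_stepAct H.one_le (Or.inl rfl) (fun _ _ _ hS _ _ h => H.eCo_eq_zero hS h)
    fun _ _ _ _ _ _ _ _ => rfl
  prod_eq := H.prod_eq
  ne_zero := H.pt_ne_zero
  shift_eq := pt_shift q₃ u H.q₁_ne
  base_eq _ _ _ _ := rfl
  irrefl := by simp
  asymm := by simp only [Finset.mem_range]; omega
  total := by simp only [Finset.mem_range]; omega
  trans := by simp only [Finset.mem_range]; omega
  sep N lam mu s t x y z hS hS' hst h hs ht := by
    obtain ⟨h1, h2, h3⟩ :=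
      H.separated hS hS' (Finset.mem_range.1 hst) (Or.inl rfl) h ht hs
    exact gden_ne_zero h1 h2 h3
  sep_upper N lam s t hS hS' hst := by
    have hts := Finset.mem_range.1 hst
    have e1 : shift (shift (shift lam s 1) s 1) t 1 t = lam t + 1 := by
      rw [shift_self, shift_ne _ hts.ne, shift_ne _ hts.ne]
    have e2 : shift (shift (shift lam s 1) s 1) t 1 s = lam s + 1 + 1 := by
      rw [shift_ne _ hts.ne', shift_self, shift_self]
    refine H.pt_ne_of_two hS hS' hts (by omega) (Or.inl ⟨fun h => ?_, Or.inl (by omega)⟩)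
    rw [shift_ne _ (by omega), shift_ne _ h, shift_ne _ h]
  sep_lower N lam s t hS hst h := by
    refine H.pt_ne_of_nonpos hS (Finset.mem_range.1 hst) (e := -2) (by norm_num) ?_
    have := H.q₁_ne
    rw [h, show (-2 : ℤ) = -1 + -1 by norm_num, zpow_add₀ H.q₁_ne, zpow_neg_one]
    field_simp

theorem isCurrent_f :
    IsCurrent k r c (-1) q₁⁻¹ q₂⁻¹ q₃⁻¹
      (fun N lam z => -(1 - q₁⁻¹)⁻¹ * tailProd q₁ q₃ u k N lam z 1) (fun N s => Finset.Ioo s N)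
      (ptF q₁ q₃ u) (fAct k r c q₁ q₂ q₃ u) where
  step := isStep_stepAct H.one_le (Or.inr rfl) (fun _ _ _ hS hN hs h => H.fCo_eq_zero hS hN hs h)
    fun _ _ _ _ hS hN hNM h => H.fCo_stable hS hN hNM h
  prod_eq := H.inv_prod_eq
  ne_zero := H.ptF_ne_zero
  shift_eq := ptF_shift q₃ u H.q₁_ne
  base_eq N lam t ht := by
    ext z
    rw [tailProd_shift ht]
  irrefl := by simp
  asymm := by simp only [Finset.mem_Ioo]; omega
  total := by simp only [Finset.mem_Ioo]; omega
  trans := by simp only [Finset.mem_Ioo]; omega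
  sep N lam mu s t x y z hS hS' hst h hs ht := by
    obtain ⟨h1, h2, h3⟩ :=
      H.separated hS hS' (Finset.mem_Ioo.1 hst).1 (Or.inr rfl) h hs ht
    exact gden_inv_ne_zero H.q₁_ne h1 h2 h3
  sep_upper N lam s t hS hS' hst := by
    have hts := (Finset.mem_Ioo.1 hst).1
    have h1 := H.q₁_ne
    have e1 : shift (shift (shift lam s (-1)) s (-1)) t (-1) t = lam t + -1 := by
      rw [shift_self, shift_ne _ hts.ne', shift_ne _ hts.ne']
    have e2 : shift (shift (shift lam s (-1)) s (-1)) t (-1) s = lam s + -1 + -1 := by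
      rw [shift_ne _ hts.ne, shift_self, shift_self]
    have key := H.pt_ne_of_two hS hS' hts (by omega)
      (Or.inl ⟨fun h => by rw [shift_ne _ h, shift_ne _ (by omega), shift_ne _ (by omega)],
        Or.inr (by omega)⟩)
    intro h
    apply key
    simp only [ptF] at h
    field_simp at h
    linear_combination -h
  sep_lower N lam s t hS hst h := by
    refine H.pt_ne_of_nonpos hS (Finset.mem_Ioo.1 hst).1 (e := -2) (by norm_num) ?_
    have h1 := H.q₁_ne
    simp only [ptF] at h
    rw [show (-2 : ℤ) = -1 + -1 by norm_num, zpow_add₀ H.q₁_ne, zpow_neg_one]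
    field_simp at h ⊢
    linear_combination -h

theorem psiAct_vec (ε : Sgn) (i : ℤ) (hS : lam ∈ S k r c) {N : ℕ} (hN : Settled k r c N lam) :
    psiAct k r c q₁ q₂ q₃ u ε i (vec k r c lam) =
      zcoeff ε (psiSer q₁ q₂ q₃ u k ε N lam) i • vec k r c lam := by
  rw [vec_of_mem hS, psiAct, Finsupp.linearCombination_single, one_smul]
  have h1 := H.psiSer_eq ε hN (le_max_left N (stab ⟨lam, hS⟩))
  have h2 := H.psiSer_eq ε (settled_stab ⟨lam, hS⟩) (le_max_right N (stab ⟨lam, hS⟩))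
  rw [← h1, h2]

theorem psiAct_comm (ε ε' : Sgn) (i j : ℤ) :
    psiAct k r c q₁ q₂ q₃ u ε i * psiAct k r c q₁ q₂ q₃ u ε' j =
      psiAct k r c q₁ q₂ q₃ u ε' j * psiAct k r c q₁ q₂ q₃ u ε i := by
  refine end_ext fun lam hS => ?_
  obtain ⟨N, hN⟩ := exists_settled hS
  simp only [Module.End.mul_apply, H.psiAct_vec _ _ hS hN, map_smul]
  exact smul_comm _ _ _

/-- `g(z, p) γ_{q₁ p}(z) = - g(p, z) γ_p(z)`, up to the common constant. -/
theorem lin_mul_gam (ε : Sgn) {p : ℂ} (hp : p ≠ 0) :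
    lin ε (q₁ * p) * (lin ε (q₂ * p) * (lin ε (q₃ * p) * expand ε (gam q₁ q₂ q₃ (q₁ * p)))) =
      lin ε (q₁⁻¹ * p) * (lin ε (q₂⁻¹ * p) * (lin ε (q₃⁻¹ * p) * expand ε (gam q₁ q₂ q₃ p))) := by
  have h1 := H.q₁_ne
  have h2 := H.q₂_ne
  have h3 := H.q₃_ne
  have e2 : q₂⁻¹ * p = q₃ * (q₁ * p) := by
    field_simp
    linear_combination -H.prod_eq
  have e3 : q₃⁻¹ * p = q₂ * (q₁ * p) := by
    field_simp
    linear_combination -H.prod_eq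
  rw [expand_gam, expand_gam, inv_mul_cancel_left₀ h1, e2, e3]
  have i1 := lin_mul_inv ε (mul_ne_zero h1 hp)
  have i2 := lin_mul_inv ε (mul_ne_zero (inv_ne_zero h1) hp)
  linear_combination (lin ε (q₂ * p) * lin ε (q₃ * p) * lin ε (q₃ * (q₁ * p)) *
    lin ε (q₂ * (q₁ * p)) * (lin ε p)⁻¹) * (i1 - i2)

theorem psiSer_eq_mul (ε : Sgn) {N s : ℕ} (hs : s < N) (d : ℤ) (lam : ℕ → ℤ) :
    psiSer q₁ q₂ q₃ u k ε N (shift lam s d) =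
      (expand ε (tailProd q₁ q₃ u k N lam) *
        ∏ l ∈ (Finset.range N).erase s, expand ε (gam q₁ q₂ q₃ (pt q₁ q₃ u lam l))) *
      expand ε (gam q₁ q₂ q₃ (q₁ ^ d * pt q₁ q₃ u lam s)) := by
  have h1 : expand ε (tailProd q₁ q₃ u k N (shift lam s d)) =
      expand ε (tailProd q₁ q₃ u k N lam) := by
    cases ε <;> exact tailProd_shift hs d _ _
  have h2 : ∏ l ∈ (Finset.range N).erase s,
      expand ε (gam q₁ q₂ q₃ (pt q₁ q₃ u (shift lam s d) l)) =
      ∏ l ∈ (Finset.range N).erase s, expand ε (gam q₁ q₂ q₃ (pt q₁ q₃ u lam l)) := by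
    refine Finset.prod_congr rfl fun l hl => ?_
    have h : pt q₁ q₃ u (shift lam s d) l = pt q₁ q₃ u lam l := by
      rw [pt, pt, shift_ne _ (Finset.ne_of_mem_erase hl)]
    rw [h]
  rw [psiSer, ← Finset.prod_erase_mul _ _ (Finset.mem_range.2 hs), H.pt_shift_self, h1, h2,
    mul_assoc]

/-- The exchange relation between `ψ^±(z)` and a current that moves the support `p` of the factor
`s` to `q₁ p`. -/
theorem lin_mul_psiSer (ε : Sgn) {N s : ℕ} (hs : s < N) (lam : ℕ → ℤ) :
    lin ε (q₁ * pt q₁ q₃ u lam s) * (lin ε (q₂ * pt q₁ q₃ u lam s) *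
        (lin ε (q₃ * pt q₁ q₃ u lam s) * psiSer q₁ q₂ q₃ u k ε N (shift lam s 1))) =
      lin ε (q₁⁻¹ * pt q₁ q₃ u lam s) * (lin ε (q₂⁻¹ * pt q₁ q₃ u lam s) *
        (lin ε (q₃⁻¹ * pt q₁ q₃ u lam s) * psiSer q₁ q₂ q₃ u k ε N lam)) := by
  have h0 : shift lam s 0 = lam := by simp [shift]
  have h := H.psiSer_eq_mul (k := k) ε hs 0 lam
  rw [h0, zpow_zero, one_mul] at h
  rw [h, H.psiSer_eq_mul (k := k) ε hs 1 lam, zpow_one]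
  have := H.lin_mul_gam ε (H.pt_ne_zero lam s)
  generalize expand ε (tailProd q₁ q₃ u k N lam) *
    ∏ l ∈ (Finset.range N).erase s, expand ε (gam q₁ q₂ q₃ (pt q₁ q₃ u lam l)) = R
  generalize expand ε (gam q₁ q₂ q₃ (q₁ * pt q₁ q₃ u lam s)) = A at *
  generalize expand ε (gam q₁ q₂ q₃ (pt q₁ q₃ u lam s)) = B at *
  linear_combination R * this

end Resonant

theorem zcoeff_lin_mul_three (ε : Sgn) (a b e : ℂ) (h : PowerSeries ℂ) (i : ℤ) :
    zcoeff ε (lin ε a * (lin ε b * (lin ε e * h))) (i + linShift ε + linShift ε + linShift ε) =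
      zcoeff ε h (i + 3) - (a + b + e) * zcoeff ε h (i + 2)
        + (a * b + a * e + b * e) * zcoeff ε h (i + 1) - a * b * e * zcoeff ε h i := by
  have e1 := zcoeff_lin_mul ε e h
  have e2 : ∀ j, zcoeff ε (lin ε b * (lin ε e * h)) (j + linShift ε + linShift ε) =
      zcoeff ε h (j + 2) - (b + e) * zcoeff ε h (j + 1) + b * e * zcoeff ε h j := by
    intro j
    rw [zcoeff_lin_mul, show j + linShift ε + 1 = j + 1 + linShift ε by ring, e1, e1,
      show j + 1 + 1 = j + 2 by ring]
    ring
  rw [zcoeff_lin_mul,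
    show i + linShift ε + linShift ε + 1 = i + 1 + linShift ε + linShift ε by ring,
    e2, e2, show i + 1 + 2 = i + 3 by ring, show i + 1 + 1 = i + 2 by ring]
  ring

theorem IsStep.psi_mul {k r : ℕ} {q₁ q₂ q₃ u : ℂ} {c : ℕ → ℤ} (H : Resonant k r q₁ q₂ q₃ u) {d : ℤ}
    {co : ℕ → (ℕ → ℤ) → ℕ → ℂ} {p : (ℕ → ℤ) → ℕ → ℂ} {X : ℤ → Module.End ℂ (U k r c)}
    (hX : IsStep k r c d co p X) {lam : ℕ → ℤ} (hS : lam ∈ S k r c) {N : ℕ}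
    (hN : Settled k r c N lam) (ε : Sgn) (i j : ℤ) :
    psiAct k r c q₁ q₂ q₃ u ε i (X j (vec k r c lam)) = ∑ s ∈ Finset.range (N + k + 1),
      (co (N + k + 1) lam s * p lam s ^ j *
        zcoeff ε (psiSer q₁ q₂ q₃ u k ε (N + k + 1) (shift lam s d)) i) •
          vec k r c (shift lam s d) := by
  rw [hX.act _ lam j hS (hN.mono (by omega : N ≤ N + k + 1)), map_sum]
  refine Finset.sum_congr rfl fun s _ => ?_
  rw [map_smul]
  by_cases h : shift lam s d ∈ S k r c
  · rw [H.psiAct_vec ε i h (hN.shift hX.one_le hS hX.dir h le_rfl).2, smul_smul]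
  · simp [vec_of_notMem h]

theorem IsStep.mul_psi {k r : ℕ} {q₁ q₂ q₃ u : ℂ} {c : ℕ → ℤ} (H : Resonant k r q₁ q₂ q₃ u) {d : ℤ}
    {co : ℕ → (ℕ → ℤ) → ℕ → ℂ} {p : (ℕ → ℤ) → ℕ → ℂ} {X : ℤ → Module.End ℂ (U k r c)}
    (hX : IsStep k r c d co p X) {lam : ℕ → ℤ} (hS : lam ∈ S k r c) {N : ℕ}
    (hN : Settled k r c N lam) (ε : Sgn) (i j : ℤ) :
    X j (psiAct k r c q₁ q₂ q₃ u ε i (vec k r c lam)) = ∑ s ∈ Finset.range N,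
      (co N lam s * p lam s ^ j * zcoeff ε (psiSer q₁ q₂ q₃ u k ε N lam) i) •
          vec k r c (shift lam s d) := by
  rw [H.psiAct_vec ε i hS hN, map_smul, hX.act _ lam j hS hN, Finset.smul_sum]
  refine Finset.sum_congr rfl fun s _ => ?_
  rw [smul_smul, mul_comm]

theorem gCoeff_psi {k r : ℕ} {c : ℕ → ℤ} {q₁ q₂ q₃ : ℂ} {ι : Type*} (D : Finset ι)
    (P : ℤ → ℤ → Module.End ℂ (U k r c)) {v : U k r c} {a y : ι → ℂ} {h : ι → PowerSeries ℂ}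
    {w : ι → U k r c} {ε : Sgn} (hy : ∀ s, y s ≠ 0)
    (hP : ∀ i j, P i j v = ∑ s ∈ D, (a s * y s ^ j * zcoeff ε (h s) i) • w s) (n m : ℤ) :
    gCoeff q₁ q₂ q₃ P n m v = ∑ s ∈ D, (a s * y s ^ m *
      zcoeff ε (lin ε (q₁ * y s) * (lin ε (q₂ * y s) * (lin ε (q₃ * y s) * h s)))
        (n + linShift ε + linShift ε + linShift ε)) • w s := by
  rw [gCoeff_apply, hP, hP (n + 2), hP (n + 1), hP n]
  simp only [Finset.smul_sum, ← Finset.sum_sub_distrib, ← Finset.sum_add_distrib, smul_smul,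
    ← sub_smul, ← add_smul]
  refine Finset.sum_congr rfl fun s _ => ?_
  congr 1
  rw [zcoeff_lin_mul_three, zpow_add₀ (hy s), zpow_add₀ (hy s), zpow_add₀ (hy s)]
  norm_cast
  ring

/-- Exchanging the variables of `g` amounts to inverting the parameters. -/
theorem gCoeff_swap {A : Type} [Ring A] [Algebra ℂ A] {q₁ q₂ q₃ : ℂ} (hq : q₁ * q₂ * q₃ = 1)
    (P : ℤ → ℤ → A) (n m : ℤ) :
    gCoeff q₁ q₂ q₃ (fun j i => P i j) m n = -gCoeff q₁⁻¹ q₂⁻¹ q₃⁻¹ P n m := by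
  have h1 : q₁ ≠ 0 := by rintro rfl; simp at hq
  have h2 : q₂ ≠ 0 := by rintro rfl; simp at hq
  have h3 : q₃ ≠ 0 := by rintro rfl; simp at hq
  have e1 : q₁⁻¹ + q₂⁻¹ + q₃⁻¹ = q₁ * q₂ + q₁ * q₃ + q₂ * q₃ := by
    field_simp
    linear_combination (-(q₁ * q₂ + q₁ * q₃ + q₂ * q₃)) * hq
  have e2 : q₁⁻¹ * q₂⁻¹ + q₁⁻¹ * q₃⁻¹ + q₂⁻¹ * q₃⁻¹ = q₁ + q₂ + q₃ := by
    field_simp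
    linear_combination (-(q₁ + q₂ + q₃)) * hq
  have e3 : q₁⁻¹ * q₂⁻¹ * q₃⁻¹ = 1 := by rw [← mul_inv, ← mul_inv, hq, inv_one]
  simp only [gCoeff, e1, e2, e3, hq, one_smul]
  abel

theorem gCoeff_swap_apply {k r : ℕ} {c : ℕ → ℤ} {q₁ q₂ q₃ : ℂ} (hq : q₁ * q₂ * q₃ = 1)
    (P : ℤ → ℤ → Module.End ℂ (U k r c)) (n m : ℤ) (v : U k r c) :
    gCoeff q₁ q₂ q₃ (fun j i => P i j) m n v = -(gCoeff q₁⁻¹ q₂⁻¹ q₃⁻¹ P n m v) := by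
  rw [gCoeff_swap hq]
  rfl

namespace Resonant

variable {k r : ℕ} {q₁ q₂ q₃ u : ℂ} (c : ℕ → ℤ) (H : Resonant k r q₁ q₂ q₃ u)
include H

theorem psi_e (ε : Sgn) (n m : ℤ) :
    gCoeff q₁ q₂ q₃ (fun i j => psiAct k r c q₁ q₂ q₃ u ε i * eAct k r c q₁ q₂ q₃ u j) n m =
      -gCoeff q₁ q₂ q₃ (fun j i => eAct k r c q₁ q₂ q₃ u j * psiAct k r c q₁ q₂ q₃ u ε i) m n := by
  refine end_ext fun lam hS => ?_
  rw [LinearMap.neg_apply, gCoeff_swap_apply H.prod_eq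
    fun i j => eAct k r c q₁ q₂ q₃ u j * psiAct k r c q₁ q₂ q₃ u ε i, neg_neg]
  obtain ⟨N, hN⟩ := exists_settled hS
  have hE := (H.isCurrent_e (c := c)).step
  rw [gCoeff_psi _ _ (H.pt_ne_zero lam) fun i j => hE.psi_mul H hS hN ε i j,
    gCoeff_psi _ _ (H.pt_ne_zero lam)
      fun i j => hE.mul_psi H hS (hN.mono (by omega : N ≤ N + k + 1)) ε i j]
  refine Finset.sum_congr rfl fun s hs => ?_
  rw [H.lin_mul_psiSer ε (Finset.mem_range.1 hs)]

theorem psi_f (ε : Sgn) (n m : ℤ) :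
    gCoeff q₁ q₂ q₃ (fun j i => psiAct k r c q₁ q₂ q₃ u ε i * fAct k r c q₁ q₂ q₃ u j) m n =
      -gCoeff q₁ q₂ q₃ (fun i j => fAct k r c q₁ q₂ q₃ u j * psiAct k r c q₁ q₂ q₃ u ε i) n m := by
  refine end_ext fun lam hS => ?_
  rw [LinearMap.neg_apply, gCoeff_swap_apply H.prod_eq
    fun i j => psiAct k r c q₁ q₂ q₃ u ε i * fAct k r c q₁ q₂ q₃ u j, neg_inj]
  obtain ⟨N, hN⟩ := exists_settled hS
  have hF := (H.isCurrent_f (c := c)).step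
  rw [gCoeff_psi _ _ (H.ptF_ne_zero lam) fun i j => hF.psi_mul H hS hN ε i j,
    gCoeff_psi _ _ (H.ptF_ne_zero lam)
      fun i j => hF.mul_psi H hS (hN.mono (by omega : N ≤ N + k + 1)) ε i j]
  refine Finset.sum_congr rfl fun s hs => ?_
  have h := H.lin_mul_psiSer (k := k) ε (Finset.mem_range.1 hs) (shift lam s (-1))
  have h1 : shift (shift lam s (-1)) s 1 = lam := by
    ext l
    simp only [shift_apply]
    split_ifs <;> ring
  rw [h1, H.pt_shift_self, zpow_neg_one] at h
  simp only [ptF, h]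

end Resonant

/-! ### The commutator of `e` and `f` -/

/-- The ratio `γ_{q₁ w}(x) / γ_w(x)` is inverted when `x` and `w` are exchanged. -/
theorem gam_mul_gam {q₁ q₂ q₃ x w : ℂ} (hq : q₁ * q₂ * q₃ = 1) (h1 : x ≠ w) (h2 : x ≠ q₁ * w)
    (h3 : q₁ * x ≠ w) :
    gam q₁ q₂ q₃ w x 1 * gam q₁ q₂ q₃ x w 1 =
      gam q₁ q₂ q₃ (q₁ * x) w 1 * gam q₁ q₂ q₃ (q₁ * w) x 1 := by
  have d1 : gden q₁ x w ≠ 0 :=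
    mul_ne_zero (mul_ne_zero (sub_ne_zero.2 h1) (sub_ne_zero.2 h2)) (sub_ne_zero.2 h3)
  have d2 : gden q₁ w x ≠ 0 := mul_ne_zero (mul_ne_zero (sub_ne_zero.2 h1.symm)
    (sub_ne_zero.2 h3.symm)) (sub_ne_zero.2 h2.symm)
  rw [gam_eq_div hq d1, gam_eq_div hq d2, gam_mul_eq_div hq d1, gam_mul_eq_div hq d2]
  ring

/-- A finite family has the same values under products when it is reindexed by a set of the same
cardinality. -/
theorem exists_reindex {ι : Type*} (a : ι → ℂ) {A D : Finset ι} (h : D.card = A.card) :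
    ∃ a' : ι → ℂ, ∀ {R : Type} [CommMonoid R] (F : ℂ → R),
      ∏ i ∈ D, F (a' i) = ∏ i ∈ A, F (a i) := by
  classical
  let e := Finset.equivOfCardEq h
  refine ⟨fun i => if hi : i ∈ D then a (e ⟨i, hi⟩) else 0, fun {R} _ F => ?_⟩
  rw [← Finset.prod_coe_sort D, ← Finset.prod_coe_sort A]
  refine Fintype.prod_equiv e _ _ fun i => ?_
  simp

/-- Partial fractions when the poles outside `D` are cancelled by the zeros: the difference of the
expansions at `z = ∞` and `z = 0` is a sum over the simple poles in `D`. -/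
theorem zcoeff_sub_zcoeff_of_cancel {ι : Type*} [DecidableEq ι] (a b : ι → ℂ) {I D : Finset ι}
    (hD : D ⊆ I) (f : ι → ι) (hfI : ∀ i ∈ I \ D, f i ∈ I) (hf : ∀ i ∈ I \ D, a (f i) = b i)
    (hinj : Set.InjOn f (I \ D : Finset ι)) (hb0 : ∀ i, b i ≠ 0)
    (hsep : ∀ i ∈ D, ∀ j ∈ I, j ≠ i → b i ≠ b j) (n : ℤ) :
    zcoeff Sgn.plus (∏ i ∈ I, lin Sgn.plus (a i) * (lin Sgn.plus (b i))⁻¹) n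
      - zcoeff Sgn.minus (∏ i ∈ I, lin Sgn.minus (a i) * (lin Sgn.minus (b i))⁻¹) n =
    ∑ i ∈ D, (∏ j ∈ I, (b i - a j)) * (∏ j ∈ I.erase i, (b i - b j)⁻¹) * b i ^ (n - 1) := by
  set A := I \ (I \ D).image f
  have himg : (I \ D).image f ⊆ I := Finset.image_subset_iff.2 hfI
  have hcard : D.card = A.card := by
    rw [Finset.card_sdiff_of_subset himg, Finset.card_image_of_injOn hinj,
      Finset.card_sdiff_of_subset hD]
    have := Finset.card_le_card hD
    omega
  obtain ⟨a', ha'⟩ := exists_reindex a hcard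
  -- the cancelled factors
  have hcancel : ∀ {R : Type} [CommMonoid R] (F : ℂ → R),
      ∏ i ∈ I, F (a i) = (∏ i ∈ I \ D, F (b i)) * ∏ i ∈ D, F (a' i) := by
    intro R _ F
    rw [ha', ← Finset.prod_sdiff himg, mul_comm, Finset.prod_image hinj]
    congr 1
    exact Finset.prod_congr rfl fun i hi => by rw [hf i hi]
  have hexp : ∀ ε : Sgn, ∏ i ∈ I, lin ε (a i) * (lin ε (b i))⁻¹ =
      ∏ i ∈ D, lin ε (a' i) * (lin ε (b i))⁻¹ := by
    intro ε
    rw [Finset.prod_mul_distrib, hcancel (lin ε), ← Finset.prod_sdiff hD,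
      Finset.prod_mul_distrib (s := D)]
    have : (∏ i ∈ I \ D, lin ε (b i)) * ∏ i ∈ I \ D, (lin ε (b i))⁻¹ = 1 := by
      rw [← Finset.prod_mul_distrib]
      exact Finset.prod_eq_one fun i _ => lin_mul_inv ε (hb0 i)
    linear_combination ((∏ i ∈ D, lin ε (a' i)) * ∏ i ∈ D, (lin ε (b i))⁻¹) * this
  have hbD : Set.InjOn b D := by
    intro i hi j hj hij
    by_contra h
    exact hsep i hi j (hD hj) (fun e => h e.symm) hij
  have hpf : ∀ ε : Sgn, ∏ i ∈ D, lin ε (a' i) * (lin ε (b i))⁻¹ = 1 + ∑ i ∈ D,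
      ((b i - a' i) * ∏ j ∈ D.erase i, (b i - a' j) * (b i - b j)⁻¹) •
        (expand ε (fun _ y => y) * (lin ε (b i))⁻¹) := by
    intro ε
    cases ε
    · exact prod_eq_one_add_sum a' b D hbD 1 PowerSeries.X (fun i => (lin Sgn.plus (b i))⁻¹)
        fun i _ => lin_mul_inv Sgn.plus (hb0 i)
    · exact prod_eq_one_add_sum a' b D hbD PowerSeries.X 1 (fun i => (lin Sgn.minus (b i))⁻¹)
        fun i _ => lin_mul_inv Sgn.minus (hb0 i)
  have hone : zcoeff Sgn.plus 1 n = zcoeff Sgn.minus 1 n := by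
    simp only [zcoeff, PowerSeries.coeff_one]
    split_ifs <;> first | rfl | omega
  rw [hexp, hexp, hpf, hpf, zcoeff_add, zcoeff_add, zcoeff_sum, zcoeff_sum, hone,
    add_sub_add_left_eq_sub, ← Finset.sum_sub_distrib]
  refine Finset.sum_congr rfl fun i hi => ?_
  rw [zcoeff_smul, zcoeff_smul, ← mul_sub, zcoeff_sub_zcoeff_inv (hb0 i)]
  congr 1
  have hi' : ∀ j ∈ I \ D, b i - b j ≠ 0 := by
    intro j hj
    rw [Finset.mem_sdiff] at hj
    exact sub_ne_zero.2 (hsep i hi j hj.1 fun h => hj.2 (h ▸ hi))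
  have hsplit : ∏ j ∈ I.erase i, (b i - b j)⁻¹ =
      (∏ j ∈ I \ D, (b i - b j)⁻¹) * ∏ j ∈ D.erase i, (b i - b j)⁻¹ := by
    rw [← Finset.prod_sdiff (Finset.erase_subset_erase i hD)]
    congr 2
    ext j
    simp only [Finset.mem_sdiff, Finset.mem_erase]
    constructor
    · rintro ⟨⟨h1, h2⟩, h3⟩
      exact ⟨h2, fun h => h3 ⟨h1, h⟩⟩
    · rintro ⟨h1, h2⟩
      exact ⟨⟨fun h => h2 (h ▸ hi), h1⟩, fun h => h2 h.2⟩
  rw [hcancel fun z => b i - z, hsplit, Finset.prod_mul_distrib,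
    ← Finset.mul_prod_erase D (fun j => b i - a' j) hi]
  have h1 : (∏ j ∈ I \ D, (b i - b j)) * ∏ j ∈ I \ D, (b i - b j)⁻¹ = 1 := by
    rw [← Finset.prod_mul_distrib]
    exact Finset.prod_eq_one fun j hj => mul_inv_cancel₀ (hi' j hj)
  linear_combination (-((b i - a' i) * (∏ j ∈ D.erase i, (b i - a' j)) *
    ∏ j ∈ D.erase i, (b i - b j)⁻¹)) * h1

theorem ptF_raise {q₁ : ℂ} (q₃ u : ℂ) (hq : q₁ ≠ 0) (lam : ℕ → ℤ) (s : ℕ) :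
    ptF q₁ q₃ u (shift lam s 1) = move q₁ (ptF q₁ q₃ u lam) s := by
  ext l
  unfold ptF
  rw [pt_shift q₃ u hq]
  by_cases h : l = s
  · subst h
    rw [move_self, move_self]
    ring
  · rw [move_ne _ _ h, move_ne _ _ h]

theorem shift_shift_neg (lam : ℕ → ℤ) (s : ℕ) (d : ℤ) : shift (shift lam s d) s (-d) = lam := by
  ext l
  simp only [shift_apply]
  split_ifs <;> ring

namespace Resonant

variable {k r : ℕ} {q₁ q₂ q₃ u : ℂ} {c : ℕ → ℤ} (H : Resonant k r q₁ q₂ q₃ u) {lam : ℕ → ℤ}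
include H

/-- Moving one part up and another one down commute. -/
theorem fCo_mul_eCo (hS : lam ∈ S k r c) {N s t : ℕ} (hs : s < N) (hst : s ≠ t)
    (hmu : shift (shift lam t (-1)) s 1 ∈ S k r c) :
    fCo q₁ q₂ q₃ u k N lam t * eCo q₁ q₂ q₃ u (shift lam t (-1)) s =
      eCo q₁ q₂ q₃ u lam s * fCo q₁ q₂ q₃ u k N (shift lam s 1) t := by
  have h1 := H.q₁_ne
  unfold fCo eCo
  rw [pt_lower q₃ u h1, ptF_raise q₃ u h1]
  simp only [tailProd_shift hs]
  rcases lt_or_gt_of_ne hst with h | h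
  · rw [coef_move hst (by simp; omega), coef_move hst.symm (by simp; omega), mul_comm]
  · have m1 : t ∈ Finset.range s := Finset.mem_range.2 h
    have m2 : s ∈ Finset.Ioo t N := Finset.mem_Ioo.2 ⟨h, hs⟩
    rw [coef_move_eq_mul hst m1, coef_eq_mul (p := pt q₁ q₃ u lam) m1,
      coef_move_eq_mul hst.symm m2, coef_eq_mul (p := ptF q₁ q₃ u lam) m2]
    have e1 : q₁ * ptF q₁ q₃ u lam s = q₁⁻¹ * (q₁ * pt q₁ q₃ u lam s) := by
      rw [ptF]
      ring
    have e2 : gam q₁⁻¹ q₂⁻¹ q₃⁻¹ (ptF q₁ q₃ u lam s) (ptF q₁ q₃ u lam t) 1 =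
        gam q₁ q₂ q₃ (pt q₁ q₃ u lam s) (ptF q₁ q₃ u lam t) 1 := gam_inv H.prod_eq _ _
    have e3 : pt q₁ q₃ u lam t = q₁ * ptF q₁ q₃ u lam t := by
      rw [ptF, mul_inv_cancel_left₀ h1]
    rw [e1, gam_inv H.prod_eq, e2, ← ptF]
    -- the supports of the two factors are separated, because both sequences are admissible
    have v1 : shift (shift lam t (-1)) s 1 t = lam t + -1 := by
      rw [shift_ne _ hst.symm, shift_self]
    have v2 : shift (shift lam t (-1)) s 1 s = lam s + 1 := by
      rw [shift_self, shift_ne _ hst]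
    have hk := H.one_le
    have hr := H.two_le
    have n1 : pt q₁ q₃ u lam s ≠ ptF q₁ q₃ u lam t := by
      intro e
      have := H.shape_of_pt_eq hS hmu h (by rw [e, ← e3])
      omega
    have n2 : pt q₁ q₃ u lam s ≠ q₁ * ptF q₁ q₃ u lam t := by
      rw [← e3]
      simpa using H.pt_ne_of_nonpos hS h (e := 0) le_rfl
    have n3 : q₁ * pt q₁ q₃ u lam s ≠ ptF q₁ q₃ u lam t := by
      intro e
      exact H.pt_ne_of_two hS hmu h (by omega) (Or.inr (by omega)) (by rw [e, ← e3])
    have key := gam_mul_gam H.prod_eq n1 n2 n3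
    rw [← e3] at key
    linear_combination (coef q₁ q₂ q₃ (fun _ => (1 - q₁)⁻¹) ((Finset.range s).erase t)
      (pt q₁ q₃ u lam) s * coef q₁⁻¹ q₂⁻¹ q₃⁻¹
        (fun z => -(1 - q₁⁻¹)⁻¹ * tailProd q₁ q₃ u k N lam z 1) ((Finset.Ioo t N).erase s)
        (ptF q₁ q₃ u lam) t) * key

end Resonant

/-! ### Zeros and poles of the eigenvalue of `ψ` -/

/-- The zeros of the eigenvalue of `ψ^±(z)` on `|lam⟩`. -/
def psiZero (q₁ q₂ q₃ u : ℂ) (lam : ℕ → ℤ) : ℕ ⊕ ℕ → ℂ :=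
  Sum.elim (fun s => q₃ * pt q₁ q₃ u lam s) fun s => q₂ * pt q₁ q₃ u lam s

/-- The poles of the eigenvalue of `ψ^±(z)` on `|lam⟩`: the pole `Sum.inl s` is the support of the
move of the `s`-th part up, the pole `Sum.inr s` that of the move down. -/
def psiPole (q₁ q₃ u : ℂ) (lam : ℕ → ℤ) : ℕ ⊕ ℕ → ℂ :=
  Sum.elim (pt q₁ q₃ u lam) (ptF q₁ q₃ u lam)

/-- The index set of the zeros and poles of the eigenvalue computed from `N` factors. -/
def psiIdx (k N : ℕ) : Finset (ℕ ⊕ ℕ) := (Finset.range (N + k)).disjSum (Finset.range N)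

open Classical in
/-- The poles that are not cancelled: they belong to the moves that keep `lam` admissible. -/
def psiOpen (k r : ℕ) (c : ℕ → ℤ) (N : ℕ) (lam : ℕ → ℤ) : Finset (ℕ ⊕ ℕ) :=
  ((Finset.range N).filter fun s => shift lam s 1 ∈ S k r c).disjSum
    ((Finset.range N).filter fun s => shift lam s (-1) ∈ S k r c)

/-- A forbidden move is blocked by another part, and the zero belonging to the blocking part
cancels the pole of the move. -/
def blocker (k r : ℕ) (lam : ℕ → ℤ) : ℕ ⊕ ℕ → ℕ ⊕ ℕ :=
  Sum.elim
    (fun s => if k ≤ s ∧ lam (s - k) - lam s = r then Sum.inr (s - k) else Sum.inl (s - 1))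
    fun s => if lam s - lam (s + k) = r then Sum.inl (s + k) else Sum.inr (s + 1)

theorem psiSer_eq_prod (ε : Sgn) (q₁ q₂ q₃ u : ℂ) (k N : ℕ) (lam : ℕ → ℤ) :
    psiSer q₁ q₂ q₃ u k ε N lam = ∏ i ∈ psiIdx k N,
      lin ε (psiZero q₁ q₂ q₃ u lam i) * (lin ε (psiPole q₁ q₃ u lam i))⁻¹ := by
  rw [psiIdx, Finset.prod_disjSum, psiSer, expand_tailProd,
    ← Finset.prod_range_mul_prod_Ico _ (Nat.le_add_right N k)]
  simp only [expand_gam, psiZero, psiPole, Sum.elim_inl, Sum.elim_inr, Finset.prod_mul_distrib, ptF]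
  ring

/-- The eigenvalue of `ψ(z)` without the factor `t`. -/
def psiRest (q₁ q₂ q₃ u : ℂ) (k N : ℕ) (lam : ℕ → ℤ) (t : ℕ) (z : ℂ) : ℂ :=
  tailProd q₁ q₃ u k N lam z 1 *
    ∏ l ∈ (Finset.range N).erase t, gam q₁ q₂ q₃ (pt q₁ q₃ u lam l) z 1

theorem residue_inl {q₁ q₂ q₃ u : ℂ} {k N t : ℕ} (ht : t < N) (lam : ℕ → ℤ) (z : ℂ) :
    (∏ j ∈ psiIdx k N, (z - psiZero q₁ q₂ q₃ u lam j)) *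
      (∏ j ∈ (psiIdx k N).erase (Sum.inl t), (z - psiPole q₁ q₃ u lam j)⁻¹) =
    (z - q₃ * pt q₁ q₃ u lam t) * (z - q₂ * pt q₁ q₃ u lam t) * (z - ptF q₁ q₃ u lam t)⁻¹ *
      psiRest q₁ q₂ q₃ u k N lam t z := by
  have h1 : (psiIdx k N).erase (Sum.inl t) =
      ((Finset.range (N + k)).erase t).disjSum (Finset.range N) := by
    ext i; rcases i with i | i <;> simp [psiIdx]
  have h2 : (Finset.range (N + k)).erase t = (Finset.range N).erase t ∪ Finset.Ico N (N + k) := by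
    ext i; simp only [Finset.mem_erase, Finset.mem_range, Finset.mem_union, Finset.mem_Ico]; omega
  have h3 : Disjoint ((Finset.range N).erase t) (Finset.Ico N (N + k)) := by
    rw [Finset.disjoint_left]
    simp only [Finset.mem_erase, Finset.mem_range, Finset.mem_Ico]
    omega
  rw [h1, psiIdx, Finset.prod_disjSum, Finset.prod_disjSum, h2, Finset.prod_union h3,
    ← Finset.prod_range_mul_prod_Ico _ (Nat.le_add_right N k), psiRest, tailProd]
  have e : t ∈ Finset.range N := Finset.mem_range.2 ht
  rw [← Finset.mul_prod_erase _ (fun j => z - psiZero q₁ q₂ q₃ u lam (Sum.inl j)) e,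
    ← Finset.mul_prod_erase _ (fun j => z - psiZero q₁ q₂ q₃ u lam (Sum.inr j)) e,
    ← Finset.mul_prod_erase _ (fun j => (z - psiPole q₁ q₃ u lam (Sum.inr j))⁻¹) e]
  simp only [gam, factor, psiZero, psiPole, Sum.elim_inl, Sum.elim_inr, Finset.prod_mul_distrib,
    ptF, smul_eq_mul, mul_one]
  ring

theorem residue_inr {q₁ q₂ q₃ u : ℂ} {k N t : ℕ} (ht : t < N) (lam : ℕ → ℤ) (z : ℂ) :
    (∏ j ∈ psiIdx k N, (z - psiZero q₁ q₂ q₃ u lam j)) *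
      (∏ j ∈ (psiIdx k N).erase (Sum.inr t), (z - psiPole q₁ q₃ u lam j)⁻¹) =
    (z - q₃ * pt q₁ q₃ u lam t) * (z - q₂ * pt q₁ q₃ u lam t) * (z - pt q₁ q₃ u lam t)⁻¹ *
      psiRest q₁ q₂ q₃ u k N lam t z := by
  have h1 : (psiIdx k N).erase (Sum.inr t) =
      (Finset.range (N + k)).disjSum ((Finset.range N).erase t) := by
    ext i; rcases i with i | i <;> simp [psiIdx]
  rw [h1, psiIdx, Finset.prod_disjSum, Finset.prod_disjSum, psiRest, tailProd,
    ← Finset.prod_range_mul_prod_Ico _ (Nat.le_add_right N k),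
    ← Finset.prod_range_mul_prod_Ico _ (Nat.le_add_right N k)]
  have e : t ∈ Finset.range N := Finset.mem_range.2 ht
  rw [← Finset.mul_prod_erase _ (fun j => z - psiZero q₁ q₂ q₃ u lam (Sum.inl j)) e,
    ← Finset.mul_prod_erase _ (fun j => z - psiZero q₁ q₂ q₃ u lam (Sum.inr j)) e,
    ← Finset.mul_prod_erase _ (fun j => (z - psiPole q₁ q₃ u lam (Sum.inl j))⁻¹) e]
  simp only [gam, factor, psiZero, psiPole, Sum.elim_inl, Sum.elim_inr, Finset.prod_mul_distrib,
    ptF, smul_eq_mul, mul_one]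
  ring

/-- The forbidden moves: those of a part that is equal to its neighbour, or whose gap condition is
saturated. -/
theorem not_mem_psiOpen {k r : ℕ} {c : ℕ → ℤ} {lam : ℕ → ℤ} (hk : 1 ≤ k) (hS : lam ∈ S k r c)
    {N : ℕ} (hN : Settled k r c N lam) :
    (∀ s, Sum.inl s ∈ psiIdx k N \ psiOpen k r c N lam ↔ s < N + k ∧
      ((∃ j, j + 1 = s ∧ lam s = lam j) ∨ ∃ j, j + k = s ∧ lam j - lam s = r)) ∧
    (∀ s, Sum.inr s ∈ psiIdx k N \ psiOpen k r c N lam ↔ s < N ∧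
      (lam (s + 1) = lam s ∨ lam s - lam (s + k) = r)) := by
  constructor <;> intro s
  · simp only [psiIdx, psiOpen, Finset.mem_sdiff, Finset.inl_mem_disjSum, Finset.mem_range,
      Finset.mem_filter]
    have h1 : shift lam s 1 ∈ S k r c → s < N := hN.lt_of_raise_mem hk hS
    rw [show ¬(s < N ∧ shift lam s 1 ∈ S k r c) ↔ shift lam s 1 ∉ S k r c by tauto,
      raise_mem_S_iff hk hS]
    refine and_congr_right fun _ => ?_
    rw [not_and_or]
    push Not
    refine or_congr (exists_congr fun j => and_congr_right fun hj => ?_)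
      (exists_congr fun j => and_congr_right fun hj => ?_)
    · subst hj
      have := hS.1 (Nat.le_succ j)
      simp only [Nat.succ_eq_add_one] at this
      omega
    · subst hj
      have := hS.2.1 j
      omega
  · simp only [psiIdx, psiOpen, Finset.mem_sdiff, Finset.inr_mem_disjSum, Finset.mem_range,
      Finset.mem_filter, lower_mem_S_iff hk hS]
    have h1 := hS.1 (Nat.le_succ s)
    have h2 := hS.2.1 s
    simp only [Nat.succ_eq_add_one] at h1
    omega

theorem prod_range_mul_prod_Ioo {N t : ℕ} (ht : t < N) (f : ℕ → ℂ) :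
    (∏ l ∈ Finset.range t, f l) * ∏ l ∈ Finset.Ioo t N, f l =
      ∏ l ∈ (Finset.range N).erase t, f l := by
  rw [← Finset.prod_union]
  · congr 1
    ext i; simp only [Finset.mem_erase, Finset.mem_range, Finset.mem_union, Finset.mem_Ioo]; omega
  · rw [Finset.disjoint_left]
    simp only [Finset.mem_range, Finset.mem_Ioo]
    omega

namespace Resonant

variable {k r : ℕ} {q₁ q₂ q₃ u : ℂ} {c : ℕ → ℤ} (H : Resonant k r q₁ q₂ q₃ u) {lam : ℕ → ℤ}
include H

theorem pt_lower_self (lam : ℕ → ℤ) (t : ℕ) :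
    pt q₁ q₃ u (shift lam t (-1)) t = ptF q₁ q₃ u lam t := by
  rw [H.pt_shift_self, zpow_neg_one, ptF]

theorem ptF_raise_self (lam : ℕ → ℤ) (t : ℕ) :
    ptF q₁ q₃ u (shift lam t 1) t = pt q₁ q₃ u lam t := by
  rw [ptF, H.pt_shift_self, zpow_one, inv_mul_cancel_left₀ H.q₁_ne]

theorem eCo_mul_fCo_raise {N t : ℕ} (ht : t < N) (lam : ℕ → ℤ) :
    eCo q₁ q₂ q₃ u lam t * fCo q₁ q₂ q₃ u k N (shift lam t 1) t =
      -((1 - q₁)⁻¹ * (1 - q₁⁻¹)⁻¹) * psiRest q₁ q₂ q₃ u k N lam t (pt q₁ q₃ u lam t) := by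
  have h : ∏ l ∈ Finset.Ioo t N, gam q₁ q₂ q₃ (pt q₁ q₃ u (shift lam t 1) l)
      (pt q₁ q₃ u lam t) 1 = ∏ l ∈ Finset.Ioo t N, gam q₁ q₂ q₃ (pt q₁ q₃ u lam l)
      (pt q₁ q₃ u lam t) 1 := by
    refine Finset.prod_congr rfl fun l hl => ?_
    simp only [pt, shift_ne _ (Finset.mem_Ioo.1 hl).1.ne']
  rw [H.fCo_eq, H.ptF_raise_self, tailProd_shift ht, h, psiRest,
    ← prod_range_mul_prod_Ioo ht, eCo, coef]
  ring

theorem fCo_mul_eCo_lower {N t : ℕ} (ht : t < N) (lam : ℕ → ℤ) :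
    fCo q₁ q₂ q₃ u k N lam t * eCo q₁ q₂ q₃ u (shift lam t (-1)) t =
      -((1 - q₁)⁻¹ * (1 - q₁⁻¹)⁻¹) * psiRest q₁ q₂ q₃ u k N lam t (ptF q₁ q₃ u lam t) := by
  have h : ∏ l ∈ Finset.range t, gam q₁ q₂ q₃ (pt q₁ q₃ u (shift lam t (-1)) l)
      (ptF q₁ q₃ u lam t) 1 = ∏ l ∈ Finset.range t, gam q₁ q₂ q₃ (pt q₁ q₃ u lam l)
      (ptF q₁ q₃ u lam t) 1 := by
    refine Finset.prod_congr rfl fun l hl => ?_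
    simp only [pt, shift_ne _ (Finset.mem_range.1 hl).ne]
  rw [H.fCo_eq, psiRest, ← prod_range_mul_prod_Ioo ht, eCo, coef, H.pt_lower_self, h]
  ring

theorem psiPole_ne_zero (lam : ℕ → ℤ) (i : ℕ ⊕ ℕ) : psiPole q₁ q₃ u lam i ≠ 0 := by
  rcases i with i | i
  · exact H.pt_ne_zero lam i
  · exact H.ptF_ne_zero lam i

theorem pt_injective (hS : lam ∈ S k r c) : Function.Injective (pt q₁ q₃ u lam) := by
  intro s t h
  by_contra hst
  rcases lt_or_gt_of_ne hst with h' | h'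
  · exact H.pt_ne_of_nonpos hS h' le_rfl (by rw [h]; simp)
  · exact H.pt_ne_of_nonpos hS h' le_rfl (by rw [h]; simp)

/-- A coincidence of the pole of a move up with the pole of a move down requires that both moves
are blocked. -/
theorem pt_ne_ptF (hS : lam ∈ S k r c) {s t : ℕ}
    (h : shift lam s 1 ∈ S k r c ∨ shift lam t (-1) ∈ S k r c) :
    pt q₁ q₃ u lam s ≠ ptF q₁ q₃ u lam t := by
  have hk := H.one_le
  intro e
  have e' : q₁ * pt q₁ q₃ u lam s = pt q₁ q₃ u lam t := by
    rw [e, ptF, mul_inv_cancel_left₀ H.q₁_ne]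
  rcases lt_trichotomy s t with hst | rfl | hst
  · refine H.pt_ne_of_nonpos hS hst (e := -1) (by norm_num) ?_
    rw [e, ptF, zpow_neg_one]
  · have := H.pt_ne_zero lam s
    exact H.q₁_ne_one (mul_right_cancel₀ this (by rw [e', one_mul]))
  · rcases h with h | h
    · have := H.shape_of_pt_eq hS h hst e'
      rw [shift_self, shift_ne _ (by omega : t ≠ s), shift_ne _ (by omega : t + 1 ≠ s)] at this
      omega
    · have := H.shape_of_pt_eq hS h hst e'
      rw [shift_self, shift_ne _ (by omega : s ≠ t), shift_ne _ (by omega : t + 1 ≠ t)] at this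
      omega

theorem psiOpen_separated (hS : lam ∈ S k r c) {N : ℕ} :
    ∀ i ∈ psiOpen k r c N lam, ∀ j ∈ psiIdx k N, j ≠ i →
      psiPole q₁ q₃ u lam i ≠ psiPole q₁ q₃ u lam j := by
  rintro (s | s) hi (t | t) - hij
  · exact (H.pt_injective hS).ne fun h => hij (by rw [h])
  · simp only [psiOpen, Finset.inl_mem_disjSum, Finset.mem_filter] at hi
    exact H.pt_ne_ptF hS (Or.inl hi.2)
  · simp only [psiOpen, Finset.inr_mem_disjSum, Finset.mem_filter] at hi
    exact (H.pt_ne_ptF hS (Or.inr hi.2)).symm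
  · intro h
    exact hij (by rw [H.pt_injective hS (mul_left_cancel₀ (inv_ne_zero H.q₁_ne) h)])

theorem blocker_mem (hS : lam ∈ S k r c) {N : ℕ} (hN : Settled k r c N lam) :
    ∀ i ∈ psiIdx k N \ psiOpen k r c N lam, blocker k r lam i ∈ psiIdx k N := by
  have hk := H.one_le
  obtain ⟨h1, h2⟩ := not_mem_psiOpen hk hS hN
  rintro (s | s) hi
  · rw [h1] at hi
    simp only [blocker, Sum.elim_inl]
    split_ifs <;> simp only [psiIdx, Finset.inl_mem_disjSum, Finset.inr_mem_disjSum,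
      Finset.mem_range] <;> omega
  · rw [h2] at hi
    simp only [blocker, Sum.elim_inr]
    split_ifs with h
    · simp only [psiIdx, Finset.inl_mem_disjSum, Finset.mem_range]
      omega
    · simp only [psiIdx, Finset.inr_mem_disjSum, Finset.mem_range]
      by_contra h3
      have := hN.gap hk (j := s) (by omega)
      omega

theorem psiZero_blocker (hS : lam ∈ S k r c) {N : ℕ} (hN : Settled k r c N lam) :
    ∀ i ∈ psiIdx k N \ psiOpen k r c N lam,
      psiZero q₁ q₂ q₃ u lam (blocker k r lam i) = psiPole q₁ q₃ u lam i := by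
  have hk := H.one_le
  have e1 := H.q₁_ne
  have e3 := H.q₃_ne
  obtain ⟨h1, h2⟩ := not_mem_psiOpen hk hS hN
  rintro (s | s) hi
  · rw [h1] at hi
    simp only [blocker, Sum.elim_inl]
    split_ifs with h
    · have := H.pt_eq_q₂_mul (s := s - k) (by rw [Nat.sub_add_cancel h.1]; exact h.2)
      rw [Nat.sub_add_cancel h.1] at this
      exact this.symm
    · obtain ⟨j, rfl, hj⟩ : ∃ j, j + 1 = s ∧ lam s = lam j := by
        rcases hi.2 with h' | ⟨j, rfl, hj⟩
        · exact h'
        · exact absurd ⟨by omega, by rwa [Nat.add_sub_cancel]⟩ h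
      exact (H.pt_eq_q₃_mul hj.symm).symm
  · rw [h2] at hi
    simp only [blocker, Sum.elim_inr]
    split_ifs with h
    · simp only [psiZero, psiPole, Sum.elim_inl, Sum.elim_inr, H.pt_eq_q₂_mul h, ptF, H.q₂_eq]
      field_simp
    · have h' : lam s = lam (s + 1) := by tauto
      simp only [psiZero, psiPole, Sum.elim_inr, H.pt_eq_q₃_mul h', ptF, H.q₂_eq]
      field_simp

theorem blocker_injOn (hS : lam ∈ S k r c) {N : ℕ} (hN : Settled k r c N lam) :
    Set.InjOn (blocker k r lam) (psiIdx k N \ psiOpen k r c N lam : Finset (ℕ ⊕ ℕ)) := by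
  have hk := H.one_le
  obtain ⟨h1, h2⟩ := not_mem_psiOpen hk hS hN
  -- `blocker` gives preference to a saturated gap condition: if one part blocked a move up and a
  -- move down by the same zero, the gap conditions at both `t` and `t + 1` would be saturated, and
  -- one of the two moves would have another blocker
  have hne : ∀ s t, Sum.inl s ∈ psiIdx k N \ psiOpen k r c N lam →
      Sum.inr t ∈ psiIdx k N \ psiOpen k r c N lam →
      blocker k r lam (Sum.inl s) ≠ blocker k r lam (Sum.inr t) := by
    intro s t hi hj h
    rw [h1] at hi
    rw [h2] at hj
    have a1 := hS.1 (Nat.le_succ t)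
    have a2 := hS.1 (Nat.le_succ (t + k))
    have a4 := hS.2.1 t
    have a3 := hS.2.1 (t + 1)
    rw [show t + 1 + k = t + k + 1 by ring] at a3
    simp only [Nat.succ_eq_add_one] at a1 a2
    simp only [blocker, Sum.elim_inl, Sum.elim_inr] at h
    split_ifs at h with g1 g2 g2
    · simp only [Sum.inr.injEq] at h
      obtain rfl : s = t + k + 1 := by omega
      rw [show t + k + 1 - k = t + 1 by omega] at g1
      clear hi
      omega
    · simp only [Sum.inl.injEq] at h
      have hs : lam s = lam (s - 1) ∧ s = t + k + 1 := by
        rcases hi.2 with ⟨j, rfl, hj'⟩ | ⟨j, rfl, hj'⟩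
        · exact ⟨by rwa [Nat.add_sub_cancel], by omega⟩
        · rw [Nat.add_sub_cancel] at g1
          omega
      obtain ⟨hs, rfl⟩ := hs
      rw [show t + k + 1 - k = t + 1 by omega] at g1
      rw [Nat.add_sub_cancel] at hs
      clear hi
      omega
  rintro (s | s) hi (t | t) hj h
  · rw [Finset.mem_coe, h1] at hi hj
    have pos : ∀ s, ((∃ j, j + 1 = s ∧ lam s = lam j) ∨ ∃ j, j + k = s ∧ lam j - lam s = r) →
        ¬(k ≤ s ∧ lam (s - k) - lam s = r) → 1 ≤ s := by
      rintro s (⟨j, rfl, -⟩ | ⟨j, rfl, -⟩) _ <;> omega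
    simp only [blocker, Sum.elim_inl] at h
    split_ifs at h with g1 g2 g2 <;> simp only [Sum.inl.injEq, Sum.inr.injEq] at h <;>
      congr 1
    · omega
    · have := pos s hi.2 g1
      have := pos t hj.2 g2
      omega
  · exact absurd h (hne s t hi hj)
  · exact absurd h.symm (hne t s hj hi)
  · rw [Finset.mem_coe, h2] at hi hj
    simp only [blocker, Sum.elim_inr] at h
    split_ifs at h <;> simp only [Sum.inl.injEq, Sum.inr.injEq] at h <;> congr 1 <;>
      omega

/-- The diagonal part of the commutator of `e` and `f` is the difference of the two expansions of
the eigenvalue of `ψ`, by partial fractions. -/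
theorem diagonal_eq (hS : lam ∈ S k r c) {N : ℕ} (hN : Settled k r c N lam) (n : ℤ) :
    (1 - q₁) * (1 - q₂) * (1 - q₃) * ∑ t ∈ Finset.range N,
      (fCo q₁ q₂ q₃ u k N lam t * eCo q₁ q₂ q₃ u (shift lam t (-1)) t * ptF q₁ q₃ u lam t ^ n
        - eCo q₁ q₂ q₃ u lam t * fCo q₁ q₂ q₃ u k N (shift lam t 1) t * pt q₁ q₃ u lam t ^ n) =
    zcoeff Sgn.plus (psiSer q₁ q₂ q₃ u k Sgn.plus N lam) n
      - zcoeff Sgn.minus (psiSer q₁ q₂ q₃ u k Sgn.minus N lam) n := by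
  classical
  have hD : psiOpen k r c N lam ⊆ psiIdx k N := by
    refine Finset.disjSum_mono ?_ (Finset.filter_subset _ _)
    exact (Finset.filter_subset _ _).trans (Finset.range_mono (Nat.le_add_right N k))
  have h1 := H.q₁_ne
  have h2 : 1 - q₁ ≠ 0 := sub_ne_zero.2 H.q₁_ne_one.symm
  have h3 : 1 - q₁⁻¹ ≠ 0 := sub_ne_zero.2 fun h => H.q₁_ne_one (by rw [← inv_inv q₁, ← h, inv_one])
  rw [psiSer_eq_prod, psiSer_eq_prod, zcoeff_sub_zcoeff_of_cancel _ _ hD (blocker k r lam)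
    (H.blocker_mem hS hN) (H.psiZero_blocker hS hN) (H.blocker_injOn hS hN)
    (H.psiPole_ne_zero lam) (H.psiOpen_separated hS), psiOpen, Finset.sum_disjSum,
    Finset.sum_filter, Finset.sum_filter, ← Finset.sum_add_distrib, Finset.mul_sum]
  refine Finset.sum_congr rfl fun t ht => ?_
  rw [Finset.mem_range] at ht
  have e1 : (1 - q₁) * (1 - q₂) * (1 - q₃) * (-(eCo q₁ q₂ q₃ u lam t *
      fCo q₁ q₂ q₃ u k N (shift lam t 1) t * pt q₁ q₃ u lam t ^ n)) =
      if shift lam t 1 ∈ S k r c then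
        (∏ j ∈ psiIdx k N, (psiPole q₁ q₃ u lam (Sum.inl t) - psiZero q₁ q₂ q₃ u lam j)) *
        (∏ j ∈ (psiIdx k N).erase (Sum.inl t),
          (psiPole q₁ q₃ u lam (Sum.inl t) - psiPole q₁ q₃ u lam j)⁻¹) *
        psiPole q₁ q₃ u lam (Sum.inl t) ^ (n - 1) else 0 := by
    split_ifs with h
    · rw [residue_inl ht, H.eCo_mul_fCo_raise ht]
      have hx := H.pt_ne_zero lam t
      simp only [psiPole, Sum.elim_inl, ptF]
      rw [show pt q₁ q₃ u lam t - q₁⁻¹ * pt q₁ q₃ u lam t = (1 - q₁⁻¹) * pt q₁ q₃ u lam t by ring,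
        zpow_sub_one₀ hx]
      field_simp
    · rw [H.eCo_eq_zero hS h]
      ring
  have e2 : (1 - q₁) * (1 - q₂) * (1 - q₃) * (fCo q₁ q₂ q₃ u k N lam t *
      eCo q₁ q₂ q₃ u (shift lam t (-1)) t * ptF q₁ q₃ u lam t ^ n) =
      if shift lam t (-1) ∈ S k r c then
        (∏ j ∈ psiIdx k N, (psiPole q₁ q₃ u lam (Sum.inr t) - psiZero q₁ q₂ q₃ u lam j)) *
        (∏ j ∈ (psiIdx k N).erase (Sum.inr t),
          (psiPole q₁ q₃ u lam (Sum.inr t) - psiPole q₁ q₃ u lam j)⁻¹) *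
        psiPole q₁ q₃ u lam (Sum.inr t) ^ (n - 1) else 0 := by
    split_ifs with h
    · rw [residue_inr ht, H.fCo_mul_eCo_lower ht]
      have hy := H.ptF_ne_zero lam t
      have hx : pt q₁ q₃ u lam t = q₁ * ptF q₁ q₃ u lam t := by
        rw [ptF, mul_inv_cancel_left₀ h1]
      simp only [psiPole, Sum.elim_inr]
      rw [hx, zpow_sub_one₀ hy]
      generalize ptF q₁ q₃ u lam t = y at *
      rw [show y - q₁ * y = (1 - q₁) * y by ring,
        show y - q₃ * (q₁ * y) = (1 - q₁ * q₃) * y by ring,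
        show y - q₂ * (q₁ * y) = (1 - q₁ * q₂) * y by ring]
      have e : (1 - q₁ * q₃) * (1 - q₁ * q₂) = q₁ * ((1 - q₂) * (1 - q₃)) := by
        linear_combination (q₁ - 1) * H.prod_eq
      have e' : (1 - q₁⁻¹)⁻¹ = -(q₁ * (1 - q₁)⁻¹) := by
        rw [show 1 - q₁⁻¹ = -(q₁⁻¹ * (1 - q₁)) by field_simp; ring, inv_neg, mul_inv, inv_inv]
      rw [e', mul_inv]
      have i1 := mul_inv_cancel₀ h2
      have i2 := mul_inv_cancel₀ hy
      generalize (1 - q₁)⁻¹ = v at *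
      generalize y⁻¹ = w at *
      generalize psiRest q₁ q₂ q₃ u k N lam t y = R at *
      generalize y ^ n = Y at *
      linear_combination (v * q₁ * (1 - q₂) * (1 - q₃) * R * Y) * i1 - v * R * Y * e -
        (1 - q₁ * q₃) * (1 - q₁ * q₂) * v * R * Y * (y * w + 1) * i2
    · rw [H.fCo_eq_zero hS hN ht h]
      ring
  rw [← e1, ← e2]
  ring

/-- `[e(z), f(w)]` is the difference of `ψ⁺` and `ψ⁻`. -/
theorem e_f (c : ℕ → ℤ) (n m : ℤ) :
    ((1 - q₁) * (1 - q₂) * (1 - q₃)) •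
      (eAct k r c q₁ q₂ q₃ u n * fAct k r c q₁ q₂ q₃ u m -
        fAct k r c q₁ q₂ q₃ u m * eAct k r c q₁ q₂ q₃ u n) =
      psiAct k r c q₁ q₂ q₃ u Sgn.plus (n + m) - psiAct k r c q₁ q₂ q₃ u Sgn.minus (n + m) := by
  refine end_ext fun lam hS => ?_
  obtain ⟨N, hN⟩ := exists_settled hS
  have hE : IsStep k r c 1 (fun _ => eCo q₁ q₂ q₃ u) _ _ := (H.isCurrent_e (c := c)).step
  have hF : IsStep k r c (-1) (fun N => fCo q₁ q₂ q₃ u k N) _ _ := (H.isCurrent_f (c := c)).step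
  have hM := hN.mono (by omega : N ≤ N + k + 1)
  have key := H.diagonal_eq hS hM (n + m)
  rw [LinearMap.smul_apply, LinearMap.sub_apply, LinearMap.sub_apply, Module.End.mul_apply,
    Module.End.mul_apply, H.psiAct_vec _ _ hS hM, H.psiAct_vec _ _ hS hM]
  rw [hE.act_act hF hS hN le_rfl, hF.act_act hE hS hN le_rfl, ← sub_smul, ← key,
    mul_smul _ (∑ t ∈ _, _), Finset.sum_smul]
  congr 1
  rw [Finset.sum_comm (f := fun t s => (_ : ℂ) • vec k r c (shift (shift lam t 1) s (-1))),
    ← Finset.sum_sub_distrib]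
  refine Finset.sum_congr rfl fun t ht => ?_
  rw [← Finset.sum_sub_distrib, Finset.sum_eq_single_of_mem t ht]
  · rw [H.pt_lower_self, H.ptF_raise_self]
    have e1 := shift_shift_neg lam t 1
    have e2 := shift_shift_neg lam t (-1)
    rw [neg_neg] at e2
    rw [e1, e2, ← sub_smul, zpow_add₀ (H.ptF_ne_zero lam t), zpow_add₀ (H.pt_ne_zero lam t)]
    congr 1
    ring
  · intro s hs hst
    rw [shift_comm lam s t]
    by_cases h : shift (shift lam t (-1)) s 1 ∈ S k r c
    · rw [← sub_smul, ← H.fCo_mul_eCo hS (Finset.mem_range.1 hs) hst h]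
      have e1 : pt q₁ q₃ u (shift lam t (-1)) s = pt q₁ q₃ u lam s := by
        rw [pt, shift_ne _ hst, pt]
      have e2 : ptF q₁ q₃ u (shift lam s 1) t = ptF q₁ q₃ u lam t := by
        rw [ptF, pt, shift_ne _ hst.symm, ptF, pt]
      rw [e1, e2]
      convert zero_smul ℂ _
      ring
    · rw [vec_of_notMem h, smul_zero, smul_zero, sub_zero]

end Resonant

/-! ### The modified operators on truncated vectors -/

namespace Resonant

variable {k r : ℕ} {q₁ q₂ q₃ u : ℂ} {c : ℕ → ℤ} (H : Resonant k r q₁ q₂ q₃ u) {lam : ℕ → ℤ}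
include H

theorem pt_of_eq_tail {m j : ℕ} (hj : j < k) (h : lam (m * k + j) = tail k r c (m * k + j)) :
    pt q₁ q₃ u lam (m * k + j) = q₁ ^ (-c j - (m : ℤ)) * q₃ ^ (-(m : ℤ) + j) * u := by
  have h1 := H.q₁_ne
  have h3 := H.q₃_ne
  have hk := H.one_le
  have e1 : (m * k + j) / k = m := by
    rw [add_comm, Nat.add_mul_div_right _ _ hk, Nat.div_eq_of_lt hj, zero_add]
  have e2 : (m * k + j) % k = j := by
    rw [add_comm, Nat.add_mul_mod_self_right, Nat.mod_eq_of_lt hj]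
  have h4 := (H.pow_eq_one_iff ((1 - (r : ℤ)) * m) (((k : ℤ) + 1) * m)).2 ⟨m, rfl, rfl⟩
  rw [pt, h, tail, e1, e2]
  have e3 : -(m : ℤ) * r - c j = (-c j - m) + (1 - (r : ℤ)) * m := by ring
  have e4 : ((m * k + j : ℕ) : ℤ) = (-(m : ℤ) + j) + ((k : ℤ) + 1) * m := by push_cast; ring
  rw [e3, e4, zpow_add₀ h1, zpow_add₀ h3]
  linear_combination (q₁ ^ (-c j - (m : ℤ)) * q₃ ^ (-(m : ℤ) + j) * u) * h4

/-- The modifying factor `β_{k,N}` accounts for the tensor factors from `N` on. -/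
theorem beta_eq_tailProd {R : Type} [CommRing R] [Algebra ℂ R] [Inv R] {N : ℕ} (hN1 : 1 ≤ N)
    (hN : Settled k r c N lam) (z y : R) :
    beta q₁ q₃ u k c N z y = tailProd q₁ q₃ u k N lam z y := by
  have hk := H.one_le
  have h3 := H.q₃_ne
  have hi := Nat.mod_lt (N - 1) hk
  have hd := Nat.div_add_mod' (N - 1) k
  unfold beta tailProd
  generalize (N - 1) % k = i at *
  generalize (N - 1) / k = m at *
  obtain rfl : N = i + 1 + m * k := by omega
  rw [← Finset.prod_Ico_consecutive _ (show i + 1 + m * k ≤ k + m * k by omega)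
    (show k + m * k ≤ i + 1 + m * k + k by omega), mul_comm]
  congr 1
  · rw [← Finset.prod_Ico_add]
    refine Finset.prod_congr rfl fun j hj => ?_
    rw [Finset.mem_Ico] at hj
    rw [H.pt_of_eq_tail hj.2 (hN.2 _ (by omega)), zpow_add_one₀ h3]
    congr 1
    ring
  · have e : Finset.Ico (k + m * k) (i + 1 + m * k + k) =
        Finset.Ico (0 + (m + 1) * k) (i + 1 + (m + 1) * k) := by
      congr 1 <;> ring
    rw [e, ← Finset.prod_Ico_add, ← Finset.range_eq_Ico]
    refine Finset.prod_congr rfl fun j hj => ?_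
    rw [Finset.mem_range] at hj
    rw [H.pt_of_eq_tail (by omega : j < k) (hN.2 _ (by nlinarith))]
    have e1 : (-c j - (m : ℤ) - 1) = -c j - ((m + 1 : ℕ) : ℤ) := by push_cast; ring
    have e2 : (-(m : ℤ) + j) = -((m + 1 : ℕ) : ℤ) + j + 1 := by push_cast; ring
    rw [e1, e2, add_sub_cancel_right, zpow_add_one₀ h3]
    congr 1
    ring

theorem param_eq (lam : ℕ → ℤ) {N : ℕ} (s : Fin N) :
    q₁ ^ (lam s - (s : ℤ)) * params q₂ u N s = pt q₁ q₃ u lam s := by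
  have h1 := H.q₁_ne
  have h3 := H.q₃_ne
  rw [params, H.q₂_eq, mul_zpow, inv_zpow', inv_zpow', neg_neg, zpow_sub₀ h1, pt]
  have : q₁ ^ (s : ℤ) ≠ 0 := zpow_ne_zero _ h1
  field_simp

theorem param_sub_one_eq (lam : ℕ → ℤ) {N : ℕ} (s : Fin N) :
    q₁ ^ (lam s - (s : ℤ) - 1) * params q₂ u N s = ptF q₁ q₃ u lam s := by
  rw [zpow_sub_one₀ H.q₁_ne, ptF, ← H.param_eq lam s]
  ring

end Resonant

/-- The vector `|lam_1, …, lam_N⟩`. -/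
def trunc (N : ℕ) (lam : ℕ → ℤ) : V N := ket fun j : Fin N => lam j

theorem single_update {N : ℕ} (lam : ℕ → ℤ) (s : Fin N) (d : ℤ) (x : ℂ) :
    Finsupp.single (Function.update (fun j : Fin N => lam j - (j : ℤ)) s (lam s - (s : ℤ) + d)) x =
      x • trunc N (shift lam s d) := by
  rw [trunc, ket, Finsupp.smul_single, smul_eq_mul, mul_one]
  congr 1
  ext j
  by_cases h : j = s
  · subst h
    simp only [Function.update_self, shift_self]
    ring
  · rw [Function.update_of_ne h, shift_ne _ fun e => h (Fin.ext e)]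

theorem prod_Iio_fin {N : ℕ} (s : Fin N) (f : ℕ → ℂ) :
    ∏ l ∈ Finset.Iio s, f l = ∏ l ∈ Finset.range s, f l := by
  rw [← Nat.Iio_eq_range, ← Fin.map_valEmbedding_Iio, Finset.prod_map]
  rfl

theorem prod_Ioi_fin {N : ℕ} (s : Fin N) (f : ℕ → ℂ) :
    ∏ l ∈ Finset.Ioi s, f l = ∏ l ∈ Finset.Ioo (s : ℕ) N, f l := by
  have h : (Finset.Ioi s).map Fin.valEmbedding = Finset.Ioo (s : ℕ) N := by
    ext l
    simp only [Finset.mem_map, Finset.mem_Ioi, Fin.valEmbedding_apply, Finset.mem_Ioo]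
    exact ⟨by rintro ⟨j, hj, rfl⟩; exact ⟨hj, j.2⟩, fun h => ⟨⟨l, h.2⟩, h.1, rfl⟩⟩
  rw [← h, Finset.prod_map]
  rfl

namespace Resonant

variable {k r : ℕ} {q₁ q₂ q₃ u : ℂ} {c : ℕ → ℤ} (H : Resonant k r q₁ q₂ q₃ u) {lam : ℕ → ℤ}
include H

theorem eOp_trunc (N : ℕ) (n : ℤ) (lam : ℕ → ℤ) :
    eOp q₁ q₂ q₃ u N n (trunc N lam) = ∑ s ∈ Finset.range N,
      (eCo q₁ q₂ q₃ u lam s * pt q₁ q₃ u lam s ^ n) • trunc N (shift lam s 1) := by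
  rw [Finset.sum_range, eOp, tensorE, trunc, ket, Finsupp.linearCombination_single, one_smul]
  refine Finset.sum_congr rfl fun s _ => ?_
  rw [single_update]
  simp only [H.param_eq]
  rw [prod_Iio_fin s fun l => gam q₁ q₂ q₃ (pt q₁ q₃ u lam l) (pt q₁ q₃ u lam s) 1]
  rfl

theorem fOp_trunc {N : ℕ} (hN1 : 1 ≤ N) (hN : Settled k r c N lam) (n : ℤ) :
    fOp q₁ q₂ q₃ u k c N n (trunc N lam) = ∑ s ∈ Finset.range N,
      (fCo q₁ q₂ q₃ u k N lam s * ptF q₁ q₃ u lam s ^ n) • trunc N (shift lam s (-1)) := by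
  rw [Finset.sum_range, fOp, tensorF, trunc, ket, Finsupp.linearCombination_single, one_smul]
  refine Finset.sum_congr rfl fun s _ => ?_
  rw [sub_eq_add_neg (_ - _ : ℤ) 1, single_update, ← sub_eq_add_neg]
  simp only [H.param_eq, H.param_sub_one_eq]
  rw [prod_Ioi_fin s fun l => gam q₁ q₂ q₃ (pt q₁ q₃ u lam l) (ptF q₁ q₃ u lam s) 1,
    H.beta_eq_tailProd hN1 hN, H.fCo_eq]

theorem psiOp_trunc {N : ℕ} (hN1 : 1 ≤ N) (hN : Settled k r c N lam) (ε : Sgn) (j : ℕ) :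
    psiOp q₁ q₂ q₃ u k c N ε j (trunc N lam) =
      PowerSeries.coeff j (psiSer q₁ q₂ q₃ u k ε N lam) • trunc N lam := by
  have h : expand ε (beta q₁ q₃ u k c N) = expand ε (tailProd q₁ q₃ u k N lam) := by
    cases ε <;> exact H.beta_eq_tailProd hN1 hN _ _
  rw [psiOp, tensorPsi, trunc, ket, Finsupp.linearCombination_single, one_smul,
    Finsupp.smul_single, smul_eq_mul, mul_one]
  simp only [H.param_eq]
  rw [h, psiSer, Finset.prod_range]

end Resonant

/-! ### Passage to the limit -/

section Limit

variable {k r : ℕ} {c : ℕ → ℤ} {N : ℕ}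

theorem represents_trunc (hk : 1 ≤ k) {lam : ℕ → ℤ} (hS : lam ∈ S k r c)
    (hN : ∀ j, N ≤ j → lam j = tail k r c j) :
    Represents (trunc N lam) (toW k r c (vec k r c lam)) := by
  constructor
  · refine Submodule.subset_span ⟨_, ⟨fun i j hij => hS.1 hij, fun i j hij => ?_, fun j => ?_⟩, rfl⟩
    · rw [hij]
      exact hS.2.1 i
    · exact tail_le_of_mem_S hS hk j
  · rw [vec_of_mem hS, toW_single, ketW, toLimit, trunc, ket, Finsupp.lmapDomain_apply,
      Finsupp.mapDomain_single]
    congr 1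
    ext j
    split_ifs with h
    · simp
    · exact (hN j (by omega)).symm

theorem Represents.smul {v : V N} {x : U k r c} (h : Represents v (toW k r c x)) (a : ℂ) :
    Represents (a • v) (toW k r c (a • x)) := by
  refine ⟨Submodule.smul_mem _ a h.1, ?_⟩
  rw [map_smul, map_smul, h.2]
  rfl

theorem Represents.sum {ι : Type*} (D : Finset ι) {v : ι → V N} {x : ι → U k r c}
    (h : ∀ s ∈ D, Represents (v s) (toW k r c (x s))) :
    Represents (∑ s ∈ D, v s) (toW k r c (∑ s ∈ D, x s)) := by
  refine ⟨Submodule.sum_mem _ fun s hs => (h s hs).1, ?_⟩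
  rw [map_sum, map_sum, Submodule.coe_sum]
  exact Finset.sum_congr rfl fun s hs => (h s hs).2

theorem Represents.zero : Represents (0 : V N) (toW k r c 0) :=
  ⟨Submodule.zero_mem _, by rw [map_zero, map_zero]; rfl⟩

theorem Represents.unique {v : V N} {w w' : W k r c} (h : Represents v w) (h' : Represents v w') :
    w = w' :=
  Subtype.ext (h.2.symm.trans h'.2)

theorem IsStep.represents {d : ℤ} {co : ℕ → (ℕ → ℤ) → ℕ → ℂ} {p : (ℕ → ℤ) → ℕ → ℂ}
    {X : ℤ → Module.End ℂ (U k r c)} (hX : IsStep k r c d co p X) {lam : ℕ → ℤ}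
    (hS : lam ∈ S k r c) (hN : Settled k r c N lam) (n : ℤ) :
    Represents (∑ s ∈ Finset.range N, (co N lam s * p lam s ^ n) • trunc N (shift lam s d))
      (toW k r c (X n (vec k r c lam))) := by
  rw [hX.act N lam n hS hN]
  refine Represents.sum _ fun s hs => ?_
  rw [Finset.mem_range] at hs
  by_cases h : shift lam s d ∈ S k r c
  · refine (represents_trunc hX.one_le h fun j hj => ?_).smul _
    rw [shift_ne _ (by omega), hN.2 j (by omega)]
  · rw [hX.vanish N lam s hS hN hs h, zero_mul, zero_smul, zero_smul]
    exact Represents.zero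

end Limit

/-! ### The representation -/

/-- The scalar by which `ψ^±_0` acts. -/
def level (k : ℕ) (q₃ : ℂ) : Sgn → ℂ
  | Sgn.plus => 1
  | Sgn.minus => q₃ ^ k

/-- The action of the generators. -/
def genAct (k r : ℕ) (c : ℕ → ℤ) (q₁ q₂ q₃ u : ℂ) : Gen → Module.End ℂ (U k r c)
  | Gen.e i => eAct k r c q₁ q₂ q₃ u i
  | Gen.f i => fAct k r c q₁ q₂ q₃ u i
  | Gen.psi Sgn.plus j => psiAct k r c q₁ q₂ q₃ u Sgn.plus j
  | Gen.psi Sgn.minus j => psiAct k r c q₁ q₂ q₃ u Sgn.minus (-j)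
  | Gen.psiInv ε => (level k q₃ ε)⁻¹ • 1

/-- The action of the free algebra. -/
def freeAct (k r : ℕ) (c : ℕ → ℤ) (q₁ q₂ q₃ u : ℂ) : Free →ₐ[ℂ] Module.End ℂ (U k r c) :=
  FreeAlgebra.lift ℂ (genAct k r c q₁ q₂ q₃ u)

theorem map_gCoeff_mul {k r : ℕ} {c : ℕ → ℤ} (φ : Free →ₐ[ℂ] Module.End ℂ (U k r c))
    (q₁ q₂ q₃ : ℂ) (a b : ℤ → ℤ → Free) (n m : ℤ) :
    φ (gCoeff q₁ q₂ q₃ (fun i j => a i j * b i j) n m) =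
      gCoeff q₁ q₂ q₃ (fun i j => φ (a i j) * φ (b i j)) n m := by
  simp only [gCoeff, ← map_mul, ← map_smul]
  rw [map_sub, map_add, map_sub]

theorem map_bracket {k r : ℕ} {c : ℕ → ℤ} (φ : Free →ₐ[ℂ] Module.End ℂ (U k r c)) (a b : Free) :
    φ ⁅a, b⁆ = ⁅φ a, φ b⁆ := by
  rw [Ring.lie_def, Ring.lie_def, map_sub, map_mul, map_mul]

theorem constantCoeff_lin_mul_inv (a b : ℂ) :
    PowerSeries.constantCoeff (lin Sgn.plus a * (lin Sgn.plus b)⁻¹) = 1 ∧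
      PowerSeries.constantCoeff (lin Sgn.minus a * (lin Sgn.minus b)⁻¹) = a * b⁻¹ := by
  constructor
  · simp [lin, expand, PowerSeries.constantCoeff_inv]
  · simp [lin, expand, PowerSeries.constantCoeff_inv, inv_neg]

theorem freeAct_psiF {k r : ℕ} {q₁ q₂ q₃ u : ℂ} (c : ℕ → ℤ) (ε : Sgn) (i : ℤ) :
    freeAct k r c q₁ q₂ q₃ u (psiF ε i) = psiAct k r c q₁ q₂ q₃ u ε i := by
  have h0 : (∀ h, zcoeff ε h i = 0) → psiAct k r c q₁ q₂ q₃ u ε i = 0 := by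
    intro h
    refine end_ext fun lam hS => ?_
    rw [vec_of_mem hS, psiAct, Finsupp.linearCombination_single, h, zero_smul, smul_zero]
    rfl
  cases ε
  · by_cases hi : 0 ≤ i
    · rw [psiF, if_pos hi, freeAct, FreeAlgebra.lift_ι_apply, genAct, Int.toNat_of_nonneg hi]
    · rw [psiF, if_neg hi, map_zero, h0 fun h => if_neg hi]
  · by_cases hi : i ≤ 0
    · rw [psiF, if_pos hi, freeAct, FreeAlgebra.lift_ι_apply, genAct,
        Int.toNat_of_nonneg (by omega), neg_neg]
    · rw [psiF, if_neg hi, map_zero, h0 fun h => if_neg hi]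

namespace Resonant

variable {k r : ℕ} {q₁ q₂ q₃ u : ℂ} (c : ℕ → ℤ) (H : Resonant k r q₁ q₂ q₃ u)

include H

theorem level_ne_zero (ε : Sgn) : level k q₃ ε ≠ 0 := by
  cases ε
  · exact one_ne_zero
  · exact pow_ne_zero _ H.q₃_ne

/-- Each factor of the tail contributes `q₃` to the value of `ψ⁻` at `z = 0`, and the other factors
contribute `q₁ q₂ q₃ = 1`. -/
theorem zcoeff_psiSer_zero (ε : Sgn) (N : ℕ) (lam : ℕ → ℤ) :
    zcoeff ε (psiSer q₁ q₂ q₃ u k ε N lam) 0 = level k q₃ ε := by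
  have h1 := H.q₁_ne
  have e : zcoeff ε (psiSer q₁ q₂ q₃ u k ε N lam) 0 =
      PowerSeries.constantCoeff (psiSer q₁ q₂ q₃ u k ε N lam) := by
    cases ε <;> simp [zcoeff]
  rw [e, psiSer, expand_tailProd, map_mul, map_prod, map_prod]
  simp only [expand_gam, map_mul PowerSeries.constantCoeff (_ * _) (_ * _)]
  cases ε
  · simp [constantCoeff_lin_mul_inv, level]
  · simp only [constantCoeff_lin_mul_inv, level]
    rw [Finset.prod_congr rfl fun l _ => show q₃ * pt q₁ q₃ u lam l * (pt q₁ q₃ u lam l)⁻¹ = q₃ from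
        mul_inv_cancel_right₀ (H.pt_ne_zero lam l) _,
      Finset.prod_congr (s₁ := Finset.range N) rfl fun l _ => show _ = (1 : ℂ) from ?_]
    · simp
    · have := H.pt_ne_zero lam l
      field_simp
      linear_combination H.prod_eq

theorem psiAct_zero (ε : Sgn) : psiAct k r c q₁ q₂ q₃ u ε 0 = level k q₃ ε • 1 := by
  refine end_ext fun lam hS => ?_
  obtain ⟨N, hN⟩ := exists_settled hS
  rw [H.psiAct_vec ε 0 hS hN, H.zcoeff_psiSer_zero]
  rfl

theorem f_f (n m : ℤ) :
    gCoeff q₁ q₂ q₃ (fun j i => fAct k r c q₁ q₂ q₃ u i * fAct k r c q₁ q₂ q₃ u j) m n =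
      -gCoeff q₁ q₂ q₃ (fun i j => fAct k r c q₁ q₂ q₃ u j * fAct k r c q₁ q₂ q₃ u i) n m := by
  have h := (H.isCurrent_f (c := c)).quadratic n m
  have h1 := gCoeff_swap H.prod_eq
    (fun i j => fAct k r c q₁ q₂ q₃ u i * fAct k r c q₁ q₂ q₃ u j) n m
  have h2 := gCoeff_swap H.prod_eq
    (fun j i => fAct k r c q₁ q₂ q₃ u j * fAct k r c q₁ q₂ q₃ u i) m n
  rw [h1, h, h2]

theorem freeAct_rel {a b : Free} (h : Rel q₁ q₂ q₃ a b) :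
    freeAct k r c q₁ q₂ q₃ u a = freeAct k r c q₁ q₂ q₃ u b := by
  have he : ∀ i, freeAct k r c q₁ q₂ q₃ u (eF i) = eAct k r c q₁ q₂ q₃ u i := fun i =>
    FreeAlgebra.lift_ι_apply _ _
  have hf : ∀ i, freeAct k r c q₁ q₂ q₃ u (fF i) = fAct k r c q₁ q₂ q₃ u i := fun i =>
    FreeAlgebra.lift_ι_apply _ _
  have hi : ∀ ε, freeAct k r c q₁ q₂ q₃ u (psiInvF ε) = (level k q₃ ε)⁻¹ • 1 := fun ε =>
    FreeAlgebra.lift_ι_apply _ _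
  have hψ : ∀ ε i, freeAct k r c q₁ q₂ q₃ u (psiF ε i) = _ := freeAct_psiF c
  cases h with
  | ee n m =>
    rw [map_neg, map_gCoeff_mul, map_gCoeff_mul]
    simp only [he]
    exact (H.isCurrent_e (c := c)).quadratic n m
  | ff n m =>
    rw [map_neg, map_gCoeff_mul, map_gCoeff_mul]
    simp only [hf]
    exact H.f_f c n m
  | psie ε n m =>
    rw [map_neg, map_gCoeff_mul, map_gCoeff_mul]
    simp only [he, hψ]
    exact H.psi_e c ε n m
  | psif ε n m =>
    rw [map_neg, map_gCoeff_mul, map_gCoeff_mul]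
    simp only [hf, hψ]
    exact H.psi_f c ε n m
  | ef n m =>
    simp only [map_smul, map_sub, map_mul, he, hf, hψ]
    exact H.e_f c n m
  | psipsi ε ε' n m =>
    simp only [map_mul, hψ]
    exact H.psiAct_comm ε ε' n m
  | psi_inv ε =>
    rw [map_mul, map_one, hψ, hi, H.psiAct_zero, smul_mul_smul_comm, one_mul,
      mul_inv_cancel₀ (H.level_ne_zero ε), one_smul]
  | inv_psi ε =>
    rw [map_mul, map_one, hψ, hi, H.psiAct_zero, smul_mul_smul_comm, one_mul,
      inv_mul_cancel₀ (H.level_ne_zero ε), one_smul]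
  | serre_e =>
    rw [map_zero, map_bracket, map_bracket, he, he, he]
    exact (H.isCurrent_e (c := c)).serre
  | serre_f =>
    rw [map_zero, map_bracket, map_bracket, hf, hf, hf]
    exact (H.isCurrent_f (c := c)).serre

/-- The action of `𝓔` on `W^{k,r}_c(u)`. -/
def rep : Alg q₁ q₂ q₃ →ₐ[ℂ] Module.End ℂ (W k r c) :=
  ((toW k r c).conjAlgEquiv ℂ).toAlgHom.comp
    (RingQuot.liftAlgHom ℂ ⟨freeAct k r c q₁ q₂ q₃ u, fun _ _ h => H.freeAct_rel c h⟩)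

theorem rep_gen (x : Gen) (v : U k r c) :
    H.rep c (gen q₁ q₂ q₃ x) (toW k r c v) = toW k r c (genAct k r c q₁ q₂ q₃ u x v) := by
  rw [rep, gen, AlgHom.comp_apply, RingQuot.liftAlgHom_mkAlgHom_apply, freeAct,
    FreeAlgebra.lift_ι_apply]
  change toW k r c (genAct k r c q₁ q₂ q₃ u x ((toW k r c).symm (toW k r c v))) = _
  rw [LinearEquiv.symm_apply_apply]

theorem isLimitAction_rep : IsLimitAction u (H.rep c) := by
  intro lam
  obtain ⟨N₀, hN₀⟩ := exists_settled lam.2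
  filter_upwards [eventually_ge_atTop (N₀ + 1)] with N hN
  have hN' := hN₀.mono (by omega : N₀ ≤ N)
  have hw : ketW lam = toW k r c (vec k r c lam.1) := by rw [vec_of_mem lam.2, toW_single]
  rw [hw]
  simp only [H.rep_gen]
  refine ⟨fun n => ?_, fun n => ?_, fun ε j => ?_⟩
  · rw [← trunc, H.eOp_trunc]
    exact (H.isCurrent_e (c := c)).step.represents lam.2 hN' n
  · rw [← trunc, H.fOp_trunc (by omega) hN']
    exact (H.isCurrent_f (c := c)).step.represents lam.2 hN' n
  · rw [← trunc, H.psiOp_trunc (by omega) hN']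
    have h : genAct k r c q₁ q₂ q₃ u (Gen.psi ε j) (vec k r c lam.1) =
        PowerSeries.coeff j (psiSer q₁ q₂ q₃ u k ε N lam.1) • vec k r c lam.1 := by
      cases ε
      · rw [genAct, H.psiAct_vec _ _ lam.2 hN']
        simp [zcoeff]
      · rw [genAct, H.psiAct_vec _ _ lam.2 hN']
        simp [zcoeff]
    rw [h]
    exact (represents_trunc H.one_le lam.2 fun i hi => hN'.2 i (by omega)).smul _

theorem hasLevel_rep : HasLevel (H.rep c) 1 (q₃ ^ k) := by
  have h : ∀ ε v, H.rep c (gen q₁ q₂ q₃ (Gen.psi ε 0)) v = level k q₃ ε • v := by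
    intro ε v
    obtain ⟨x, rfl⟩ := (toW k r c).surjective v
    have hx : genAct k r c q₁ q₂ q₃ u (Gen.psi ε 0) = level k q₃ ε • 1 := by
      rw [← H.psiAct_zero c ε]
      cases ε <;> rfl
    rw [H.rep_gen, hx, ← map_smul]
    rfl
  exact ⟨h Sgn.plus, h Sgn.minus⟩

end Resonant

theorem end_ext_ketW {k r : ℕ} {c : ℕ → ℤ} {X Y : Module.End ℂ (W k r c)}
    (h : ∀ lam, X (ketW lam) = Y (ketW lam)) : X = Y := by
  have e : X.comp (toW k r c).toLinearMap = Y.comp (toW k r c).toLinearMap := by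
    refine Finsupp.lhom_ext' fun lam => LinearMap.ext_ring ?_
    have := h lam
    rwa [← toW_single] at this
  refine LinearMap.ext fun w => ?_
  obtain ⟨x, rfl⟩ := (toW k r c).surjective w
  exact LinearMap.congr_fun e x

/-- The limit formula determines the module structure: it determines `e`, `f` and `ψ^±`, and the
inverses of `ψ^±_0` are unique. -/
theorem IsLimitAction.unique {k r : ℕ} {q₁ q₂ q₃ u : ℂ} {c : ℕ → ℤ}
    {ρ ρ' : Alg q₁ q₂ q₃ →ₐ[ℂ] Module.End ℂ (W k r c)} (h : IsLimitAction u ρ)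
    (h' : IsLimitAction u ρ') : ρ' = ρ := by
  have he : ∀ i, ρ' (gen q₁ q₂ q₃ (Gen.e i)) = ρ (gen q₁ q₂ q₃ (Gen.e i)) := fun i =>
    end_ext_ketW fun lam => by
      obtain ⟨N, h1, h2⟩ := ((h lam).and (h' lam)).exists
      exact (h2.1 i).unique (h1.1 i)
  have hf : ∀ i, ρ' (gen q₁ q₂ q₃ (Gen.f i)) = ρ (gen q₁ q₂ q₃ (Gen.f i)) := fun i =>
    end_ext_ketW fun lam => by
      obtain ⟨N, h1, h2⟩ := ((h lam).and (h' lam)).exists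
      exact (h2.2.1 i).unique (h1.2.1 i)
  have hψ : ∀ ε j, ρ' (gen q₁ q₂ q₃ (Gen.psi ε j)) = ρ (gen q₁ q₂ q₃ (Gen.psi ε j)) := fun ε j =>
    end_ext_ketW fun lam => by
      obtain ⟨N, h1, h2⟩ := ((h lam).and (h' lam)).exists
      exact (h2.2.2 ε j).unique (h1.2.2 ε j)
  have h0 : ∀ ε, psiF ε 0 = FreeAlgebra.ι ℂ (Gen.psi ε 0) := by
    intro ε
    cases ε <;> simp [psiF]
  have r1 : ∀ ε, gen q₁ q₂ q₃ (Gen.psi ε 0) * gen q₁ q₂ q₃ (Gen.psiInv ε) = 1 := by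
    intro ε
    have := RingQuot.mkAlgHom_rel ℂ (Rel.psi_inv (q₁ := q₁) (q₂ := q₂) (q₃ := q₃) ε)
    rwa [map_mul, map_one, h0] at this
  have r2 : ∀ ε, gen q₁ q₂ q₃ (Gen.psiInv ε) * gen q₁ q₂ q₃ (Gen.psi ε 0) = 1 := by
    intro ε
    have := RingQuot.mkAlgHom_rel ℂ (Rel.inv_psi (q₁ := q₁) (q₂ := q₂) (q₃ := q₃) ε)
    rwa [map_mul, map_one, h0] at this
  refine RingQuot.ringQuot_ext' ℂ _ _ (FreeAlgebra.hom_ext (funext fun x => ?_))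
  change ρ' (gen q₁ q₂ q₃ x) = ρ (gen q₁ q₂ q₃ x)
  cases x with
  | e i => exact he i
  | f i => exact hf i
  | psi ε j => exact hψ ε j
  | psiInv ε =>
    refine left_inv_eq_right_inv (a := ρ (gen q₁ q₂ q₃ (Gen.psi ε 0))) ?_ ?_
    · rw [← hψ, ← map_mul, r2, map_one]
    · rw [← map_mul, r1, map_one]

end QuantumGlInf

end

theorem theorem6p3 (k r : ℕ) (hk : 1 ≤ k) (hr : 2 ≤ r) (q₁ q₂ q₃ u : ℂ)
    (hq : q₁ * q₂ * q₃ = 1) (hu : u ≠ 0)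
    (hres : q₁ ^ (1 - (r : ℤ)) * q₃ ^ ((k : ℤ) + 1) = 1)
    (hgen : ∀ n m : ℤ, q₁ ^ n * q₃ ^ m = 1 ↔
      ∃ α : ℤ, n = (1 - (r : ℤ)) * α ∧ m = ((k : ℤ) + 1) * α)
    (c : ℕ → ℤ) (hc0 : c 0 = 0) (hc : ∀ i j : ℕ, i ≤ j → j < k → c i ≤ c j)
    (hcr : ∀ i : ℕ, i < k → c i ≤ (r : ℤ)) :
    ∃ ρ : QuantumGlInf.Alg q₁ q₂ q₃ →ₐ[ℂ] Module.End ℂ (QuantumGlInf.W k r c),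
      QuantumGlInf.IsLimitAction u ρ ∧
      QuantumGlInf.HasLevel ρ 1 (q₃ ^ k) ∧
      ∀ ρ' : QuantumGlInf.Alg q₁ q₂ q₃ →ₐ[ℂ] Module.End ℂ (QuantumGlInf.W k r c),
        QuantumGlInf.IsLimitAction u ρ' → ρ' = ρ := by
  have H : QuantumGlInf.Resonant k r q₁ q₂ q₃ u := ⟨hk, hr, hq, hu, hgen⟩
  exact ⟨H.rep c, H.isLimitAction_rep c, H.hasLevel_rep c, fun _ h =>
    (H.isLimitAction_rep c).unique h⟩
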